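/- \textbf{Setting.} Let $D=[0,1]$ with Lebesgue measure, let $\alpha\ge 1$ be an integer and $c\in[0,1]$. Let $K=K_{\alpha,c}$ be the reproducing kernel of the Hilbert space of functions on $[0,1]$ with $f(c)=0$ and inner product $\sum_{r=1}^{\alpha-1}f^{(r)}(c)g^{(r)}(c)+\int_0^1 f^{(\alpha)}g^{(\alpha)}$, that is, $$K(x,y)=\sum_{r=1}^{\alpha-1}\frac{(x-c)^r}{r!}\frac{(y-c)^r}{r!}+R(x,y),$$ where $R(x,y)=\int_c^1\frac{(x-t)_+^{\alpha-1}(y-t)_+^{\alpha-1}}{((\alpha-1)!)^2}\,dt$ if $x,y>c$, $R(x,y)=\int_0^c\frac{(t-x)_+^{\alpha-1}(t-y)_+^{\alpha-1}}{((\alpha-1)!)^2}\,dt$ if $x,y<c$, and $R(x,y)=0$ otherwise; here $(z)_+^0=1_{z>0}$. Let $C_0=\int_0^1\int_0^1K(x,y)\,dx\,dy$. Let $\boldsymbol\gamma=(\gamma_u)$, indexed by the finite sets $u\subset\mathbb N$, be POD weights: $\gamma_u=\Gamma_{|u|}\prod_{j\in u}\gamma_j$ with $\gamma_1\ge\gamma_2\ge\dots\ge0$,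 $\Gamma_0=\Gamma_1=1$, $\Gamma_k\ge 0$, and $\gamma_u>0$ for at least one $u\ne\emptyset$. Let $u_1,u_2,\dots$ be the distinct sets $u$ with $|u|=1$ and $\gamma_u>0$, ordered such that $\gamma_{u_1}C_0^{|u_1|}\ge\gamma_{u_2}C_0^{|u_2|}\ge\dots$, and let $d:=\mathrm{decay}_{\boldsymbol\gamma,1}=\sup\{p\in\mathbb R:\lim_{j\to\infty}\gamma_{u_j}C_0^{|u_j|}j^p=0\}$, with $d=\infty$ if there are only finitely many $u_j$. Assume $d>1$, and that there are a real number $q<d$ and a constant $C_q>0$ with $\Gamma_k\le C_q(k!)^q$ for all $k\ge 1$. Let $\mathfrak X=\{x\in[0,1]^{\mathbb N}:\sum_u\gamma_u\prod_{j\in u}K(x_j,x_j)<\infty\}$, let $\mathcal H_{\boldsymbol\gamma}$ be the reproducing kernel Hilbert space on $\mathfrak X$ with kernel $\sum_u\gamma_u\prod_{j\in u}K(x_j,y_j)$, and let $I(f)=\int_{\mathfrak X}f\,d\mu$, where $\mu$ is the infinite product of Lebesgue measure on $[0,1]$. Algorithms are of the form $Q(f)=\sum_{i=1}^na_if(x^{(i)})$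 with $n\ge 0$, $a_i\in\mathbb R$ and points $x^{(i)}\in[0,1]^{\mathbb N}$ with only finitely many coordinates different from $c$; their worst case error is $e(Q)=\sup_{\|f\|\le1}|I(f)-Q(f)|$. Let $\$:\mathbb N_0\to[1,\infty)$ be non-decreasing with $\$(k)=\Theta(k^s)$ for some $s\ge0$. In the nested subspace sampling model $$\mathrm{cost}_{\mathrm{nest}}(Q)=\inf_{w}\sum_{i=1}^n\inf\{\$(|w_l|): x^{(i)}_j=c\ \ \forall j\notin w_l\},$$ the outer infimum being over all strictly increasing sequences $w_1\subset w_2\subset\cdots$ of finite subsets of $\mathbb N$. The problem is strongly tractable if there are $C,p\ge0$ with $\inf\{\mathrm{cost}_{\mathrm{nest}}(Q):e(Q)\le\varepsilon\}\le C\varepsilon^{-p}$ for all $\varepsilon>0$, and $p^{\mathrm{nest}}$ is the infimum of all such $p$. Let $b$ be a prime, $L\in\mathbb N$ with $L\ge 1$, and $a>1$; put $L_0=0$, $L_k=L\lceil a^{k-1}\rceil$ for $k\ge 1$, and $v_k=\{1,\dots,L_k\}$. A digitally shifted polynomial lattice rule with $b^m$ points, $m\ge1$, consists of an irreducible modulus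 $p\in\mathbb F_b[x]$ of degree $n\ge m$, generating polynomials $q_j\in\mathbb F_b[x]$ and shifts $\sigma_j\in[0,1)$; the $j$th coordinate of its point number $h$, $0\le h<b^m$, is the digit-wise sum modulo $b$ (in base $b$) of $\sigma_j$ and $\sum_{l=1}^nt_lb^{-l}$, where $t_l$ is the coefficient of $x^{-l}$ in the Laurent series of $h(x)q_j(x)/p(x)$ and $h(x)=\sum_r h_rx^r$ for $h=\sum_r h_rb^r$. A QMC multilevel algorithm is $$Q^{\mathrm{ML}}(f)=f(\mathbf c)+\sum_{k=1}^{M}\frac1{n_k}\sum_{h=0}^{n_k-1}\Big(f\big(t^{(h,k)}_{v_k};\mathbf c\big)-f\big(t^{(h,k)}_{v_{k-1}};\mathbf c\big)\Big),\qquad n_k=b^{m_k},\quad n_1\ge n_2\ge\dots\ge n_M,$$ where $(t_v;\mathbf c)$ has the coordinates of $t$ in $v$ and $c$ elsewhere, and for each $k$ the $t^{(h,k)}$ are the points of a polynomial lattice rule which either is unshifted with modulus of degree $\alpha m_k$, or is digitally shifted with modulus of degree $m_k$. We say that these algorithms attain $V\in[0,\infty)$ if for all $b,L,a$ as above and every $p>V$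 there is a $C$ such that for every $\varepsilon\in(0,1]$ there is a QMC multilevel algorithm with parameters $b,L,a$ whose worst case error is at most $\varepsilon$ and whose nested cost is at most $C\varepsilon^{-p}$. \textbf{Statement.} The problem is strongly tractable in the nested subspace sampling model, and the following holds, where $2s/(d-1)=0$ if $d=\infty$. If $s\ge(2\alpha-1)/(2\alpha)$, then $p^{\mathrm{nest}}=\max\{1/\alpha,\,2s/(d-1)\}$, and the QMC multilevel algorithms attain this value. If $0\le s<(2\alpha-1)/(2\alpha)$, then: (i) if $d\ge2\alpha$, then $p^{\mathrm{nest}}=1/\alpha$, and the QMC multilevel algorithms attain this value; (ii) if $2\alpha>d>1/(1-s)$, then $\max\{1/\alpha,\,2s/(d-1)\}\le p^{\mathrm{nest}}\le 2/d$, and the QMC multilevel algorithms attain $2/d$; (iii) if $1/(1-s)\ge d>1$, then $p^{\mathrm{nest}}=2s/(d-1)$, and the QMC multilevel algorithms attain this value. -/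

import Mathlib

open MeasureTheory Filter Topology
open scoped NNReal ENNReal unitInterval Polynomial LaurentSeries

noncomputable section

namespace InfInt

/-! Coordinates are numbered `0, 1, 2, …`, so `{1, …, n}` becomes `Finset.range n`. -/

/-! ### The univariate anchored Sobolev kernel of smoothness `α` on `D = [0,1]` -/

/-- `(x - t)_+ ^ k`, with the convention `(x - t)_+ ^ 0 = 1_{x > t}`. -/
def posPow (x t : ℝ) (k : ℕ) : ℝ := if t < x then (x - t) ^ k else 0

/-- The reproducing kernel of the space of functions on `[0,1]` with `f c = 0` and inner product
`∑_{r=1}^{α-1} f^{(r)}(c) g^{(r)}(c) + ∫_0^1 f^{(α)} g^{(α)}`. -/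
def sobKernel (α : ℕ) (c x y : I) : ℝ :=
  (∑ r ∈ Finset.Ico 1 α,
      (((x : ℝ) - c) ^ r / r.factorial) * (((y : ℝ) - c) ^ r / r.factorial)) +
    (if c < x ∧ c < y then
      ∫ t in (c : ℝ)..1, (posPow x t (α - 1) / (α - 1).factorial) *
        (posPow y t (α - 1) / (α - 1).factorial)
    else if x < c ∧ y < c then
      ∫ t in (0 : ℝ)..c, (posPow t x (α - 1) / (α - 1).factorial) *
        (posPow t y (α - 1) / (α - 1).factorial)
    else 0)

/-! ### Kernels in infinitely many variables -/

/-- `K_u(x,y) = ∏_{j ∈ u} K(x_j, y_j)`. -/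
def prodKernel (K : I → I → ℝ) (u : Finset ℕ) (x y : ℕ → I) : ℝ := ∏ j ∈ u, K (x j) (y j)

/-- The domain of the functions of infinitely many variables. -/
def domain (K : I → I → ℝ) (γ : Finset ℕ → ℝ≥0) : Set (ℕ → I) :=
  {x | Summable fun u : Finset ℕ => (γ u : ℝ) * prodKernel K u x x}

/-- The weighted kernel (inactive sets, `γ u = 0`, contribute nothing). -/
def weightedKernel (K : I → I → ℝ) (γ : Finset ℕ → ℝ≥0) (x y : ℕ → I) : ℝ :=
  ∑' u : Finset ℕ, (γ u : ℝ) * prodKernel K u x y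

/-- The weighted kernel on the domain, in the operator-valued format of Mathlib's `RKHS`. -/
def kernelMatrix (α : ℕ) (c : I) (γ : Finset ℕ → ℝ≥0) :
    Matrix (domain (sobKernel α c) γ) (domain (sobKernel α c) γ) (ℝ →L[ℝ] ℝ) :=
  Matrix.of fun x y => weightedKernel (sobKernel α c) γ x y • (1 : ℝ →L[ℝ] ℝ)

/-! #### Positive semidefiniteness of the weighted kernel -/

def IsPSD {X : Type} (k : X → X → ℝ) : Prop :=
  (∀ x y, k x y = k y x) ∧
    ∀ (s : Finset X) (a : X → ℝ), 0 ≤ ∑ x ∈ s, ∑ y ∈ s, a x * a y * k x y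

theorem IsPSD.add {X : Type} {k l : X → X → ℝ} (hk : IsPSD k) (hl : IsPSD l) :
    IsPSD fun x y => k x y + l x y := by
  refine ⟨fun x y => by simp only [hk.1 x y, hl.1 x y], fun s a => ?_⟩
  simp only [mul_add, Finset.sum_add_distrib]
  exact add_nonneg (hk.2 s a) (hl.2 s a)

theorem IsPSD.finsum {X ι : Type} {k : ι → X → X → ℝ} (hk : ∀ i, IsPSD (k i)) (t : Finset ι) :
    IsPSD fun x y => ∑ i ∈ t, k i x y := by
  refine ⟨fun x y => Finset.sum_congr rfl fun i _ => (hk i).1 x y, fun s a => ?_⟩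
  have : ∑ x ∈ s, ∑ y ∈ s, a x * a y * ∑ i ∈ t, k i x y
      = ∑ i ∈ t, ∑ x ∈ s, ∑ y ∈ s, a x * a y * k i x y := by
    simp only [Finset.mul_sum]
    rw [Finset.sum_comm (s := t)]
    refine Finset.sum_congr rfl fun x _ => ?_
    rw [Finset.sum_comm]
  rw [this]
  exact Finset.sum_nonneg fun i _ => (hk i).2 s a

theorem IsPSD.mul_rankOne {X : Type} {k : X → X → ℝ} (hk : IsPSD k) (f : X → ℝ) :
    IsPSD fun x y => k x y * (f x * f y) := by
  refine ⟨fun x y => by simp only [hk.1 x y]; ring, fun s a => ?_⟩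
  have := hk.2 s fun x => a x * f x
  refine this.trans_eq (Finset.sum_congr rfl fun x _ => Finset.sum_congr rfl fun y _ => ?_)
  ring

theorem IsPSD.mul_integral {X : Type} {k : X → X → ℝ} (hk : IsPSD k) (f : X → ℝ)
    (g : X → ℝ → ℝ) {p q : ℝ} (hpq : p ≤ q)
    (hg : ∀ x y, IntervalIntegrable (fun t => g x t * g y t) volume p q) :
    IsPSD fun x y => k x y * ((f x * f y) * ∫ t in p..q, g x t * g y t) := by
  refine ⟨fun x y => ?_, fun s a => ?_⟩
  · simp only [hk.1 x y, mul_comm (f x) (f y), mul_comm (g x _) (g y _)]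
  · have : ∑ x ∈ s, ∑ y ∈ s, a x * a y * (k x y * ((f x * f y) * ∫ t in p..q, g x t * g y t))
        = ∫ t in p..q, ∑ x ∈ s, ∑ y ∈ s,
            (a x * a y * (k x y * (f x * f y))) * (g x t * g y t) := by
      rw [intervalIntegral.integral_finsetSum]
      · refine Finset.sum_congr rfl fun x _ => ?_
        rw [intervalIntegral.integral_finsetSum]
        · refine Finset.sum_congr rfl fun y _ => ?_
          rw [intervalIntegral.integral_const_mul]
          ring
        · exact fun y _ => (hg x y).const_mul _
      · intro x _
        have h := IntervalIntegrable.sum s (f := fun y t =>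
          (a x * a y * (k x y * (f x * f y))) * (g x t * g y t))
          fun y _ => (hg x y).const_mul _
        refine h.congr ?_
        exact fun t _ => by simp
    rw [this]
    refine intervalIntegral.integral_nonneg hpq fun t _ => ?_
    have := hk.2 s fun x => a x * f x * g x t
    refine this.trans_eq (Finset.sum_congr rfl fun x _ => Finset.sum_congr rfl fun y _ => ?_)
    ring

theorem posPow_abs_le {x t : ℝ} (hx : x ∈ Set.Icc (0 : ℝ) 1) (ht : t ∈ Set.Icc (0 : ℝ) 1)
    (k : ℕ) : |posPow x t k| ≤ 1 := by
  unfold posPow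
  split_ifs with h
  · rw [abs_of_nonneg (pow_nonneg (by linarith) _)]
    exact pow_le_one₀ (by linarith) (by linarith [hx.2, ht.1])
  · simp

theorem intervalIntegrable_aux {g : ℝ → ℝ} (hg : Measurable g) {p q C : ℝ}
    (hp : p ∈ Set.Icc (0 : ℝ) 1) (hq : q ∈ Set.Icc (0 : ℝ) 1)
    (hC : ∀ t ∈ Set.Icc (0 : ℝ) 1, |g t| ≤ C) : IntervalIntegrable g volume p q := by
  have : IntegrableOn g (Set.Icc 0 1) := by
    refine Measure.integrableOn_of_bounded (M := C) (by simp) hg.aestronglyMeasurable ?_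
    exact (ae_restrict_iff' measurableSet_Icc).2 (Eventually.of_forall fun t ht => hC t ht)
  rw [intervalIntegrable_iff]
  refine this.mono_set fun t ht => ?_
  rw [Set.mem_uIoc] at ht
  rcases ht with ht | ht
  · exact ⟨by linarith [hp.1], by linarith [hq.2]⟩
  · exact ⟨by linarith [hq.1], by linarith [hp.2]⟩

theorem measurable_posPow_right (x : ℝ) (k : ℕ) : Measurable fun t => posPow x t k :=
  Measurable.ite measurableSet_Iio (by fun_prop) measurable_const

theorem measurable_posPow_left (x : ℝ) (k : ℕ) : Measurable fun t => posPow t x k :=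
  Measurable.ite measurableSet_Ioi (by fun_prop) measurable_const

theorem abs_div_factorial_mul_le {a b : ℝ} (ha : |a| ≤ 1) (hb : |b| ≤ 1) (n : ℕ) :
    |a / n.factorial * (b / n.factorial)| ≤ 1 := by
  have hn : (1 : ℝ) ≤ n.factorial := by exact_mod_cast n.factorial_pos
  have h : ∀ z : ℝ, |z| ≤ 1 → |z / n.factorial| ≤ 1 := fun z hz => by
    rw [abs_div, abs_of_pos (by linarith : (0 : ℝ) < n.factorial)]
    exact div_le_one_of_le₀ (hz.trans hn) (by linarith)
  rw [abs_mul]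
  exact mul_le_one₀ (h a ha) (abs_nonneg _) (h b hb)

theorem IsPSD.mul_sobKernel {X : Type} {k : X → X → ℝ} (hk : IsPSD k) (φ : X → I) (α : ℕ) (c : I) :
    IsPSD fun x y => k x y * sobKernel α c (φ x) (φ y) := by
  have h1 := IsPSD.finsum (fun r : ℕ => hk.mul_rankOne
    fun x => ((φ x : ℝ) - c) ^ r / r.factorial) (Finset.Ico 1 α)
  have h2 := hk.mul_integral (fun x => if c < φ x then 1 else 0)
    (fun x t => posPow (φ x) t (α - 1) / (α - 1).factorial) c.2.2 (fun x y =>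
      intervalIntegrable_aux (C := 1)
        (((measurable_posPow_right _ _).div_const _).mul
          ((measurable_posPow_right _ _).div_const _)) c.2 (by simp)
        fun t ht => abs_div_factorial_mul_le (posPow_abs_le (φ x).2 ht _)
          (posPow_abs_le (φ y).2 ht _) _)
  have h3 := hk.mul_integral (fun x => if φ x < c then 1 else 0)
    (fun x t => posPow t (φ x) (α - 1) / (α - 1).factorial) c.2.1 (fun x y =>
      intervalIntegrable_aux (C := 1)
        (((measurable_posPow_left _ _).div_const _).mul
          ((measurable_posPow_left _ _).div_const _)) (by simp) c.2
        fun t ht => abs_div_factorial_mul_le (posPow_abs_le ht (φ x).2 _)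
          (posPow_abs_le ht (φ y).2 _) _)
  have h := (h1.add h2).add h3
  refine (congrArg IsPSD (funext fun x => funext fun y => ?_)).mp h
  rw [← Finset.mul_sum, sobKernel, ← mul_add, ← mul_add, add_assoc]
  congr 2
  rcases lt_trichotomy c (φ x) with hx | hx | hx <;>
    rcases lt_trichotomy c (φ y) with hy | hy | hy <;>
    simp [hx, hy, hx.not_gt, hy.not_gt]

theorem isPSD_prodKernel (α : ℕ) (c : I) (u : Finset ℕ) :
    IsPSD (prodKernel (sobKernel α c) u) := by
  classical
  induction u using Finset.induction_on with
  | empty =>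
    refine ⟨fun x y => by simp [prodKernel], fun s a => ?_⟩
    have : ∑ x ∈ s, ∑ y ∈ s, a x * a y * prodKernel (sobKernel α c) ∅ x y = (∑ x ∈ s, a x) ^ 2 := by
      simp [prodKernel, sq, Finset.sum_mul_sum]
    rw [this]
    positivity
  | insert j u hj ih =>
    have := ih.mul_sobKernel (fun x => x j) α c
    convert this using 3 with x y
    simp [prodKernel, Finset.prod_insert hj, mul_comm]

theorem IsPSD.abs_le_diag {X : Type} {k : X → X → ℝ} (hk : IsPSD k) (x y : X) :
    |k x y| ≤ k x x + k y y := by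
  classical
  have hd : ∀ z, 0 ≤ k z z := fun z => by simpa using hk.2 {z} 1
  by_cases hxy : x = y
  · subst hxy
    rw [abs_of_nonneg (hd x)]
    linarith [hd x]
  · have hs := hk.1 x y
    have h1 := hk.2 {x, y} 1
    have h2 := hk.2 {x, y} fun z => if z = x then 1 else -1
    simp [Finset.sum_pair hxy, Ne.symm hxy] at h1 h2
    rw [abs_le]
    constructor <;> linarith [hd x, hd y]

theorem summable_weightedKernel (α : ℕ) (c : I) (γ : Finset ℕ → ℝ≥0)
    (x y : domain (sobKernel α c) γ) :
    Summable fun u : Finset ℕ => (γ u : ℝ) * prodKernel (sobKernel α c) u x y := by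
  refine Summable.of_norm_bounded (Summable.add x.2 y.2) fun u => ?_
  rw [Real.norm_eq_abs, abs_mul, NNReal.abs_eq, ← mul_add]
  exact mul_le_mul_of_nonneg_left ((isPSD_prodKernel α c u).abs_le_diag x y) (γ u).2

theorem isPSD_weightedKernel (α : ℕ) (c : I) (γ : Finset ℕ → ℝ≥0) :
    IsPSD fun x y : domain (sobKernel α c) γ => weightedKernel (sobKernel α c) γ x y := by
  refine ⟨fun x y => ?_, fun s a => ?_⟩
  · simp only [weightedKernel]
    exact tsum_congr fun u => by rw [(isPSD_prodKernel α c u).1]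
  · have hsum : HasSum (fun u : Finset ℕ => ∑ x ∈ s, ∑ y ∈ s,
        a x * a y * ((γ u : ℝ) * prodKernel (sobKernel α c) u x y))
        (∑ x ∈ s, ∑ y ∈ s, a x * a y * weightedKernel (sobKernel α c) γ x y) :=
      hasSum_sum fun x _ => hasSum_sum fun y _ =>
        (summable_weightedKernel α c γ x y).hasSum.mul_left _
    refine hsum.nonneg fun u => ?_
    classical
    have h := (isPSD_prodKernel α c u).2 (s.map ⟨Subtype.val, Subtype.val_injective⟩)
      fun z => if hz : z ∈ domain (sobKernel α c) γ then a ⟨z, hz⟩ else 0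
    simp only [Finset.sum_map, Function.Embedding.coeFn_mk, Subtype.coe_prop, dite_true,
      Subtype.coe_eta] at h
    have h' := mul_nonneg (NNReal.coe_nonneg (γ u)) h
    refine h'.trans_eq ?_
    rw [Finset.mul_sum]
    refine Finset.sum_congr rfl fun x _ => ?_
    rw [Finset.mul_sum]
    refine Finset.sum_congr rfl fun y _ => ?_
    ring

instance factPosSemidef (α : ℕ) (c : I) (γ : Finset ℕ → ℝ≥0) :
    Fact (kernelMatrix α c γ).PosSemidef := by
  constructor
  refine ((RKHS.posSemidef_tfae (K := kernelMatrix α c γ)).out 0 2).mpr (And.intro ?_ fun v => ?_)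
  · ext x y
    simp [kernelMatrix, (isPSD_weightedKernel α c γ).1 x y]
  · have := (isPSD_weightedKernel α c γ).2 v.support v
    simp only [Finsupp.sum, kernelMatrix, Matrix.of_apply]
    rw [RCLike.re_to_real]
    refine this.trans_eq (Finset.sum_congr rfl fun x _ => Finset.sum_congr rfl fun y _ => ?_)
    rw [(isPSD_weightedKernel α c γ).1 x y]
    simp
    ring

/-! ### The space of integrands and the integration functional -/

/-- The reproducing kernel Hilbert space of the weighted kernel. -/
abbrev Integrands (α : ℕ) (c : I) (γ : Finset ℕ → ℝ≥0) : Type :=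
  RKHS.OfKernel (kernelMatrix α c γ)

/-- The infinite product of the uniform distribution on `[0,1]`, restricted to the domain. -/
def domainMeasure (K : I → I → ℝ) (γ : Finset ℕ → ℝ≥0) : Measure (domain K γ) :=
  Measure.comap Subtype.val (Measure.infinitePi fun _ : ℕ => (volume : Measure I))

def integration (α : ℕ) (c : I) (γ : Finset ℕ → ℝ≥0) (f : Integrands α c γ) : ℝ :=
  ∫ x, f x ∂(domainMeasure (sobKernel α c) γ)

/-! ### Admissible algorithms, worst case error, cost -/

/-- The admissible sample points: sequences all but finitely many of whose entries are `c`. -/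
def SamplePoint (c : I) : Type := {x : ℕ → I // {j | x j ≠ c}.Finite}

theorem sobKernel_anchor (α : ℕ) (c : I) : sobKernel α c c c = 0 := by
  simp only [sobKernel, sub_self, lt_self_iff_false, and_self, if_false, add_zero]
  refine Finset.sum_eq_zero fun r hr => ?_
  have : r ≠ 0 := by have := (Finset.mem_Ico.1 hr).1; omega
  simp [this]

theorem samplePoint_mem_domain (α : ℕ) (c : I) (γ : Finset ℕ → ℝ≥0) (x : SamplePoint c) :
    x.1 ∈ domain (sobKernel α c) γ := by
  refine summable_of_ne_finset_zero (s := x.2.toFinset.powerset) fun u hu => ?_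
  rw [Finset.mem_powerset, Finset.not_subset] at hu
  obtain ⟨j, hj, hx⟩ := hu
  have hx : x.1 j = c := by simpa using hx
  rw [prodKernel, Finset.prod_eq_zero hj (by rw [hx, sobKernel_anchor]), mul_zero]

def SamplePoint.toDomain {c : I} (x : SamplePoint c) (α : ℕ) (γ : Finset ℕ → ℝ≥0) :
    domain (sobKernel α c) γ := ⟨x.1, samplePoint_mem_domain α c γ x⟩

/-- A linear algorithm `Q(f) = ∑ᵢ aᵢ f(xᵢ)` with finitely many (possibly no) admissible sample
points, given by the list of its coefficients and sample points. -/
abbrev Algorithm (c : I) : Type := List (ℝ × SamplePoint c)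

def Algorithm.apply {c : I} (Q : Algorithm c) (α : ℕ) (γ : Finset ℕ → ℝ≥0)
    (f : Integrands α c γ) : ℝ :=
  (Q.map fun ax => ax.1 * f (ax.2.toDomain α γ)).sum

/-- The worst case error over the unit ball of the space of integrands. -/
def worstCaseError {c : I} (α : ℕ) (γ : Finset ℕ → ℝ≥0) (Q : Algorithm c) : ℝ≥0∞ :=
  ⨆ f : Integrands α c γ, ⨆ _ : ‖f‖ ≤ 1, ENNReal.ofReal |integration α c γ f - Algorithm.apply Q α γ f|

/-- The cost of evaluating at `x` for a given increasing sequence of coordinate sets. -/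
def pointCost {c : I} (cost : ℕ → ℝ) (w : ℕ → Finset ℕ) (x : SamplePoint c) : ℝ≥0∞ :=
  ⨅ i : ℕ, ⨅ _ : ∀ j, j ∉ w i → x.1 j = c, ENNReal.ofReal (cost (w i).card)

/-- The cost of an algorithm in the nested subspace sampling model. -/
def nestedCost {c : I} (cost : ℕ → ℝ) (Q : Algorithm c) : ℝ≥0∞ :=
  ⨅ w : ℕ → Finset ℕ, ⨅ _ : StrictMono w, (Q.map fun ax => pointCost cost w ax.2).sum

/-! ### Strong tractability in the nested subspace sampling model -/

/-- The `ε`-complexity. -/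
def nestedComplexity (α : ℕ) (c : I) (γ : Finset ℕ → ℝ≥0) (cost : ℕ → ℝ) (ε : ℝ) : ℝ≥0∞ :=
  ⨅ Q : Algorithm c, ⨅ _ : worstCaseError α γ Q ≤ ENNReal.ofReal ε, nestedCost cost Q

def TractableWith (α : ℕ) (c : I) (γ : Finset ℕ → ℝ≥0) (cost : ℕ → ℝ) (p : ℝ) : Prop :=
  0 ≤ p ∧ ∃ C : ℝ, 0 ≤ C ∧
    ∀ ε : ℝ, 0 < ε → nestedComplexity α c γ cost ε ≤ ENNReal.ofReal (C * ε ^ (-p))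

def StronglyTractable (α : ℕ) (c : I) (γ : Finset ℕ → ℝ≥0) (cost : ℕ → ℝ) : Prop :=
  ∃ p : ℝ, TractableWith α c γ cost p

/-- The exponent of strong tractability (`⊤` if the problem is not strongly tractable). -/
def pNes (α : ℕ) (c : I) (γ : Finset ℕ → ℝ≥0) (cost : ℕ → ℝ) : EReal :=
  sInf {p : EReal | ∃ r : ℝ, p = r ∧ TractableWith α c γ cost r}

/-! ### Weights -/

/-- Product and order-dependent weights `γ_u = Γ_{|u|} ∏_{j ∈ u} γ_j`. -/
def podWeights (Γ γ : ℕ → ℝ≥0) (u : Finset ℕ) : ℝ≥0 := Γ u.card * ∏ j ∈ u, γ j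

/-- The cut-off weights of order `o`. -/
def cutOff (o : ℕ∞) (γ : Finset ℕ → ℝ≥0) (u : Finset ℕ) : ℝ≥0 :=
  if (u.card : ℕ∞) ≤ o then γ u else 0

/-- `C₀ = ∫∫ K(x,y) dx dy`. -/
def kernelMean (K : I → I → ℝ) : ℝ := ∫ x : I, ∫ y : I, K x y

/-- The weights `γ_u C₀^{|u|}`. -/
def hatWeights (K : I → I → ℝ) (γ : Finset ℕ → ℝ≥0) (u : Finset ℕ) : ℝ :=
  γ u * kernelMean K ^ u.card

/-- The non-empty active coordinate sets. -/
def activeSets (γ : Finset ℕ → ℝ≥0) : Set (Finset ℕ) := {u | u.Nonempty ∧ 0 < γ u}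

/-- `e 0, e 1, …` lists the non-empty active coordinate sets, each once, such that the hat weights
do not increase. If there are only `N` of these sets, the list is `e 0, …, e (N - 1)`. -/
def IsOrdering (K : I → I → ℝ) (γ : Finset ℕ → ℝ≥0) (e : ℕ → Finset ℕ) : Prop :=
  Set.BijOn e {j : ℕ | (j : ℕ∞) < (activeSets γ).encard} (activeSets γ) ∧
    AntitoneOn (fun j => hatWeights K γ (e j)) {j : ℕ | (j : ℕ∞) < (activeSets γ).encard}

open Classical in
/-- The decay `sup {p : lim_j γ̂_{u_j} j^p = 0}` of the cut-off weights of order `o`, in the extended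
reals; a finite list of active sets is continued by zeros, so that its decay is `⊤`. -/
def decay (K : I → I → ℝ) (γ : Finset ℕ → ℝ≥0) (o : ℕ∞) : EReal :=
  sSup {p : EReal | ∃ r : ℝ, p = r ∧ ∃ e, IsOrdering K (cutOff o γ) e ∧
    Tendsto (fun j : ℕ =>
      (if (j : ℕ∞) < (activeSets (cutOff o γ)).encard then hatWeights K (cutOff o γ) (e j) else 0) *
        ((j : ℝ) + 1) ^ r) atTop (𝓝 0)}

/-! ### Polynomial lattice rules -/

/-- The embedding of `F_b[x]` into `F_b((x⁻¹))`; the Laurent series are written in the variable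
`x⁻¹`, so that `x` becomes the monomial of degree `-1` and the coefficient of `x^{-l}` is `coeff l`. -/
def toLaurent (b : ℕ) (f : (ZMod b)[X]) : (ZMod b)⸨X⸩ :=
  Polynomial.aeval (HahnSeries.single (-1 : ℤ) (1 : ZMod b) : (ZMod b)⸨X⸩) f

/-- The map `ϑ_n`, `∑_l t_l x^{-l} ↦ ∑_{l=1}^n t_l b^{-l}`. -/
def truncEval (b n : ℕ) (S : (ZMod b)⸨X⸩) : ℝ :=
  ∑ l ∈ Finset.Icc 1 n, ((HahnSeries.coeff S (l : ℤ)).val : ℝ) / (b : ℝ) ^ l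

/-- The polynomial whose coefficients are the first `m` base `b` digits of `h`. -/
def digitPoly (b m h : ℕ) : (ZMod b)[X] :=
  ∑ r ∈ Finset.range m, Polynomial.C ((h / b ^ r % b : ℕ) : ZMod b) * Polynomial.X ^ r

/-- The digital `b`-adic shift `x ⊕ δ` of `x ∈ [0,1)` by `δ ∈ [0,1)`. -/
def digitalShift (b : ℕ) [NeZero b] (x δ : ℝ) : I :=
  ⟨Real.ofDigits fun i => Real.digits x b i + Real.digits δ b i,
    Real.ofDigits_nonneg _, Real.ofDigits_le_one _⟩

/-- A digitally shifted polynomial lattice rule with `b ^ m` points, with modulus of degree `n`.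
Generating vector and shift are given for all coordinates; a rule in dimension `L` uses only the
coordinates in `range L`. -/
structure PolyLatticeRule (b : ℕ) [Fact b.Prime] where
  m : ℕ
  n : ℕ
  one_le_m : 1 ≤ m
  m_le_n : m ≤ n
  modulus : (ZMod b)[X]
  irreducible_modulus : Irreducible modulus
  natDegree_modulus : modulus.natDegree = n
  gen : ℕ → (ZMod b)[X]
  shift : ℕ → ℝ
  shift_mem : ∀ j, shift j ∈ Set.Ico (0 : ℝ) 1

/-- Coordinate `j` of the `h`-th point of the rule, `0 ≤ h < b ^ m`. -/
def PolyLatticeRule.point {b : ℕ} [Fact b.Prime] (R : PolyLatticeRule b) (h j : ℕ) : I :=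
  digitalShift b
    (truncEval b R.n (toLaurent b (digitPoly b R.m h * R.gen j) / toLaurent b R.modulus))
    (R.shift j)

/-- The rules used for smoothness `α`: higher order rules without shift whose modulus has degree
`α m`, and digitally shifted classical rules, whose modulus has degree `m`. -/
def PolyLatticeRule.Suitable {b : ℕ} [Fact b.Prime] (R : PolyLatticeRule b) (α : ℕ) : Prop :=
  (R.n = α * R.m ∧ ∀ j, R.shift j = 0) ∨ R.n = R.m

/-! ### Quasi-Monte Carlo multilevel algorithms -/

/-- The point `(x_v; c)`. -/
def anchoredPoint (c : I) (v : Finset ℕ) (x : ℕ → I) : SamplePoint c :=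
  ⟨fun j => if j ∈ v then x j else c, v.finite_toSet.subset fun j hj => by
    by_contra h
    exact hj (if_neg (by simpa using h))⟩

/-- `L_0 = 0` and `L_k = L ⌈a^{k-1}⌉` for `k ≥ 1`. -/
def levelDim (L : ℕ) (a : ℝ) : ℕ → ℕ
  | 0 => 0
  | k + 1 => L * ⌈a ^ k⌉₊

/-- The multilevel algorithm
`f(c) + ∑_{k=1}^M b^{-m_k} ∑_{h < b^{m_k}} (f(t^{(h,k)}_{v_k}; c) - f(t^{(h,k)}_{v_{k-1}}; c))`
with `v_k = {1, …, L_k}`, where `t^{(h,k)}` are the points of the rule `R (k - 1)`. -/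
def multilevel {b : ℕ} [Fact b.Prime] (c : I) (L : ℕ) (a : ℝ) (M : ℕ)
    (R : ℕ → PolyLatticeRule b) : Algorithm c :=
  (1, anchoredPoint c ∅ fun _ => c) ::
    (List.range M).flatMap fun k => (List.range (b ^ (R k).m)).flatMap fun h =>
      [(((b : ℝ) ^ (R k).m)⁻¹,
          anchoredPoint c (Finset.range (levelDim L a (k + 1))) ((R k).point h)),
        (-((b : ℝ) ^ (R k).m)⁻¹,
          anchoredPoint c (Finset.range (levelDim L a k)) ((R k).point h))]

/-- Quasi-Monte Carlo multilevel algorithms built from suitable polynomial lattice rules, with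
non-increasing numbers `n_1 ≥ n_2 ≥ …` of points on the levels. -/
def IsQMCMultilevel (b : ℕ) [Fact b.Prime] (α : ℕ) (c : I) (L : ℕ) (a : ℝ)
    (Q : Algorithm c) : Prop :=
  ∃ (M : ℕ) (R : ℕ → PolyLatticeRule b), (∀ k < M, (R k).Suitable α) ∧
    (∀ k, k + 1 < M → (R (k + 1)).m ≤ (R k).m) ∧ Q = multilevel c L a M R

/-- The multilevel algorithms establish the upper bound `V` on the exponent of strong tractability:
for every `p > V` they reach error `ε` with nested cost `O(ε^{-p})`, for every prime base `b` and
every choice of the fixed parameters `L ∈ ℕ`, `a > 1` of the level dimensions. -/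
def MultilevelAttains (α : ℕ) (c : I) (γ : Finset ℕ → ℝ≥0) (cost : ℕ → ℝ) (V : EReal) : Prop :=
  ∀ (b : ℕ) [Fact b.Prime] (L : ℕ) (a : ℝ), 1 ≤ L → 1 < a → ∀ p : ℝ, V < p →
    ∃ C : ℝ, ∀ ε : ℝ, 0 < ε → ε ≤ 1 → ∃ Q : Algorithm c, IsQMCMultilevel b α c L a Q ∧
      worstCaseError α γ Q ≤ ENNReal.ofReal ε ∧ nestedCost cost Q ≤ ENNReal.ofReal (C * ε ^ (-p))

end InfInt

end

open InfInt

/-! The univariate kernel factors through a probability space: `K(x,y) = ∫ φ(x,ω) φ(y,ω) dν(ω)`,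
where the features `φ(·,ω)` are Taylor monomials and truncated powers, bounded by `√α`
(`sobKernel_eq_integral`). Products of features represent the product kernels, and the POD weights
make the weighted kernel sum converge uniformly. Hence the squared worst case error of `Q` is `∑_u
γ_u e_u(Q)²`, where `e_u(Q)²` is the mean square over `ω` of the plain integration error of `Q` for
the bounded function `∏_{j ∈ u} φ(x_j, ω_j)` (`worstCaseError_eq`). All estimates, from below and
from above, concern these numbers.

Lower bounds keep only singletons `u = {j}`. For `p ≥ 1/α`: `n` nodes leave many cells of a
partition free, and on a free cell the error is, as a function of the knot `t`, a polynomial of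
degree `α` with leading coefficient `± 1/α!`. Its finite differences of order `α` are bounded away
from `0`, so `e_{j}² ≥ C n^{-2α}` (`exists_le_integral_featErr_sq`, `ReachesWith.one_div_le`). For
`p ≥ 2s/(d-1)`: because the sampling spaces are nested, one affordable set `W` carries all sample
points, and each coordinate outside `W` contributes the full `γ_j C₀`. A low cost therefore forces
the weights to decay fast (`ReachesWith.exists_weight_le`, `le_decay`).

For the upper bound, a non-empty `u` is sorted by its largest element `i`. Since features vanish at
the anchor, the multilevel sum telescopes, and `e_u` is the error of the single rule on whose level
`i` lies; sets with `i` beyond the last level form the truncation error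
(`tsum_sqErr_multilevel_le`). The error of a rule is expanded in Walsh functions on the grid of
`b`-adic digits. The Walsh coefficients of the features decay with order `α`
(`IsPrimitiveChain.norm_walshCoeff_le`), and averaging over the points leaves only frequencies in
the dual net. A component-by-component averaging argument (`exists_dualSum_le`) yields squared
errors `O(N^{-2τ})` on `N` points for each `1/2 ≤ τ < min(α, d/2)`, with the factor `∑ γ_i` over the
level kept outside (`exists_rule_le`). Rules without shift of modulus degree `αm` serve `τ ≥ 1`,
shifted rules of degree `m` serve `τ < 1`.

Balancing the level sizes (`exists_level_parameters`) reaches every exponent `p` above `1/α`, `2/d`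
and `2s/(d-1)`. The regimes of the theorem record when the requirement from `2/d` is implied by
another one. -/

noncomputable section

/-! ### Feature representation of the univariate kernel -/

/-- The probability measure carrying the features of the univariate kernel: the points `r + 1`,
`1 ≤ r < α`, stand for the Taylor polynomials and `[0,1]` for the remainder. -/
def featMeasure (α : ℕ) : Measure ℝ :=
  (α : ℝ≥0∞)⁻¹ • (volume.restrict (Set.Icc 0 1) +
    ∑ r ∈ Finset.Ico 1 α, Measure.dirac ((r : ℝ) + 1))

/-- The remainder feature. -/
def remFeat (α : ℕ) (c x : I) (t : ℝ) : ℝ :=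
  (if (c : ℝ) < t then posPow x t (α - 1) else posPow t x (α - 1)) / (α - 1).factorial

/-- The Taylor features. -/
def polyFeat (c x : I) (r : ℕ) : ℝ := ((x : ℝ) - c) ^ r / r.factorial

/-- The values at `ω < 0` and at `ω > 1` off the atoms are invisible to `featMeasure`. They are
chosen so that the bound by `1` holds for every `ω`, which makes all later domination arguments
pointwise. The factor `√α` of `feat` compensates the normalisation of `featMeasure`. -/
def rawFeat (α : ℕ) (c x : I) (ω : ℝ) : ℝ :=
  if ω ≤ 1 then remFeat α c x ω
  else ∑ r ∈ Finset.Ico 1 α, if ω = r + 1 then polyFeat c x r else 0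

/-- The features `φ(x, ω)` of the univariate kernel. -/
def feat (α : ℕ) (c x : I) (ω : ℝ) : ℝ := √α * rawFeat α c x ω

theorem measurable_posPow_uncurry {X : Type*} [MeasurableSpace X] {f g : X → ℝ}
    (hf : Measurable f) (hg : Measurable g) (k : ℕ) :
    Measurable fun x => posPow (f x) (g x) k :=
  Measurable.ite (measurableSet_lt hg hf) ((hf.sub hg).pow_const k) measurable_const

theorem measurable_rawFeat_uncurry (α : ℕ) (c : I) :
    Measurable fun p : I × ℝ => rawFeat α c p.1 p.2 := by
  have h1 : Measurable fun p : I × ℝ => (p.1 : ℝ) := measurable_subtype_coe.comp measurable_fst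
  have h2 : Measurable fun p : I × ℝ => p.2 := measurable_snd
  refine Measurable.ite (measurableSet_le h2 measurable_const) ?_ ?_
  · refine Measurable.div_const (Measurable.ite (measurableSet_lt measurable_const h2) ?_ ?_) _
    · exact measurable_posPow_uncurry h1 h2 _
    · exact measurable_posPow_uncurry h2 h1 _
  · refine Finset.measurable_sum _ fun r _ => ?_
    refine Measurable.ite (measurableSet_eq_fun h2 measurable_const) ?_ measurable_const
    exact ((h1.sub measurable_const).pow_const r).div_const _

theorem measurable_feat_uncurry (α : ℕ) (c : I) :
    Measurable fun p : I × ℝ => feat α c p.1 p.2 :=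
  (measurable_rawFeat_uncurry α c).const_mul _

theorem measurable_rawFeat (α : ℕ) (c x : I) : Measurable (rawFeat α c x) :=
  (measurable_rawFeat_uncurry α c).comp (measurable_const.prodMk measurable_id)

theorem measurable_feat (α : ℕ) (c x : I) : Measurable (feat α c x) :=
  (measurable_rawFeat α c x).const_mul _

theorem measurable_feat_left (α : ℕ) (c : I) (ω : ℝ) : Measurable fun x => feat α c x ω :=
  (measurable_feat_uncurry α c).comp (measurable_id.prodMk measurable_const)

theorem abs_div_factorial_le_one {a : ℝ} (ha : |a| ≤ 1) (n : ℕ) : |a / n.factorial| ≤ 1 := by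
  have hn : (1 : ℝ) ≤ n.factorial := by exact_mod_cast n.factorial_pos
  rw [abs_div, abs_of_pos (by linarith : (0 : ℝ) < n.factorial)]
  exact div_le_one_of_le₀ (ha.trans hn) (by linarith)

theorem abs_polyFeat_le (c x : I) (r : ℕ) : |polyFeat c x r| ≤ 1 := by
  refine abs_div_factorial_le_one ?_ _
  rw [abs_pow]
  refine pow_le_one₀ (abs_nonneg _) (abs_le.2 ⟨?_, ?_⟩) <;>
    linarith [x.2.1, x.2.2, c.2.1, c.2.2]

theorem abs_remFeat_le (α : ℕ) (c x : I) {t : ℝ} (ht : t ≤ 1) : |remFeat α c x t| ≤ 1 := by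
  refine abs_div_factorial_le_one ?_ _
  split_ifs with h
  · exact posPow_abs_le x.2 ⟨by linarith [c.2.1], ht⟩ _
  · by_cases h0 : 0 ≤ t
    · exact posPow_abs_le ⟨h0, ht⟩ x.2 _
    · rw [posPow, if_neg (by linarith [x.2.1]), abs_zero]
      exact zero_le_one

theorem sum_ite_natCast_eq {α r : ℕ} (hr : r ∈ Finset.Ico 1 α) (f : ℕ → ℝ) :
    (∑ i ∈ Finset.Ico 1 α, if (r : ℝ) + 1 = i + 1 then f i else 0) = f r := by
  rw [Finset.sum_eq_single r]
  · simp
  · intro i _ hi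
    rw [if_neg]
    intro h
    exact hi (by exact_mod_cast (add_right_cancel h).symm)
  · exact fun h => absurd hr h

theorem rawFeat_natCast {α : ℕ} (c x : I) {r : ℕ} (hr : r ∈ Finset.Ico 1 α) :
    rawFeat α c x ((r : ℝ) + 1) = polyFeat c x r := by
  have h1 : (1 : ℝ) ≤ r := by exact_mod_cast (Finset.mem_Ico.1 hr).1
  rw [rawFeat, if_neg (by linarith), sum_ite_natCast_eq hr]

theorem abs_rawFeat_le (α : ℕ) (c x : I) (ω : ℝ) : |rawFeat α c x ω| ≤ 1 := by
  by_cases h : ω ≤ 1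
  · rw [rawFeat, if_pos h]
    exact abs_remFeat_le α c x h
  · by_cases hr : ∃ r ∈ Finset.Ico 1 α, ω = r + 1
    · obtain ⟨r, hr, rfl⟩ := hr
      rw [rawFeat_natCast c x hr]
      exact abs_polyFeat_le c x r
    · push Not at hr
      rw [rawFeat, if_neg h, Finset.sum_eq_zero fun r h => if_neg (hr r h), abs_zero]
      exact zero_le_one

theorem abs_feat_le (α : ℕ) (c x : I) (ω : ℝ) : |feat α c x ω| ≤ √α := by
  rw [feat, abs_mul, abs_of_nonneg (Real.sqrt_nonneg _)]
  exact mul_le_of_le_one_right (Real.sqrt_nonneg _) (abs_rawFeat_le α c x ω)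

theorem rawFeat_anchor (α : ℕ) (c : I) (ω : ℝ) : rawFeat α c c ω = 0 := by
  have h : remFeat α c c ω = 0 := by
    unfold remFeat posPow
    split_ifs <;> first | linarith | simp
  unfold rawFeat
  split_ifs
  · exact h
  · refine Finset.sum_eq_zero fun r hr => ?_
    have : r ≠ 0 := by have := (Finset.mem_Ico.1 hr).1; omega
    simp [polyFeat, this]

theorem feat_anchor (α : ℕ) (c : I) (ω : ℝ) : feat α c c ω = 0 := by
  rw [feat, rawFeat_anchor, mul_zero]

theorem isProbabilityMeasure_featMeasure {α : ℕ} (hα : 1 ≤ α) :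
    IsProbabilityMeasure (featMeasure α) := by
  constructor
  have h : (1 : ℝ≥0∞) + ((α - 1 : ℕ) : ℝ≥0∞) = α := by
    exact_mod_cast (by omega : 1 + (α - 1) = α)
  simp only [featMeasure, Measure.smul_apply, Measure.add_apply, Measure.restrict_apply_univ,
    Real.volume_Icc, Measure.finsetSum_apply, measure_univ, Finset.sum_const, Nat.card_Ico,
    smul_eq_mul, sub_zero, ENNReal.ofReal_one, nsmul_eq_mul, mul_one]
  rw [h]
  exact ENNReal.inv_mul_cancel (by simpa using by omega) (by simp)

theorem integral_featMeasure (α : ℕ) {f : ℝ → ℝ} (hf : Measurable f) {C : ℝ}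
    (hC : ∀ ω, |f ω| ≤ C) :
    ∫ ω, f ω ∂featMeasure α =
      (α : ℝ)⁻¹ * ((∫ t in (0 : ℝ)..1, f t) + ∑ r ∈ Finset.Ico 1 α, f (r + 1)) := by
  have hi : ∀ ν : Measure ℝ, IsFiniteMeasure ν → Integrable f ν := fun ν _ =>
    Integrable.of_bound hf.aestronglyMeasurable C (ae_of_all _ hC)
  have hfin : IsFiniteMeasure (∑ r ∈ Finset.Ico 1 α, Measure.dirac ((r : ℝ) + 1)) := by
    infer_instance
  rw [featMeasure, integral_smul_measure, integral_add_measure (hi _ inferInstance) (hi _ hfin),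
    integral_finsetSum_measure fun r _ => hi _ inferInstance,
    intervalIntegral.integral_of_le zero_le_one, integral_Icc_eq_integral_Ioc]
  simp [integral_dirac]

/-- Split the integral at `c`. Right of `c` the product vanishes unless both points lie right of
`c`, and symmetrically on the left, so at most one half survives. -/
theorem intervalIntegral_remFeat_mul (α : ℕ) (c x y : I) :
    ∫ t in (0 : ℝ)..1, remFeat α c x t * remFeat α c y t =
    (if c < x ∧ c < y then
      ∫ t in (c : ℝ)..1, (posPow x t (α - 1) / (α - 1).factorial) *
        (posPow y t (α - 1) / (α - 1).factorial)
    else if x < c ∧ y < c then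
      ∫ t in (0 : ℝ)..c, (posPow t x (α - 1) / (α - 1).factorial) *
        (posPow t y (α - 1) / (α - 1).factorial)
    else 0) := by
  have hm : Measurable fun t => remFeat α c x t * remFeat α c y t := by
    have h : ∀ z : I, Measurable (remFeat α c z) := fun z =>
      (Measurable.ite measurableSet_Ioi (measurable_posPow_right _ _)
        (measurable_posPow_left _ _)).div_const _
    exact (h x).mul (h y)
  have hb : ∀ t ∈ Set.Icc (0 : ℝ) 1, |remFeat α c x t * remFeat α c y t| ≤ 1 := fun t ht => by
    rw [abs_mul]
    exact mul_le_one₀ (abs_remFeat_le α c x ht.2) (abs_nonneg _) (abs_remFeat_le α c y ht.2)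
  rw [← intervalIntegral.integral_add_adjacent_intervals
    (intervalIntegrable_aux hm (by simp) c.2 hb) (intervalIntegrable_aux hm c.2 (by simp) hb)]
  have e1 : ∫ t in (0 : ℝ)..c, remFeat α c x t * remFeat α c y t = ∫ t in (0 : ℝ)..c,
      (posPow t x (α - 1) / (α - 1).factorial) * (posPow t y (α - 1) / (α - 1).factorial) := by
    refine intervalIntegral.integral_congr fun t ht => ?_
    rw [Set.uIcc_of_le c.2.1] at ht
    simp [remFeat, ht.2.not_gt]
  have e2 : ∫ t in (c : ℝ)..1, remFeat α c x t * remFeat α c y t = ∫ t in (c : ℝ)..1,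
      (posPow x t (α - 1) / (α - 1).factorial) * (posPow y t (α - 1) / (α - 1).factorial) := by
    refine intervalIntegral.integral_congr_ae (ae_of_all _ fun t ht => ?_)
    rw [Set.uIoc_of_le c.2.2] at ht
    simp [remFeat, ht.1]
  have z1 : ∀ z : I, c ≤ z → ∀ t ∈ Set.Icc (0 : ℝ) c, posPow t z (α - 1) = 0 := fun z hz t ht => by
    have : (c : ℝ) ≤ z := hz
    rw [posPow, if_neg (by linarith [ht.2])]
  have z2 : ∀ z : I, z ≤ c → ∀ t ∈ Set.Icc (c : ℝ) 1, posPow z t (α - 1) = 0 := fun z hz t ht => by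
    have : (z : ℝ) ≤ c := hz
    rw [posPow, if_neg (by linarith [ht.1])]
  have w1 : c ≤ x ∨ c ≤ y → ∫ t in (0 : ℝ)..c, (posPow t x (α - 1) / (α - 1).factorial) *
      (posPow t y (α - 1) / (α - 1).factorial) = 0 := fun h => by
    refine (intervalIntegral.integral_congr fun t ht => ?_).trans intervalIntegral.integral_zero
    rw [Set.uIcc_of_le c.2.1] at ht
    rcases h with h | h <;> simp [z1 _ h t ht]
  have w2 : x ≤ c ∨ y ≤ c → ∫ t in (c : ℝ)..1, (posPow x t (α - 1) / (α - 1).factorial) *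
      (posPow y t (α - 1) / (α - 1).factorial) = 0 := fun h => by
    refine (intervalIntegral.integral_congr fun t ht => ?_).trans intervalIntegral.integral_zero
    rw [Set.uIcc_of_le c.2.2] at ht
    rcases h with h | h <;> simp [z2 _ h t ht]
  rw [e1, e2]
  split_ifs with h1 h2
  · rw [w1 (Or.inl h1.1.le), zero_add]
  · rw [w2 (Or.inl h2.1.le), add_zero]
  · rw [w1, w2, add_zero]
    · by_contra! h
      exact h1 h
    · by_contra! h
      exact h2 h

theorem sobKernel_eq_integral {α : ℕ} (hα : 1 ≤ α) (c x y : I) :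
    sobKernel α c x y = ∫ ω, feat α c x ω * feat α c y ω ∂featMeasure α := by
  have hα' : (0 : ℝ) < α := by exact_mod_cast hα
  have e : ∀ ω, feat α c x ω * feat α c y ω = α * (rawFeat α c x ω * rawFeat α c y ω) := fun ω => by
    rw [feat, feat, mul_mul_mul_comm, Real.mul_self_sqrt hα'.le]
  simp_rw [e]
  rw [integral_const_mul, integral_featMeasure α
    (f := fun ω => rawFeat α c x ω * rawFeat α c y ω) ((measurable_rawFeat α c x).mul (measurable_rawFeat α c y)) (C := 1) fun ω => by
      rw [abs_mul]
      exact mul_le_one₀ (abs_rawFeat_le α c x ω) (abs_nonneg _) (abs_rawFeat_le α c y ω),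
    ← mul_assoc, mul_inv_cancel₀ hα'.ne', one_mul, sobKernel, add_comm]
  congr 1
  · rw [← intervalIntegral_remFeat_mul]
    refine intervalIntegral.integral_congr fun t ht => ?_
    rw [Set.uIcc_of_le zero_le_one] at ht
    simp [rawFeat, ht.2]
  · refine Finset.sum_congr rfl fun r hr => ?_
    rw [rawFeat_natCast c x hr, rawFeat_natCast c y hr, polyFeat, polyFeat]

theorem integral_infinitePi_prod {X : Type*} [MeasurableSpace X] (ν : Measure X)
    [IsProbabilityMeasure ν] (u : Finset ℕ) (h : ℕ → X → ℝ) (hh : ∀ j, Measurable (h j)) :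
    ∫ x, ∏ j ∈ u, h j (x j) ∂Measure.infinitePi (fun _ : ℕ => ν) = ∏ j ∈ u, ∫ x, h j x ∂ν := by
  have := integral_restrict_infinitePi (μ := fun _ : ℕ => ν) (s := u)
    (f := fun y : (j : u) → X => ∏ j : u, h j (y j))
    (Finset.measurable_prod _ fun (j : u) _ =>
      (hh j).comp (measurable_pi_apply j)).aestronglyMeasurable
  rw [integral_fintype_prod_eq_prod (fun (j : u) => h j)] at this
  rw [← Finset.prod_coe_sort u fun j => ∫ x, h j x ∂ν, ← this]
  refine integral_congr_ae (ae_of_all _ fun x => ?_)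
  simp only [Finset.restrict]
  exact (Finset.prod_coe_sort u fun j => h j (x j)).symm

end


noncomputable section

/-! ### The worst case error as a sum of squared errors of features -/

/-- The infinite product of the uniform distribution on `[0,1]`. -/
abbrev uniformMeasure : Measure (ℕ → I) := Measure.infinitePi fun _ : ℕ => (volume : Measure I)

/-- The infinite product of the feature measure. -/
abbrev featMeasurePi (α : ℕ) : Measure (ℕ → ℝ) := Measure.infinitePi fun _ : ℕ => featMeasure α

/-- The integration error of `Q` for a function on the full sequence space. -/
def errFun {c : I} (Q : Algorithm c) (f : (ℕ → I) → ℝ) : ℝ :=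
  ∫ x, f x ∂uniformMeasure - (Q.map fun ax => ax.1 * f ax.2.1).sum

/-- The features `∏_{j ∈ u} φ(x_j, ω_j)` of the product kernel. -/
def prodFeat (α : ℕ) (c : I) (u : Finset ℕ) (ω : ℕ → ℝ) (x : ℕ → I) : ℝ :=
  ∏ j ∈ u, feat α c (x j) (ω j)

/-- The squared worst case error of `Q` over the space with kernel `K_u`. -/
def sqErr {c : I} (α : ℕ) (Q : Algorithm c) (u : Finset ℕ) : ℝ :=
  ∫ ω, errFun Q (prodFeat α c u ω) ^ 2 ∂featMeasurePi α

/-- A sum over a `Fin` type replaces the list sum, so that linearity and integrability of finite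
sums apply. -/
theorem errFun_eq {c : I} (Q : Algorithm c) (f : (ℕ → I) → ℝ) :
    errFun Q f = ∫ x, f x ∂uniformMeasure -
      ∑ i : Fin Q.length, (Q[i]).1 * f (Q[i]).2.1 := by
  exact congrArg (_ - ·) (Fin.sum_univ_fun_getElem Q fun ax => ax.1 * f ax.2.1).symm

theorem errFun_const_mul {c : I} (Q : Algorithm c) (a : ℝ) (f : (ℕ → I) → ℝ) :
    errFun Q (fun x => a * f x) = a * errFun Q f := by
  rw [errFun_eq, errFun_eq, integral_const_mul, mul_sub, Finset.mul_sum]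
  congr 1
  exact Finset.sum_congr rfl fun i _ => by ring

theorem abs_integral_le_of_forall_abs_le {X : Type*} [MeasurableSpace X] (μ : Measure X)
    [IsProbabilityMeasure μ] {f : X → ℝ} {C : ℝ} (hf : ∀ x, |f x| ≤ C) : |∫ x, f x ∂μ| ≤ C := by
  have := norm_integral_le_of_norm_le_const (μ := μ) (f := f) (ae_of_all _ hf)
  simpa using this

theorem abs_errFun_le {c : I} (Q : Algorithm c) {f : (ℕ → I) → ℝ} {C : ℝ}
    (hf : ∀ x, |f x| ≤ C) :
    |errFun Q f| ≤ (1 + ∑ i : Fin Q.length, |(Q[i]).1|) * C := by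
  rw [errFun_eq, add_mul, one_mul, Finset.sum_mul]
  refine (abs_sub _ _).trans (add_le_add ?_ ?_)
  · exact abs_integral_le_of_forall_abs_le _ hf
  · refine (Finset.abs_sum_le_sum_abs _ _).trans (Finset.sum_le_sum fun i _ => ?_)
    rw [abs_mul]
    exact mul_le_mul_of_nonneg_left (hf _) (abs_nonneg _)

/-- Dominated convergence for the integral; the quadrature part is a finite combination of point
values. -/
theorem hasSum_errFun {c : I} (Q : Algorithm c) {ι : Type} [Countable ι]
    {g : ι → (ℕ → I) → ℝ} {C : ι → ℝ} (hg : ∀ u, Measurable (g u))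
    (hC : ∀ u x, |g u x| ≤ C u) (hs : Summable C) :
    HasSum (fun u => errFun Q (g u)) (errFun Q fun x => ∑' u, g u x) := by
  have hsum : ∀ x, HasSum (fun u => g u x) (∑' u, g u x) := fun x =>
    (Summable.of_norm_bounded hs fun u => hC u x).hasSum
  simp_rw [errFun_eq]
  refine HasSum.sub ?_ (hasSum_sum fun i _ => (hsum _).mul_left _)
  exact hasSum_integral_of_dominated_convergence (fun u _ => C u)
    (fun u => (hg u).aestronglyMeasurable) (fun u => ae_of_all _ fun x => hC u x)
    (ae_of_all _ fun _ => hs) (integrable_const _) (ae_of_all _ hsum)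

theorem measurable_prodFeat_uncurry (α : ℕ) (c : I) (u : Finset ℕ) :
    Measurable fun p : (ℕ → ℝ) × (ℕ → I) => prodFeat α c u p.1 p.2 := by
  refine Finset.measurable_prod _ fun j _ => ?_
  have h1 : Measurable fun p : (ℕ → ℝ) × (ℕ → I) => p.2 j :=
    (measurable_pi_apply j).comp measurable_snd
  have h2 : Measurable fun p : (ℕ → ℝ) × (ℕ → I) => p.1 j :=
    (measurable_pi_apply j).comp measurable_fst
  exact (measurable_feat_uncurry α c).comp (h1.prodMk h2)

theorem measurable_prodFeat_left (α : ℕ) (c : I) (u : Finset ℕ) (x : ℕ → I) :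
    Measurable fun ω => prodFeat α c u ω x :=
  (measurable_prodFeat_uncurry α c u).comp (measurable_id.prodMk measurable_const)

theorem abs_prodFeat_le (α : ℕ) (c : I) (u : Finset ℕ) (ω : ℕ → ℝ) (x : ℕ → I) :
    |prodFeat α c u ω x| ≤ √α ^ u.card := by
  rw [prodFeat, Finset.abs_prod]
  refine (Finset.prod_le_prod (fun _ _ => abs_nonneg _)
    fun j _ => abs_feat_le α c (x j) (ω j)).trans ?_
  rw [Finset.prod_const]

theorem measurable_errFun_prodFeat {c : I} (α : ℕ) (Q : Algorithm c) (u : Finset ℕ) :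
    Measurable fun ω => errFun Q (prodFeat α c u ω) := by
  simp_rw [errFun_eq]
  refine Measurable.sub ?_ (Finset.measurable_sum _ fun i _ =>
    (measurable_prodFeat_left α c u _).const_mul _)
  exact (measurable_prodFeat_uncurry α c u).stronglyMeasurable.integral_prod_right.measurable

/-- The error functional passes under the `ω`-integral by Fubini, all integrands being bounded. -/
theorem errFun_integral {α : ℕ} (hα : 1 ≤ α) {c : I} (Q : Algorithm c) (u : Finset ℕ)
    {ψ : (ℕ → ℝ) → ℝ} (hψ : Measurable ψ) {C : ℝ} (hC : ∀ ω, |ψ ω| ≤ C) :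
    errFun Q (fun x => ∫ ω, ψ ω * prodFeat α c u ω x ∂featMeasurePi α) =
      ∫ ω, ψ ω * errFun Q (prodFeat α c u ω) ∂featMeasurePi α := by
  have := isProbabilityMeasure_featMeasure hα
  have hi : ∀ {f : (ℕ → ℝ) → ℝ} {B : ℝ}, Measurable f → (∀ ω, |f ω| ≤ B) →
      Integrable f (featMeasurePi α) := fun hf hB =>
    Integrable.of_bound hf.aestronglyMeasurable _ (ae_of_all _ hB)
  have hb : ∀ ω x, |ψ ω * prodFeat α c u ω x| ≤ C * √α ^ u.card := fun ω x => by
    rw [abs_mul]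
    exact mul_le_mul (hC ω) (abs_prodFeat_le α c u ω x) (abs_nonneg _)
      ((abs_nonneg _).trans (hC ω))
  have hs : ∫ x, ∫ ω, ψ ω * prodFeat α c u ω x ∂featMeasurePi α ∂uniformMeasure =
      ∫ ω, ψ ω * ∫ x, prodFeat α c u ω x ∂uniformMeasure ∂featMeasurePi α := by
    rw [integral_integral_swap]
    · simp_rw [integral_const_mul]
    · refine Integrable.of_bound (C := C * √α ^ u.card) ?_ (ae_of_all _ fun p => hb p.2 p.1)
      exact ((hψ.comp measurable_snd).mul
        ((measurable_prodFeat_uncurry α c u).comp measurable_swap)).aestronglyMeasurable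
  simp_rw [errFun_eq, mul_sub, Finset.mul_sum]
  rw [hs, integral_sub, integral_finsetSum]
  · congr 1
    refine Finset.sum_congr rfl fun i _ => ?_
    rw [← integral_const_mul]
    refine integral_congr_ae (ae_of_all _ fun ω => ?_)
    ring
  · intro i _
    refine hi (B := C * (|(Q[i]).1| * √α ^ u.card))
      (hψ.mul ((measurable_prodFeat_left α c u _).const_mul _)) fun ω => ?_
    rw [abs_mul, abs_mul]
    have := (abs_nonneg _).trans (hC ω)
    gcongr
    · exact hC ω
    · exact abs_prodFeat_le _ _ _ _ _
  · refine hi (B := C * (√α ^ u.card)) (hψ.mul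
      (measurable_prodFeat_uncurry α c u).stronglyMeasurable.integral_prod_right.measurable)
      fun ω => ?_
    rw [abs_mul]
    have := (abs_nonneg _).trans (hC ω)
    gcongr
    · exact hC ω
    · exact abs_integral_le_of_forall_abs_le _ (abs_prodFeat_le α c u ω)
  · refine integrable_finsetSum _ fun i _ => ?_
    refine hi (B := C * (|(Q[i]).1| * √α ^ u.card))
      (hψ.mul ((measurable_prodFeat_left α c u _).const_mul _)) fun ω => ?_
    rw [abs_mul, abs_mul]
    have := (abs_nonneg _).trans (hC ω)
    gcongr
    · exact hC ω
    · exact abs_prodFeat_le _ _ _ _ _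

theorem prodKernel_eq_integral {α : ℕ} (hα : 1 ≤ α) (c : I) (u : Finset ℕ) (x y : ℕ → I) :
    prodKernel (sobKernel α c) u x y =
      ∫ ω, prodFeat α c u ω x * prodFeat α c u ω y ∂featMeasurePi α := by
  have := isProbabilityMeasure_featMeasure hα
  simp_rw [prodFeat, ← Finset.prod_mul_distrib]
  rw [integral_infinitePi_prod (featMeasure α) u
    (fun j t => feat α c (x j) t * feat α c (y j) t)
    fun j => (measurable_feat _ _ _).mul (measurable_feat _ _ _)]
  exact Finset.prod_congr rfl fun j _ => sobKernel_eq_integral hα c (x j) (y j)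

theorem abs_prodKernel_le {α : ℕ} (hα : 1 ≤ α) (c : I) (u : Finset ℕ) (x y : ℕ → I) :
    |prodKernel (sobKernel α c) u x y| ≤ (α : ℝ) ^ u.card := by
  have := isProbabilityMeasure_featMeasure hα
  rw [prodKernel_eq_integral hα]
  refine abs_integral_le_of_forall_abs_le _ fun ω => ?_
  rw [abs_mul]
  refine (mul_le_mul (abs_prodFeat_le α c u ω x) (abs_prodFeat_le α c u ω y)
    (abs_nonneg _) (by positivity)).trans_eq ?_
  rw [← mul_pow, Real.mul_self_sqrt (by positivity)]

theorem measurable_prodKernel {α : ℕ} (hα : 1 ≤ α) (c : I) (u : Finset ℕ) (y : ℕ → I) :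
    Measurable fun x => prodKernel (sobKernel α c) u x y := by
  have := isProbabilityMeasure_featMeasure hα
  simp_rw [prodKernel_eq_integral hα]
  refine StronglyMeasurable.measurable (StronglyMeasurable.integral_prod_left'
    (f := fun p : (ℕ → ℝ) × (ℕ → I) => prodFeat α c u p.1 p.2 * prodFeat α c u p.1 y) ?_)
  exact ((measurable_prodFeat_uncurry α c u).mul
    ((measurable_prodFeat_left α c u y).comp measurable_fst)).stronglyMeasurable

/-- By the feature representation, the error functional in `x` turns one feature factor into its
error, and the one in `y` then turns the other factor into the same number, leaving the integral of
a square. -/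
theorem errFun_errFun_prodKernel {α : ℕ} (hα : 1 ≤ α) {c : I} (Q : Algorithm c) (u : Finset ℕ) :
    errFun Q (fun y => errFun Q fun x => prodKernel (sobKernel α c) u x y) = sqErr α Q u := by
  simp_rw [prodKernel_eq_integral hα, mul_comm (prodFeat α c u _ _) (prodFeat α c u _ _)]
  have h1 : ∀ y, (errFun Q fun x => ∫ ω, prodFeat α c u ω y * prodFeat α c u ω x ∂featMeasurePi α)
      = ∫ ω, errFun Q (prodFeat α c u ω) * prodFeat α c u ω y ∂featMeasurePi α := fun y => by
    rw [errFun_integral hα Q u (measurable_prodFeat_left α c u y)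
      fun ω => abs_prodFeat_le α c u ω y]
    simp_rw [mul_comm]
  simp_rw [h1]
  rw [errFun_integral hα Q u (measurable_errFun_prodFeat α Q u)
    fun ω => abs_errFun_le Q (abs_prodFeat_le α c u ω), sqErr]
  simp_rw [sq]

theorem sqErr_nonneg {c : I} (α : ℕ) (Q : Algorithm c) (u : Finset ℕ) : 0 ≤ sqErr α Q u :=
  integral_nonneg fun _ => sq_nonneg _

/-! ### The error functional and its representer in the space of integrands. -/

section RKHS

variable {α : ℕ} {c : I} {γ : Finset ℕ → ℝ≥0}

theorem mem_domain_of_summable (hα : 1 ≤ α)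
    (hs : Summable fun u => (γ u : ℝ) * (α : ℝ) ^ u.card) (x : ℕ → I) :
    x ∈ domain (sobKernel α c) γ := by
  refine Summable.of_norm_bounded hs fun u => ?_
  rw [Real.norm_eq_abs, abs_mul, NNReal.abs_eq]
  exact mul_le_mul_of_nonneg_left (abs_prodKernel_le hα c u x x) (γ u).2

theorem abs_weighted_prodKernel_le (hα : 1 ≤ α) (u : Finset ℕ) (x y : ℕ → I) :
    |(γ u : ℝ) * prodKernel (sobKernel α c) u x y| ≤ γ u * (α : ℝ) ^ u.card := by
  rw [abs_mul, NNReal.abs_eq]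
  exact mul_le_mul_of_nonneg_left (abs_prodKernel_le hα c u x y) (γ u).2

/-- The kernel section at `x`. -/
def kerSec (x : domain (sobKernel α c) γ) : Integrands α c γ :=
  RKHS.kerFun (Integrands α c γ) x (1 : ℝ)

theorem inner_kerSec (x : domain (sobKernel α c) γ) (f : Integrands α c γ) :
    inner ℝ (kerSec x) f = f x := by
  rw [kerSec, RKHS.kerFun_inner]
  simp

theorem kerSec_apply (x y : domain (sobKernel α c) γ) :
    kerSec y x = weightedKernel (sobKernel α c) γ x y := by
  rw [kerSec, RKHS.kerFun_apply, RKHS.OfKernel.kernel_ofKernel]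
  simp [kernelMatrix]

theorem measurable_weightedKernel (hα : 1 ≤ α)
    (hs : Summable fun u => (γ u : ℝ) * (α : ℝ) ^ u.card) (y : ℕ → I) :
    Measurable fun x => weightedKernel (sobKernel α c) γ x y := by
  refine measurable_of_tendsto_metrizable' (atTop : Filter (Finset (Finset ℕ)))
    (f := fun s x => ∑ u ∈ s, (γ u : ℝ) * prodKernel (sobKernel α c) u x y) ?_ ?_
  · exact fun s => Finset.measurable_sum _ fun u _ => (measurable_prodKernel hα c u y).const_mul _
  · rw [tendsto_pi_nhds]
    exact fun x => (Summable.of_norm_bounded hs fun u =>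
      abs_weighted_prodKernel_le hα u x y).hasSum

/-- Kernel sections are measurable, they span a dense subspace, and norm convergence implies
pointwise convergence because evaluations are continuous. -/
theorem measurable_integrand (hα : 1 ≤ α)
    (hs : Summable fun u => (γ u : ℝ) * (α : ℝ) ^ u.card) (f : Integrands α c γ) :
    Measurable fun x : ℕ → I => f ⟨x, mem_domain_of_summable hα hs x⟩ := by
  let M : Submodule ℝ (Integrands α c γ) :=
    { carrier := {f | Measurable fun x : ℕ → I => f ⟨x, mem_domain_of_summable hα hs x⟩}
      add_mem' := fun {f g} hf hg => by
        simp only [Set.mem_ofPred_eq, RKHS.coe_add, Pi.add_apply]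
        exact hf.add hg
      zero_mem' := by
        simp only [Set.mem_ofPred_eq, RKHS.coe_zero, Pi.zero_apply]
        exact measurable_const
      smul_mem' := fun a f hf => by
        simp only [Set.mem_ofPred_eq, RKHS.coe_smul, Pi.smul_apply]
        exact hf.const_smul a }
  have hspan : Submodule.span ℝ
      {f | ∃ (x : domain (sobKernel α c) γ) (v : ℝ), RKHS.kerFun (Integrands α c γ) x v = f} ≤ M := by
    rw [Submodule.span_le]
    rintro _ ⟨y, v, rfl⟩
    have e : RKHS.kerFun (Integrands α c γ) y v = v • kerSec y := by
      rw [kerSec, ← map_smul]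
      simp
    rw [e]
    refine M.smul_mem v ?_
    change Measurable _
    simp_rw [kerSec_apply]
    exact measurable_weightedKernel hα hs y
  have hf : f ∈ closure (M : Set (Integrands α c γ)) := by
    have h := RKHS.kerFun_dense (Integrands α c γ)
    have : f ∈ (⊤ : Submodule ℝ (Integrands α c γ)) := trivial
    rw [← h] at this
    exact closure_mono hspan this
  obtain ⟨F, hF, hlim⟩ := mem_closure_iff_seq_limit.1 hf
  refine measurable_of_tendsto_metrizable hF ?_
  rw [tendsto_pi_nhds]
  exact fun x => ((RKHS.continuous_eval _).tendsto f).comp hlim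

theorem weightedKernel_self_le (hα : 1 ≤ α)
    (hs : Summable fun u => (γ u : ℝ) * (α : ℝ) ^ u.card) (x : ℕ → I) :
    weightedKernel (sobKernel α c) γ x x ≤ ∑' u, (γ u : ℝ) * (α : ℝ) ^ u.card := by
  refine Summable.tsum_le_tsum (fun u => (le_abs_self _).trans
    (abs_weighted_prodKernel_le hα u x x)) ?_ hs
  exact Summable.of_norm_bounded hs fun u => abs_weighted_prodKernel_le hα u x x

theorem norm_kerSec_le (hα : 1 ≤ α)
    (hs : Summable fun u => (γ u : ℝ) * (α : ℝ) ^ u.card) (x : domain (sobKernel α c) γ) :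
    ‖kerSec x‖ ≤ √(∑' u, (γ u : ℝ) * (α : ℝ) ^ u.card) := by
  refine Real.le_sqrt_of_sq_le ?_
  rw [← real_inner_self_eq_norm_sq, inner_kerSec, kerSec_apply]
  exact weightedKernel_self_le hα hs x

theorem abs_integrand_le (hα : 1 ≤ α)
    (hs : Summable fun u => (γ u : ℝ) * (α : ℝ) ^ u.card) (f : Integrands α c γ)
    (x : domain (sobKernel α c) γ) :
    |f x| ≤ √(∑' u, (γ u : ℝ) * (α : ℝ) ^ u.card) * ‖f‖ := by
  rw [← inner_kerSec]
  exact (abs_real_inner_le_norm _ _).trans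
    (mul_le_mul_of_nonneg_right (norm_kerSec_le hα hs x) (norm_nonneg _))

/-- Under the summability assumption every sequence belongs to the domain, so passing to the subtype
changes nothing. -/
theorem integration_eq (hα : 1 ≤ α)
    (hs : Summable fun u => (γ u : ℝ) * (α : ℝ) ^ u.card) (f : Integrands α c γ) :
    integration α c γ f =
      ∫ x, f ⟨x, mem_domain_of_summable hα hs x⟩ ∂uniformMeasure := by
  have hu : domain (sobKernel α c) γ = Set.univ :=
    Set.eq_univ_of_forall (mem_domain_of_summable hα hs)
  have h := integral_subtype_comap (μ := uniformMeasure) (s := domain (sobKernel α c) γ)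
    (by rw [hu]; exact MeasurableSet.univ) fun x => f ⟨x, mem_domain_of_summable hα hs x⟩
  rw [integration, domainMeasure]
  simp only [Subtype.coe_eta] at h
  rw [h, Measure.restrict_eq_self_of_ae_mem (ae_of_all _ (mem_domain_of_summable hα hs))]

theorem integration_sub_apply (hα : 1 ≤ α)
    (hs : Summable fun u => (γ u : ℝ) * (α : ℝ) ^ u.card) (Q : Algorithm c)
    (f : Integrands α c γ) :
    integration α c γ f - Algorithm.apply Q α γ f =
      errFun Q fun x => f ⟨x, mem_domain_of_summable hα hs x⟩ := by
  rw [integration_eq hα hs, errFun]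
  rfl

/-- Integration as a bounded linear functional. -/
def integrationCLM (hα : 1 ≤ α) (hs : Summable fun u => (γ u : ℝ) * (α : ℝ) ^ u.card) :
    Integrands α c γ →L[ℝ] ℝ :=
  have hi : ∀ f : Integrands α c γ, Integrable
      (fun x : ℕ → I => f ⟨x, mem_domain_of_summable hα hs x⟩) uniformMeasure := fun f =>
    Integrable.of_bound (measurable_integrand hα hs f).aestronglyMeasurable _
      (ae_of_all _ fun x => abs_integrand_le hα hs f _)
  LinearMap.mkContinuous
    { toFun := integration α c γ
      map_add' := fun f g => by
        simp only [integration_eq hα hs, RKHS.coe_add, Pi.add_apply]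
        exact integral_add (hi f) (hi g)
      map_smul' := fun a f => by
        simp only [integration_eq hα hs, RKHS.coe_smul, Pi.smul_apply]
        exact integral_smul a _ }
    (√(∑' u, (γ u : ℝ) * (α : ℝ) ^ u.card)) fun f => by
      simp only [LinearMap.coe_mk, AddHom.coe_mk, integration_eq hα hs, Real.norm_eq_abs]
      exact abs_integral_le_of_forall_abs_le _ fun x => abs_integrand_le hα hs f _

/-- The representer of the error functional of `Q`. -/
def errRep (hα : 1 ≤ α) (hs : Summable fun u => (γ u : ℝ) * (α : ℝ) ^ u.card)
    (Q : Algorithm c) : Integrands α c γ :=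
  (InnerProductSpace.toDual ℝ _).symm (integrationCLM hα hs) -
    ∑ i : Fin Q.length, (Q[i]).1 • kerSec ((Q[i]).2.toDomain α γ)

theorem inner_errRep (hα : 1 ≤ α) (hs : Summable fun u => (γ u : ℝ) * (α : ℝ) ^ u.card)
    (Q : Algorithm c) (f : Integrands α c γ) :
    inner ℝ (errRep hα hs Q) f = integration α c γ f - Algorithm.apply Q α γ f := by
  rw [errRep, inner_sub_left, InnerProductSpace.toDual_symm_apply, sum_inner, Algorithm.apply,
    ← Fin.sum_univ_fun_getElem Q fun ax => ax.1 * f (ax.2.toDomain α γ)]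
  congr 1
  refine Finset.sum_congr rfl fun i _ => ?_
  rw [inner_smul_left, inner_kerSec]
  rfl

/-- The value at `y` is the inner product with the kernel section at `y`, that is, the error of `Q`
for that section; the error functional then passes through the series over `u`. -/
theorem errRep_apply (hα : 1 ≤ α) (hs : Summable fun u => (γ u : ℝ) * (α : ℝ) ^ u.card)
    (Q : Algorithm c) (y : ℕ → I) :
    errRep hα hs Q ⟨y, mem_domain_of_summable hα hs y⟩ =
      ∑' u, (γ u : ℝ) * errFun Q fun x => prodKernel (sobKernel α c) u x y := by
  have h := hasSum_errFun Q (g := fun u x => (γ u : ℝ) * prodKernel (sobKernel α c) u x y)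
    (fun u => (measurable_prodKernel hα c u y).const_mul _)
    (fun u x => abs_weighted_prodKernel_le hα u x y) hs
  rw [← inner_kerSec, real_inner_comm, inner_errRep, integration_sub_apply hα hs]
  simp_rw [kerSec_apply]
  refine h.tsum_eq.symm.trans (tsum_congr fun u => errFun_const_mul Q _ _)

theorem measurable_errFun_prodKernel (hα : 1 ≤ α) (Q : Algorithm c) (u : Finset ℕ) :
    Measurable fun y => errFun Q fun x => prodKernel (sobKernel α c) u x y := by
  have := isProbabilityMeasure_featMeasure hα
  have e : ∀ y, (errFun Q fun x => prodKernel (sobKernel α c) u x y)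
      = ∫ ω, prodFeat α c u ω y * errFun Q (prodFeat α c u ω) ∂featMeasurePi α := fun y => by
    simp_rw [prodKernel_eq_integral hα, mul_comm (prodFeat α c u _ _) (prodFeat α c u _ y)]
    exact errFun_integral hα Q u (measurable_prodFeat_left α c u y)
      fun ω => abs_prodFeat_le α c u ω y
  simp_rw [e]
  refine StronglyMeasurable.measurable (StronglyMeasurable.integral_prod_left'
    (f := fun p : (ℕ → ℝ) × (ℕ → I) => prodFeat α c u p.1 p.2 *
      errFun Q (prodFeat α c u p.1)) ?_)
  exact ((measurable_prodFeat_uncurry α c u).mul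
    ((measurable_errFun_prodFeat α Q u).comp measurable_fst)).stronglyMeasurable

/-- The squared norm of the representer is the error of `Q` for the representer itself, whose values
are again errors of kernel sections. Both applications of the error functional commute with the sum
over `u`. -/
theorem hasSum_sqErr (hα : 1 ≤ α) (hs : Summable fun u => (γ u : ℝ) * (α : ℝ) ^ u.card)
    (Q : Algorithm c) :
    HasSum (fun u => (γ u : ℝ) * sqErr α Q u) (‖errRep hα hs Q‖ ^ 2) := by
  have hb : ∀ (u : Finset ℕ) (y : ℕ → I),
      |(γ u : ℝ) * errFun Q fun x => prodKernel (sobKernel α c) u x y| ≤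
        (1 + ∑ i : Fin Q.length, |(Q[i]).1|) * (γ u * (α : ℝ) ^ u.card) := fun u y => by
    rw [abs_mul, NNReal.abs_eq, mul_left_comm]
    exact mul_le_mul_of_nonneg_left
      (abs_errFun_le Q fun x => abs_prodKernel_le hα c u x y) (γ u).2
  have h := hasSum_errFun Q (fun u => (measurable_errFun_prodKernel hα Q u).const_mul (γ u : ℝ)) hb
    (hs.mul_left _)
  rw [← real_inner_self_eq_norm_sq, inner_errRep, integration_sub_apply hα hs]
  simp_rw [errRep_apply]
  simp_rw [errFun_const_mul, errFun_errFun_prodKernel hα] at h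
  exact h

/-- The squared worst case error is `∑_u γ_u e_u(Q)²`. -/
theorem worstCaseError_eq (hα : 1 ≤ α) (hs : Summable fun u => (γ u : ℝ) * (α : ℝ) ^ u.card)
    (Q : Algorithm c) :
    worstCaseError α γ Q = ENNReal.ofReal (√(∑' u, (γ u : ℝ) * sqErr α Q u)) := by
  rw [(hasSum_sqErr hα hs Q).tsum_eq, Real.sqrt_sq (norm_nonneg _)]
  refine le_antisymm (iSup₂_le fun f hf => ENNReal.ofReal_le_ofReal ?_) ?_
  · rw [← inner_errRep hα hs]
    exact (abs_real_inner_le_norm _ _).trans (mul_le_of_le_one_right (norm_nonneg _) hf)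
  · by_cases h0 : ‖errRep hα hs Q‖ = 0
    · rw [h0, ENNReal.ofReal_zero]
      exact zero_le
    -- The normalised representer attains the supremum.
    · refine le_iSup₂_of_le (‖errRep hα hs Q‖⁻¹ • errRep hα hs Q) ?_ (ENNReal.ofReal_le_ofReal ?_)
      · rw [norm_smul, norm_inv, norm_norm, inv_mul_cancel₀ h0]
      · rw [← inner_errRep hα hs, inner_smul_right, real_inner_self_eq_norm_sq, sq, ← mul_assoc,
          inv_mul_cancel₀ h0, one_mul]
        exact le_abs_self _

end RKHS

end


noncomputable section

/-! ### Lower bounds for the errors of features of one variable -/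

theorem intervalIntegral_posPow_left {a b t : ℝ} (ha : a ≤ t) (hb : t ≤ b) (k : ℕ) :
    ∫ x in a..b, posPow x t k = (b - t) ^ (k + 1) / (k + 1) := by
  have h1 : ∫ x in a..t, posPow x t k = 0 := by
    refine (intervalIntegral.integral_congr fun x hx => ?_).trans intervalIntegral.integral_zero
    rw [Set.uIcc_of_le ha] at hx
    simp [posPow, hx.2.not_gt]
  have h2 : Set.EqOn (fun x => posPow x t k) (fun x => (x - t) ^ k) (Set.uIoc t b) :=
    fun x hx => by
      rw [Set.uIoc_of_le hb] at hx
      simp [posPow, hx.1]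
  have h3 : ∫ x in t..b, posPow x t k = (b - t) ^ (k + 1) / (k + 1) := by
    rw [intervalIntegral.integral_congr_ae (ae_of_all _ fun x hx => h2 hx),
      intervalIntegral.integral_comp_sub_right (fun x => x ^ k), integral_pow]
    simp
  rw [← intervalIntegral.integral_add_adjacent_intervals (b := t), h1, h3, zero_add]
  · refine (intervalIntegrable_const (c := (0 : ℝ))).congr fun x hx => ?_
    rw [Set.uIoc_of_le ha] at hx
    simp [posPow, hx.2.not_gt]
  · refine IntervalIntegrable.congr (fun x hx => (h2 hx).symm) ?_
    exact (Continuous.intervalIntegrable (by fun_prop) _ _)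

theorem intervalIntegral_posPow_right {a b t : ℝ} (ha : a ≤ t) (hb : t ≤ b) (k : ℕ) :
    ∫ x in a..b, posPow t x k = (t - a) ^ (k + 1) / (k + 1) := by
  have h := intervalIntegral.integral_comp_neg (a := a) (b := b) fun x => posPow x (-t) k
  have e : ∀ x, posPow (-x) (-t) k = posPow t x k := fun x => by
    simp only [posPow, neg_lt_neg_iff, neg_sub_neg]
  simp_rw [e] at h
  rw [h, intervalIntegral_posPow_left (neg_le_neg hb) (neg_le_neg ha)]
  congr 2
  ring

theorem integral_unitInterval (f : ℝ → ℝ) : ∫ x : I, f x = ∫ x in (0 : ℝ)..1, f x := by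
  rw [intervalIntegral.integral_of_le zero_le_one, ← integral_Icc_eq_integral_Ioc]
  exact integral_subtype measurableSet_Icc f

theorem sum_choose_linear_pow_of_lt {j n : ℕ} (hj : j < n) (A B : ℝ) :
    ∑ k ∈ Finset.range (n + 1), ((-1 : ℤ) ^ (n - k) * n.choose k) • (A + B * k) ^ j = 0 := by
  let P : ℝ[X] := (Polynomial.C B * Polynomial.X + Polynomial.C A) ^ j
  have hP : P.natDegree < n := (Polynomial.natDegree_pow_le_of_le j
    Polynomial.natDegree_linear_le).trans_lt (by omega)
  have h := congrFun (Polynomial.fwdDiff_iter_eq_zero_of_degree_lt hP) 0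
  rw [fwdDiff_iter_eq_sum_shift] at h
  refine (Finset.sum_congr rfl fun k _ => ?_).trans h
  simp [P, add_comm]

/-- The `n`-th forward difference with step `1` of a polynomial of degree `n` is `n!` times its
leading coefficient. The actual step `B` is hidden in the linear polynomial `B X + A`. -/
theorem sum_choose_linear_pow (n : ℕ) (A : ℝ) {B : ℝ} (hB : B ≠ 0) :
    ∑ k ∈ Finset.range (n + 1), ((-1 : ℤ) ^ (n - k) * n.choose k) • (A + B * k) ^ n =
      B ^ n * n.factorial := by
  let P : ℝ[X] := (Polynomial.C B * Polynomial.X + Polynomial.C A) ^ n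
  have hd : P.natDegree = n := by
    simp only [P]
    rw [Polynomial.natDegree_pow, Polynomial.natDegree_linear hB, mul_one]
  have hl : P.leadingCoeff = B ^ n := by
    simp only [P]
    rw [Polynomial.leadingCoeff_pow, Polynomial.leadingCoeff_linear hB]
  have h := congrFun (Polynomial.fwdDiff_iter_degree_eq_factorial P) 0
  rw [hd, hl, fwdDiff_iter_eq_sum_shift] at h
  refine Eq.trans (Finset.sum_congr rfl fun k _ => ?_) (h.trans ?_)
  · simp [P, add_comm]
  · simp

/-- The squared `ℓ²` norm of the coefficients of the finite difference of order `n`. -/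
def diffConst (n : ℕ) : ℝ :=
  ∑ k ∈ Finset.range (n + 1), (((-1 : ℤ) ^ (n - k) * n.choose k : ℤ) : ℝ) ^ 2

theorem diffConst_pos (n : ℕ) : 0 < diffConst n := by
  refine Finset.sum_pos (fun k hk => ?_) ⟨0, by simp⟩
  have : (n.choose k : ℝ) ≠ 0 := by
    exact_mod_cast (Nat.choose_pos (by simpa [Nat.lt_succ_iff] using hk)).ne'
  push_cast
  positivity

/-- A function whose finite differences of order `n` with step `h` are `± h ^ n` cannot be small
in the mean. -/
theorem pow_le_integral_sq {E : ℝ → ℝ} {l r : ℝ} (hlr : l < r) (n : ℕ)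
    (hE : IntervalIntegrable (fun t => E t ^ 2) volume l r)
    (hd : ∀ t h, l < t → 0 < h → t + n * h < r →
      |∑ k ∈ Finset.range (n + 1), ((-1 : ℤ) ^ (n - k) * n.choose k) • E (t + h * k)| = h ^ n) :
    ((r - l) / (n + 1)) ^ (2 * n + 1) ≤ diffConst n * ∫ t in l..r, E t ^ 2 := by
  -- With `n + 1` steps, the `n + 1` translates of `(l, l + h)` tile `(l, r)`, and for a base point
  -- `t` in the first one all nodes `t + k h`, `k ≤ n`, stay inside. Cauchy–Schwarz at each `t` and
  -- integration over the first translate then give the full integral.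
  set h := (r - l) / (n + 1) with hh
  have hn : (0 : ℝ) < n + 1 := by positivity
  have h0 : 0 < h := div_pos (by linarith) hn
  have hr : l + (n + 1 : ℕ) * h = r := by
    rw [hh]
    push_cast
    field_simp
    ring
  have hsub : ∀ k < n + 1, IntervalIntegrable (fun t => E t ^ 2) volume
      (l + (k : ℕ) * h) (l + (k + 1 : ℕ) * h) := fun k hk => by
    refine hE.mono_set ?_
    have h1 : ((k + 1 : ℕ) : ℝ) ≤ (n + 1 : ℕ) := by exact_mod_cast hk
    rw [Set.uIcc_of_le (by push_cast; nlinarith), Set.uIcc_of_le hlr.le]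
    refine Set.Icc_subset_Icc (by nlinarith [mul_nonneg (Nat.cast_nonneg (α := ℝ) k) h0.le]) ?_
    rw [← hr]
    nlinarith
  have hshift : ∀ k < n + 1, IntervalIntegrable (fun t => E (t + h * k) ^ 2) volume l (l + h) ∧
      ∫ t in l..(l + h), E (t + h * k) ^ 2 =
        ∫ t in (l + (k : ℕ) * h)..(l + (k + 1 : ℕ) * h), E t ^ 2 := fun k hk => by
    have e1 : l + (k : ℕ) * h = l + h * k := by ring
    have e2 : l + (k + 1 : ℕ) * h = l + h + h * k := by push_cast; ring
    constructor
    · have := (hsub k hk).comp_add_right (h * k)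
      rw [e1, e2] at this
      simpa using this
    · rw [intervalIntegral.integral_comp_add_right (fun t => E t ^ 2), e1, e2]
  have hsum : ∫ t in l..(l + h), ∑ k ∈ Finset.range (n + 1), E (t + h * k) ^ 2 =
      ∫ t in l..r, E t ^ 2 := by
    rw [intervalIntegral.integral_finsetSum fun k hk => (hshift k (Finset.mem_range.1 hk)).1,
      Finset.sum_congr rfl fun k hk => (hshift k (Finset.mem_range.1 hk)).2,
      intervalIntegral.sum_integral_adjacent_intervals hsub, hr]
    simp
  have hpt : ∀ t ∈ Set.Ioo l (l + h),
      h ^ (2 * n) ≤ diffConst n * ∑ k ∈ Finset.range (n + 1), E (t + h * k) ^ 2 := fun t ht => by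
    have h1 := hd t h ht.1 h0 (by
      rw [← hr]
      push_cast
      linarith [ht.2])
    rw [mul_comm 2 n, pow_mul, ← h1, sq_abs]
    simp_rw [zsmul_eq_mul]
    exact Finset.sum_mul_sq_le_sq_mul_sq _ _ _
  have hint : IntervalIntegrable (fun t => diffConst n *
      ∑ k ∈ Finset.range (n + 1), E (t + h * k) ^ 2) volume l (l + h) := by
    refine IntervalIntegrable.const_mul ?_ _
    have := IntervalIntegrable.sum (Finset.range (n + 1)) (f := fun k t => E (t + h * k) ^ 2)
      fun k hk => (hshift k (Finset.mem_range.1 hk)).1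
    refine this.congr fun t _ => by simp
  have := intervalIntegral.integral_mono_on_of_le_Ioo (by linarith)
    (intervalIntegrable_const (c := h ^ (2 * n))) hint hpt
  rw [intervalIntegral.integral_const, intervalIntegral.integral_const_mul, hsum] at this
  refine le_trans (le_of_eq ?_) this
  rw [add_sub_cancel_left, smul_eq_mul, pow_succ']

/-- A point meets at most one of the disjoint open cells, namely the one whose index is its
rounded-down rescaled position. -/
theorem exists_many_free_cells {n N : ℕ} (z : Fin n → ℝ) (β w : ℝ) (hw : 0 < w) :
    ∃ s ⊆ Finset.range N, N ≤ s.card + n ∧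
      ∀ j ∈ s, ∀ i, z i ∉ Set.Ioo (β + j * w) (β + (j + 1 : ℕ) * w) := by
  classical
  let hit : Finset ℕ := Finset.univ.image fun i : Fin n => ⌊(z i - β) / w⌋₊
  refine ⟨Finset.range N \ hit, Finset.sdiff_subset, ?_, fun j hj i hi => ?_⟩
  · have h1 : hit.card ≤ n := Finset.card_image_le.trans (by simp)
    have h2 := Finset.le_card_sdiff hit (Finset.range N)
    rw [Finset.card_range] at h2
    omega
  · refine (Finset.mem_sdiff.1 hj).2 (Finset.mem_image.2 ⟨i, Finset.mem_univ _, ?_⟩)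
    have h1 : (j : ℝ) < (z i - β) / w := by rw [lt_div_iff₀ hw]; linarith [hi.1]
    have h2 : (z i - β) / w < (j + 1 : ℕ) := by rw [div_lt_iff₀ hw]; linarith [hi.2]
    rw [Nat.floor_eq_iff (le_trans (Nat.cast_nonneg j) h1.le)]
    exact ⟨h1.le, by exact_mod_cast h2⟩

/-- The error of a quadrature formula for the features of one variable. -/
def featErr (α : ℕ) (c : I) {n : ℕ} (a : Fin n → ℝ) (z : Fin n → I) (t : ℝ) : ℝ :=
  (∫ x : I, rawFeat α c x t) - ∑ i, a i * rawFeat α c (z i) t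

theorem measurable_featErr (α : ℕ) (c : I) {n : ℕ} (a : Fin n → ℝ) (z : Fin n → I) :
    Measurable (featErr α c a z) := by
  refine Measurable.sub ?_ (Finset.measurable_sum _ fun i _ =>
    (measurable_rawFeat α c _).const_mul _)
  exact (StronglyMeasurable.integral_prod_right' (f := fun p : ℝ × I => rawFeat α c p.2 p.1)
    ((measurable_rawFeat_uncurry α c).comp measurable_swap).stronglyMeasurable).measurable

theorem abs_featErr_le (α : ℕ) (c : I) {n : ℕ} (a : Fin n → ℝ) (z : Fin n → I) (t : ℝ) :
    |featErr α c a z t| ≤ 1 + ∑ i, |a i| := by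
  refine (abs_sub _ _).trans (add_le_add
    (abs_integral_le_of_forall_abs_le _ fun x => abs_rawFeat_le α c x t) ?_)
  refine (Finset.abs_sum_le_sum_abs _ _).trans (Finset.sum_le_sum fun i _ => ?_)
  rw [abs_mul]
  exact mul_le_of_le_one_right (abs_nonneg _) (abs_rawFeat_le α c _ t)

theorem integral_rawFeat_right {α : ℕ} (hα : 1 ≤ α) {c : I} {t : ℝ} (ht : c < t) (h1 : t ≤ 1) :
    ∫ x : I, rawFeat α c x t = (1 - t) ^ α / α.factorial := by
  have e : ∀ x : I, rawFeat α c x t = posPow x t (α - 1) / (α - 1).factorial := fun x => by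
    simp [rawFeat, h1, remFeat, ht]
  simp_rw [e]
  rw [integral_div, integral_unitInterval fun x => posPow x t (α - 1),
    intervalIntegral_posPow_left (by linarith [c.2.1]) h1]
  obtain ⟨k, rfl⟩ := Nat.exists_eq_add_of_le' hα
  rw [Nat.factorial_succ]
  push_cast
  rw [div_div]

theorem integral_rawFeat_left {α : ℕ} (hα : 1 ≤ α) {c : I} {t : ℝ} (ht : t ≤ c) (h0 : 0 ≤ t) :
    ∫ x : I, rawFeat α c x t = t ^ α / α.factorial := by
  have h1 : t ≤ 1 := ht.trans c.2.2
  have e : ∀ x : I, rawFeat α c x t = posPow t x (α - 1) / (α - 1).factorial := fun x => by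
    simp [rawFeat, h1, remFeat, ht.not_gt]
  simp_rw [e]
  rw [integral_div, integral_unitInterval fun x => posPow t x (α - 1),
    intervalIntegral_posPow_right h0 h1]
  obtain ⟨k, rfl⟩ := Nat.exists_eq_add_of_le' hα
  rw [Nat.factorial_succ]
  push_cast
  rw [div_div]
  simp

/-- As a function of the knot `t`, on an interval on one side of `c` without nodes, each node
contributes zero or a polynomial of degree `α - 1`, which the difference of order `α` annihilates.
Only the exact integral `(1 - t)^α / α!` or `t^α / α!` remains, and its difference is `± h^α`. -/
theorem abs_sum_choose_featErr {α : ℕ} (hα : 1 ≤ α) {c : I} {n : ℕ} (a : Fin n → ℝ)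
    (z : Fin n → I) {l r : ℝ} (hside : (c : ℝ) ≤ l ∧ r ≤ 1 ∨ 0 ≤ l ∧ r ≤ c)
    (hz : ∀ i, (z i : ℝ) ∉ Set.Ioo l r) {t h : ℝ} (ht : l < t) (hh : 0 < h) (hr : t + α * h < r) :
    |∑ k ∈ Finset.range (α + 1), ((-1 : ℤ) ^ (α - k) * α.choose k) •
      featErr α c a z (t + h * k)| = h ^ α := by
  have hf : (α.factorial : ℝ) ≠ 0 := by positivity
  have hmem : ∀ k ∈ Finset.range (α + 1), t + h * k ∈ Set.Ioo l r := fun k hk => by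
    have h1 : (k : ℝ) ≤ α := by exact_mod_cast Nat.lt_succ_iff.1 (Finset.mem_range.1 hk)
    exact ⟨by nlinarith [mul_nonneg hh.le (Nat.cast_nonneg (α := ℝ) k)], by nlinarith⟩
  simp_rw [featErr, smul_sub, Finset.sum_sub_distrib]
  have hzero : ∑ k ∈ Finset.range (α + 1), ((-1 : ℤ) ^ (α - k) * α.choose k) •
      ∑ i, a i * rawFeat α c (z i) (t + h * k) = 0 := by
    simp_rw [Finset.smul_sum]
    rw [Finset.sum_comm]
    refine Finset.sum_eq_zero fun i _ => ?_
    suffices hs : ∑ k ∈ Finset.range (α + 1), ((-1 : ℤ) ^ (α - k) * α.choose k) •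
        rawFeat α c (z i) (t + h * k) = 0 by
      simp_rw [← mul_smul_comm]
      rw [← Finset.mul_sum, hs, mul_zero]
    have hzi : (z i : ℝ) ≤ l ∨ r ≤ z i := by
      by_contra! hc
      exact hz i ⟨hc.1, hc.2⟩
    have key : ∀ A B : ℝ, (∀ k ∈ Finset.range (α + 1), rawFeat α c (z i) (t + h * k) =
        (A + B * k) ^ (α - 1) / (α - 1).factorial) →
        ∑ k ∈ Finset.range (α + 1), ((-1 : ℤ) ^ (α - k) * α.choose k) •
        rawFeat α c (z i) (t + h * k) = 0 := fun A B hAB => by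
      rw [Finset.sum_congr rfl fun k hk => by rw [hAB k hk, div_eq_mul_inv, ← smul_mul_assoc],
        ← Finset.sum_mul, sum_choose_linear_pow_of_lt (by omega), zero_mul]
    rcases hside with hs | hs <;> rcases hzi with hi | hi
    · refine Finset.sum_eq_zero fun k hk => ?_
      have := hmem k hk
      rw [rawFeat, if_pos (by linarith [this.2]), remFeat, if_pos (by linarith [this.1]), posPow,
        if_neg (by linarith [this.1])]
      simp
    · refine key (z i - t) (-h) fun k hk => ?_
      have := hmem k hk
      rw [rawFeat, if_pos (by linarith [this.2]), remFeat, if_pos (by linarith [this.1]), posPow,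
        if_pos (by linarith [this.2])]
      congr 2
      ring
    · refine key (t - z i) h fun k hk => ?_
      have := hmem k hk
      rw [rawFeat, if_pos (by linarith [this.2, c.2.2]), remFeat, if_neg (by linarith [this.2]),
        posPow, if_pos (by linarith [this.1])]
      congr 2
      ring
    · refine Finset.sum_eq_zero fun k hk => ?_
      have := hmem k hk
      rw [rawFeat, if_pos (by linarith [this.2, c.2.2]), remFeat, if_neg (by linarith [this.2]),
        posPow, if_neg (by linarith [this.2])]
      simp
  rw [hzero, sub_zero]
  have key : ∀ A B : ℝ, |B| = h → (∀ k ∈ Finset.range (α + 1),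
      ∫ x : I, rawFeat α c x (t + h * k) = (A + B * k) ^ α / α.factorial) →
      |∑ k ∈ Finset.range (α + 1), ((-1 : ℤ) ^ (α - k) * α.choose k) •
        ∫ x : I, rawFeat α c x (t + h * k)| = h ^ α := fun A B hB hAB => by
    have hB0 : B ≠ 0 := fun h0 => by rw [h0, abs_zero] at hB; exact hh.ne hB
    rw [Finset.sum_congr rfl fun k hk => by rw [hAB k hk, div_eq_mul_inv, ← smul_mul_assoc],
      ← Finset.sum_mul, sum_choose_linear_pow α A hB0, mul_assoc, mul_inv_cancel₀ hf, mul_one,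
      abs_pow, hB]
  rcases hside with hs | hs
  · refine key (1 - t) (-h) (by rw [abs_neg, abs_of_pos hh]) fun k hk => ?_
    have := hmem k hk
    rw [integral_rawFeat_right hα (by linarith [this.1]) (by linarith [this.2])]
    congr 2
    ring
  · refine key t h (abs_of_pos hh) fun k hk => ?_
    have := hmem k hk
    rw [integral_rawFeat_left hα (by linarith [this.2]) (by linarith [this.1])]

/-- One side of `c` contains an interval of length `1/2`. It is cut into `2(n+1)` cells of width `w`
proportional to `1/(n+1)`; at least `n + 1` of them contain no node, and each of these contributes a
multiple of `w^{2α+1}`. -/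
theorem exists_le_integral_featErr_sq {α : ℕ} (hα : 1 ≤ α) (c : I) :
    ∃ C : ℝ, 0 < C ∧ ∀ (n : ℕ) (a : Fin n → ℝ) (z : Fin n → I),
      C * ((n : ℝ) + 1) ^ (-(2 * α : ℝ)) ≤ ∫ t in (0 : ℝ)..1, featErr α c a z t ^ 2 := by
  refine ⟨(diffConst α)⁻¹ * (4 * (α + 1 : ℝ))⁻¹ ^ (2 * α + 1),
    mul_pos (inv_pos.2 (diffConst_pos α)) (by positivity), fun n a z => ?_⟩
  set N := 2 * (n + 1) with hN
  set w : ℝ := 1 / (4 * (n + 1)) with hw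
  have hw0 : 0 < w := by positivity
  have hNw : (N : ℝ) * w = 1 / 2 := by
    rw [hN, hw]
    push_cast
    field_simp
    norm_num
  obtain ⟨β, hβ⟩ : ∃ β : ℝ, ((c : ℝ) ≤ β ∧ β + 1 / 2 ≤ 1 ∨ 0 ≤ β ∧ β + 1 / 2 ≤ c) := by
    by_cases h : (c : ℝ) ≤ 1 / 2
    · exact ⟨c, Or.inl ⟨le_rfl, by linarith⟩⟩
    · exact ⟨0, Or.inr ⟨le_rfl, by linarith⟩⟩
  have hβ0 : 0 ≤ β := by
    rcases hβ with h | h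
    · linarith [c.2.1]
    · exact h.1
  have hβ1 : β + 1 / 2 ≤ 1 := by
    rcases hβ with h | h
    · exact h.2
    · linarith [c.2.2]
  have hint : ∀ p q, p ∈ Set.Icc (0 : ℝ) 1 → q ∈ Set.Icc (0 : ℝ) 1 →
      IntervalIntegrable (fun t => featErr α c a z t ^ 2) volume p q := fun p q hp hq => by
    refine intervalIntegrable_aux ((measurable_featErr α c a z).pow_const 2)
      (C := (1 + ∑ i, |a i|) ^ 2) hp hq fun t _ => ?_
    rw [abs_pow]
    exact pow_le_pow_left₀ (abs_nonneg _) (abs_featErr_le α c a z t) 2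
  have hpt : ∀ k ≤ N, β + k * w ∈ Set.Icc β (β + 1 / 2) := fun k hk => by
    have : (k : ℝ) ≤ N := by exact_mod_cast hk
    have h2 : (k : ℝ) * w ≤ N * w := by gcongr
    exact ⟨by linarith [mul_nonneg (Nat.cast_nonneg (α := ℝ) k) hw0.le], by linarith⟩
  obtain ⟨s, hsN, hscard, hs⟩ := exists_many_free_cells (N := N) (fun i => (z i : ℝ)) β w hw0
  have hcell : ∀ j ∈ s, (diffConst α)⁻¹ * (w / (α + 1)) ^ (2 * α + 1) ≤
      ∫ t in (β + (j : ℕ) * w)..(β + (j + 1 : ℕ) * w), featErr α c a z t ^ 2 := fun j hj => by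
    have hjN : j < N := Finset.mem_range.1 (hsN hj)
    have h1 := hpt j hjN.le
    have h2 := hpt (j + 1) hjN
    have hlt : β + (j : ℕ) * w < β + (j + 1 : ℕ) * w := by push_cast; nlinarith
    have h3 := pow_le_integral_sq hlt α
      (hint _ _ ⟨by linarith [h1.1], by linarith [h1.2]⟩ ⟨by linarith [h2.1], by linarith [h2.2]⟩)
      fun t h ht hh hr => abs_sum_choose_featErr hα a z (by
        rcases hβ with h | h
        · exact Or.inl ⟨by linarith [h1.1], by linarith [h2.2]⟩
        · exact Or.inr ⟨by linarith [h1.1], by linarith [h2.2]⟩) (hs j hj) ht hh hr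
    rw [inv_mul_le_iff₀ (diffConst_pos α)]
    have e : β + (j + 1 : ℕ) * w - (β + (j : ℕ) * w) = w := by push_cast; ring
    rwa [e] at h3
  have hcells : ∑ j ∈ s, ∫ t in (β + (j : ℕ) * w)..(β + (j + 1 : ℕ) * w), featErr α c a z t ^ 2
      ≤ ∫ t in (0 : ℝ)..1, featErr α c a z t ^ 2 := by
    calc _ ≤ ∑ j ∈ Finset.range N,
          ∫ t in (β + (j : ℕ) * w)..(β + (j + 1 : ℕ) * w), featErr α c a z t ^ 2 := by
          refine Finset.sum_le_sum_of_subset_of_nonneg hsN fun j _ _ => ?_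
          exact intervalIntegral.integral_nonneg (by push_cast; nlinarith) fun t _ => sq_nonneg _
      _ = ∫ t in (β + (0 : ℕ) * w)..(β + N * w), featErr α c a z t ^ 2 := by
          refine intervalIntegral.sum_integral_adjacent_intervals fun k hk => hint _ _ ?_ ?_
          · have := hpt k hk.le
            exact ⟨by linarith [this.1], by linarith [this.2]⟩
          · have := hpt (k + 1) hk
            exact ⟨by linarith [this.1], by linarith [this.2]⟩
      _ ≤ _ := by
          rw [hNw]
          refine intervalIntegral.integral_mono_interval (by simpa using hβ0) (by simp) hβ1
            (ae_of_all _ fun t => sq_nonneg _) (hint _ _ (by simp) (by simp))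
  refine le_trans ?_ ((Finset.sum_le_sum hcell).trans hcells)
  rw [Finset.sum_const, nsmul_eq_mul]
  have hcard : (n : ℝ) + 1 ≤ s.card := by
    have : n + 1 ≤ s.card := by omega
    exact_mod_cast this
  have hn : (0 : ℝ) < n + 1 := by positivity
  refine le_trans (le_of_eq ?_) (mul_le_mul_of_nonneg_right hcard
    (mul_nonneg (inv_pos.2 (diffConst_pos α)).le (by positivity)))
  rw [Real.rpow_neg hn.le, (by norm_cast : ((n : ℝ) + 1) ^ (2 * (α : ℝ)) = ((n : ℝ) + 1) ^ (2 * α)),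
    (by rw [hw]; field_simp : w / (α + 1) = (4 * (α + 1 : ℝ))⁻¹ * ((n : ℝ) + 1)⁻¹), mul_pow,
    pow_succ (((n : ℝ) + 1)⁻¹), inv_pow ((n : ℝ) + 1)]
  field_simp

end


noncomputable section

/-! ### Errors of one-dimensional components and the mean of the kernel -/

theorem integral_infinitePi_eval {X : Type*} [MeasurableSpace X] (ν : Measure X)
    [IsProbabilityMeasure ν] (j : ℕ) {h : X → ℝ} (hh : Measurable h) :
    ∫ x, h (x j) ∂Measure.infinitePi (fun _ : ℕ => ν) = ∫ x, h x ∂ν := by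
  simpa using integral_infinitePi_prod ν {j} (fun _ => h) fun _ => hh

theorem integral_prodFeat (α : ℕ) (c : I) (u : Finset ℕ) (ω : ℕ → ℝ) :
    ∫ x, prodFeat α c u ω x ∂uniformMeasure = ∏ j ∈ u, ∫ x : I, feat α c x (ω j) :=
  integral_infinitePi_prod volume u (fun j x => feat α c x (ω j))
    fun j => measurable_feat_left α c (ω j)

theorem errFun_prodFeat_singleton {α : ℕ} {c : I} (Q : Algorithm c) (j : ℕ) (ω : ℕ → ℝ) :
    errFun Q (prodFeat α c {j} ω) = √α * featErr α c (fun i : Fin Q.length => (Q[i]).1)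
      (fun i => (Q[i]).2.1 j) (ω j) := by
  rw [errFun_eq, integral_prodFeat, Finset.prod_singleton, featErr, mul_sub, Finset.mul_sum,
    ← integral_const_mul]
  congr 1
  refine Finset.sum_congr rfl fun i _ => ?_
  rw [prodFeat, Finset.prod_singleton, feat]
  ring

theorem sqErr_singleton {α : ℕ} (hα : 1 ≤ α) {c : I} (Q : Algorithm c) (j : ℕ) :
    sqErr α Q {j} = (∫ t in (0 : ℝ)..1, featErr α c (fun i : Fin Q.length => (Q[i]).1)
        (fun i => (Q[i]).2.1 j) t ^ 2) + ∑ r ∈ Finset.Ico 1 α,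
      featErr α c (fun i : Fin Q.length => (Q[i]).1) (fun i => (Q[i]).2.1 j) (r + 1) ^ 2 := by
  have := isProbabilityMeasure_featMeasure hα
  have hα' : (0 : ℝ) < α := by exact_mod_cast hα
  set F := featErr α c (fun i : Fin Q.length => (Q[i]).1) (fun i => (Q[i]).2.1 j) with hF
  have hm : Measurable fun t => F t ^ 2 := (measurable_featErr α c _ _).pow_const 2
  rw [sqErr]
  simp_rw [errFun_prodFeat_singleton, mul_pow, ← hF, Real.sq_sqrt hα'.le]
  rw [integral_const_mul, integral_infinitePi_eval _ j hm,
    integral_featMeasure α hm (C := (1 + ∑ i : Fin Q.length, |(Q[i]).1|) ^ 2), ← mul_assoc,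
    mul_inv_cancel₀ hα'.ne', one_mul]
  intro t
  rw [abs_pow]
  exact pow_le_pow_left₀ (abs_nonneg _) (abs_featErr_le α c _ _ t) 2

theorem exists_le_sqErr_singleton {α : ℕ} (hα : 1 ≤ α) (c : I) :
    ∃ C : ℝ, 0 < C ∧ ∀ (Q : Algorithm c) (j : ℕ),
      C * ((Q.length : ℝ) + 1) ^ (-(2 * α : ℝ)) ≤ sqErr α Q {j} := by
  obtain ⟨C, hC, h⟩ := exists_le_integral_featErr_sq hα c
  refine ⟨C, hC, fun Q j => ?_⟩
  rw [sqErr_singleton hα]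
  exact (h _ _ _).trans (le_add_of_nonneg_right (Finset.sum_nonneg fun _ _ => sq_nonneg _))

theorem measurable_sobKernel_uncurry {α : ℕ} (hα : 1 ≤ α) (c : I) :
    Measurable fun p : I × I => sobKernel α c p.1 p.2 := by
  have := isProbabilityMeasure_featMeasure hα
  simp_rw [sobKernel_eq_integral hα]
  refine (StronglyMeasurable.integral_prod_right' (ν := featMeasure α)
    (f := fun q : (I × I) × ℝ => feat α c q.1.1 q.2 * feat α c q.1.2 q.2)
    (Measurable.stronglyMeasurable ?_)).measurable
  have h1 : Measurable fun q : (I × I) × ℝ => (q.1.1, q.2) := by fun_prop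
  have h2 : Measurable fun q : (I × I) × ℝ => (q.1.2, q.2) := by fun_prop
  exact ((measurable_feat_uncurry α c).comp h1).mul ((measurable_feat_uncurry α c).comp h2)

theorem sobKernel_comm {α : ℕ} (hα : 1 ≤ α) (c x y : I) :
    sobKernel α c x y = sobKernel α c y x := by
  rw [sobKernel_eq_integral hα, sobKernel_eq_integral hα]
  exact integral_congr_ae (ae_of_all _ fun ω => mul_comm _ _)

theorem integral_integral_eval {k : I → I → ℝ} (hk : Measurable fun p : I × I => k p.1 p.2)
    (j : ℕ) :
    ∫ y, ∫ x, k (x j) (y j) ∂uniformMeasure ∂uniformMeasure = ∫ y : I, ∫ x : I, k x y := by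
  have h1 : ∀ y : I, ∫ x, k (x j) y ∂uniformMeasure = ∫ x : I, k x y := fun y =>
    integral_infinitePi_eval (volume : Measure I) j (h := fun x => k x y)
      (hk.comp (measurable_id.prodMk measurable_const))
  have h2 : Measurable fun y => ∫ x : I, k x y :=
    (StronglyMeasurable.integral_prod_right' (f := fun p : I × I => k p.2 p.1)
      (hk.comp measurable_swap).stronglyMeasurable).measurable
  rw [← integral_infinitePi_eval (volume : Measure I) j h2]
  exact integral_congr_ae (ae_of_all _ fun y => h1 (y j))

/-- The algorithm without sample points errs by the integral itself, and squaring the representer of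
integration gives the double integral of the kernel. -/
theorem kernelMean_eq_sqErr {α : ℕ} (hα : 1 ≤ α) (c : I) (j : ℕ) :
    kernelMean (sobKernel α c) = sqErr α ([] : Algorithm c) {j} := by
  have h1 : ∀ f, errFun ([] : Algorithm c) f = ∫ x, f x ∂uniformMeasure := fun f => by
    simp [errFun]
  have h2 := integral_integral_eval (measurable_sobKernel_uncurry hα c) j
  rw [← errFun_errFun_prodKernel hα, h1]
  simp_rw [h1, prodKernel, Finset.prod_singleton]
  rw [h2, kernelMean]
  exact integral_congr_ae (ae_of_all _ fun x =>
    integral_congr_ae (ae_of_all _ fun y => sobKernel_comm hα c x y))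

/-- The lower bound for quadrature errors applied to the formula without nodes. -/
theorem kernelMean_pos {α : ℕ} (hα : 1 ≤ α) (c : I) : 0 < kernelMean (sobKernel α c) := by
  obtain ⟨C, hC, h⟩ := exists_le_sqErr_singleton hα c
  rw [kernelMean_eq_sqErr hα c 0]
  refine lt_of_lt_of_le ?_ (h [] 0)
  simpa using hC

/-- Features vanish at the anchor, so such an algorithm receives no information about the variable
`j` and does no better than the empty one. -/
theorem sqErr_singleton_of_anchored {α : ℕ} (hα : 1 ≤ α) {c : I} {Q : Algorithm c} {j : ℕ}
    (hQ : ∀ ax ∈ Q, ax.2.1 j = c) : sqErr α Q {j} = kernelMean (sobKernel α c) := by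
  rw [kernelMean_eq_sqErr hα c j, sqErr, sqErr]
  refine integral_congr_ae (ae_of_all _ fun ω => ?_)
  simp only [errFun_eq]
  congr 2
  simp only [List.length_nil, Finset.univ_eq_empty, Finset.sum_empty]
  refine Finset.sum_eq_zero fun i _ => ?_
  have e : (Q[i]).2.1 j = c := hQ _ (List.getElem_mem _)
  rw [prodFeat, Finset.prod_singleton]
  refine (congrArg (fun z => (Q[i]).1 * feat α c z (ω j)) e).trans ?_
  simp [feat_anchor]

theorem podWeights_singleton {Γ γ : ℕ → ℝ≥0} (hΓ1 : Γ 1 = 1) (j : ℕ) :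
    podWeights Γ γ {j} = γ j := by
  simp [podWeights, hΓ1]

/-- All terms of the series for the squared error are nonnegative, so any finite family of
singletons may be kept and the rest dropped. Both lower bounds start here. -/
theorem sum_le_of_worstCaseError_le {α : ℕ} (hα : 1 ≤ α) {c : I} {γ : Finset ℕ → ℝ≥0}
    (hs : Summable fun u => (γ u : ℝ) * (α : ℝ) ^ u.card) {Q : Algorithm c} {ε : ℝ} (hε : 0 < ε)
    (hQ : worstCaseError α γ Q ≤ ENNReal.ofReal ε) (T : Finset ℕ) :
    ∑ j ∈ T, (γ {j} : ℝ) * sqErr α Q {j} ≤ ε ^ 2 := by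
  rw [worstCaseError_eq hα hs, ENNReal.ofReal_le_ofReal_iff hε.le] at hQ
  have h := (hasSum_sqErr hα hs Q)
  have h1 : ∑ j ∈ T, (γ {j} : ℝ) * sqErr α Q {j} ≤ ∑' u, (γ u : ℝ) * sqErr α Q u := by
    refine (Finset.sum_map T ⟨fun j : ℕ => ({j} : Finset ℕ), Finset.singleton_injective⟩
      fun u => (γ u : ℝ) * sqErr α Q u).symm.trans_le ?_
    exact h.summable.sum_le_tsum _ fun u _ => mul_nonneg (γ u).2 (sqErr_nonneg α Q u)
  exact h1.trans (Real.sqrt_le_left hε.le |>.1 hQ)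

/-! ### Lower bounds for the exponent of tractability -/

/-- Errors `ε ≤ 1` can be reached with nested cost `O(ε^{-p})`. -/
def ReachesWith (α : ℕ) (c : I) (γ : Finset ℕ → ℝ≥0) (cost : ℕ → ℝ) (p : ℝ) : Prop :=
  ∃ C : ℝ, 0 < C ∧ ∀ ε : ℝ, 0 < ε → ε ≤ 1 → ∃ Q : Algorithm c,
    worstCaseError α γ Q ≤ ENNReal.ofReal ε ∧ ∃ w : ℕ → Finset ℕ, StrictMono w ∧
      (Q.map fun ax => pointCost cost w ax.2).sum ≤ ENNReal.ofReal (C * ε ^ (-p))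

theorem TractableWith.reachesWith {α : ℕ} {c : I} {γ : Finset ℕ → ℝ≥0} {cost : ℕ → ℝ} {p : ℝ}
    (h : TractableWith α c γ cost p) : ReachesWith α c γ cost p := by
  obtain ⟨-, C, hC, h⟩ := h
  -- The larger constant makes the bound on the infimum strict, so an actual algorithm and an actual
  -- sequence of sets undercut it.
  refine ⟨C + 1, by linarith, fun ε hε _ => ?_⟩
  have hlt : nestedComplexity α c γ cost ε < ENNReal.ofReal ((C + 1) * ε ^ (-p)) := by
    refine (h ε hε).trans_lt ?_
    have := Real.rpow_pos_of_pos hε (-p)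
    rw [ENNReal.ofReal_lt_ofReal_iff (by positivity)]
    nlinarith
  obtain ⟨Q, hQ⟩ := iInf_lt_iff.1 hlt
  obtain ⟨hQe, hQ⟩ := iInf_lt_iff.1 hQ
  obtain ⟨w, hw⟩ := iInf_lt_iff.1 hQ
  obtain ⟨hwm, hw⟩ := iInf_lt_iff.1 hw
  exact ⟨Q, hQe, w, hwm, hw.le⟩

theorem length_le_sum_pointCost {c : I} {cost : ℕ → ℝ} (h1 : ∀ k, 1 ≤ cost k)
    (w : ℕ → Finset ℕ) (Q : Algorithm c) :
    (Q.length : ℝ≥0∞) ≤ (Q.map fun ax => pointCost cost w ax.2).sum := by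
  induction Q with
  | nil => simp
  | cons ax Q ih =>
    rw [List.map_cons, List.sum_cons, List.length_cons, Nat.cast_add, add_comm, Nat.cast_one]
    refine add_le_add (le_iInf₂ fun i _ => ?_) ih
    rw [← ENNReal.ofReal_one]
    exact ENNReal.ofReal_le_ofReal (h1 _)

theorem exponent_le_of_forall_rpow_le {A B x y : ℝ} (hA : 0 < A)
    (h : ∀ ε : ℝ, 0 < ε → ε ≤ 1 → A * ε ^ (-x) ≤ B * ε ^ (-y)) : x ≤ y := by
  by_contra! hxy
  have hB : 0 < B := by
    have := h 1 one_pos le_rfl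
    simp only [Real.one_rpow, mul_one] at this
    linarith
  have hlim : Tendsto (fun ε : ℝ => B * ε ^ (x - y)) (𝓝[>] 0) (𝓝 0) := by
    have h0 : Tendsto (fun ε : ℝ => ε ^ (x - y)) (𝓝[>] 0) (𝓝 0) := by
      have := (Real.continuousAt_rpow_const 0 (x - y) (Or.inr (by linarith))).tendsto
      rw [Real.zero_rpow (by linarith)] at this
      exact this.mono_left nhdsWithin_le_nhds
    simpa using h0.const_mul B
  have hev : ∀ᶠ ε : ℝ in 𝓝[>] 0, A ≤ B * ε ^ (x - y) := by
    filter_upwards [Ioc_mem_nhdsGT (zero_lt_one' ℝ)] with ε hε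
    have h1 := h ε hε.1 hε.2
    have h2 := Real.rpow_pos_of_pos hε.1 x
    rw [sub_eq_add_neg, Real.rpow_add hε.1]
    rw [Real.rpow_neg hε.1.le x, ← div_eq_mul_inv, div_le_iff₀ h2] at h1
    nlinarith
  exact absurd (ge_of_tendsto hlim hev) (by linarith)

/-- Every evaluation costs at least `1`, so at most `C ε^{-p}` points are used, whereas the
component `{0}` alone needs at least a multiple of `ε^{-1/α}` points. -/
theorem ReachesWith.one_div_le {α : ℕ} (hα : 1 ≤ α) {c : I} {γ : Finset ℕ → ℝ≥0}
    (hs : Summable fun u => (γ u : ℝ) * (α : ℝ) ^ u.card) (hγ : 0 < γ {0}) {cost : ℕ → ℝ}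
    (h1 : ∀ k, 1 ≤ cost k) {p : ℝ} (hp : 0 ≤ p) (h : ReachesWith α c γ cost p) :
    1 / (α : ℝ) ≤ p := by
  obtain ⟨C, hC, h⟩ := h
  obtain ⟨C₁, hC₁, hlow⟩ := exists_le_sqErr_singleton hα c
  have hα' : (0 : ℝ) < α := by exact_mod_cast hα
  have hγ' : (0 : ℝ) < γ {0} := hγ
  set A := (γ {0} : ℝ) * C₁ with hA
  have hA0 : 0 < A := mul_pos hγ' hC₁
  refine exponent_le_of_forall_rpow_le (A := A ^ (1 / (2 * α : ℝ))) (B := C + 1)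
    (Real.rpow_pos_of_pos hA0 _) fun ε hε hε1 => ?_
  obtain ⟨Q, hQ, w, hw, hc⟩ := h ε hε hε1
  have hεp : 1 ≤ ε ^ (-p) := Real.one_le_rpow_of_pos_of_le_one_of_nonpos hε hε1 (by linarith)
  have hlen : (Q.length : ℝ) + 1 ≤ (C + 1) * ε ^ (-p) := by
    have h2 := (length_le_sum_pointCost h1 w Q).trans hc
    rw [← ENNReal.ofReal_natCast, ENNReal.ofReal_le_ofReal_iff (by positivity)] at h2
    linarith
  have h3 := sum_le_of_worstCaseError_le hα hs hε hQ {0}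
  rw [Finset.sum_singleton] at h3
  have h4 : A * ((Q.length : ℝ) + 1) ^ (-(2 * α : ℝ)) ≤ ε ^ 2 := by
    refine le_trans ?_ h3
    rw [hA, mul_assoc]
    exact mul_le_mul_of_nonneg_left (hlow Q 0) hγ'.le
  have hL : (0 : ℝ) < (Q.length : ℝ) + 1 := by positivity
  refine le_trans ?_ hlen
  have h5 : A ≤ ε ^ 2 * ((Q.length : ℝ) + 1) ^ (2 * α : ℝ) := by
    rwa [Real.rpow_neg hL.le, ← div_eq_mul_inv, div_le_iff₀ (Real.rpow_pos_of_pos hL _)] at h4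
  have h6 := Real.rpow_le_rpow hA0.le h5 (by positivity : (0 : ℝ) ≤ 1 / (2 * α : ℝ))
  rw [Real.mul_rpow (x := ε ^ 2) (by positivity) (by positivity), ← Real.rpow_mul hL.le,
    mul_one_div_cancel (by positivity), Real.rpow_one, ← Real.rpow_natCast ε 2,
    ← Real.rpow_mul hε.le] at h6
  rw [Real.rpow_neg hε.le, ← div_eq_mul_inv, div_le_iff₀ (Real.rpow_pos_of_pos hε _),
    mul_comm ((Q.length : ℝ) + 1)]
  refine h6.trans_eq ?_
  congr 2
  push_cast
  field_simp

/-- The sets chosen for the individual points form a chain, so the largest of them carries all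
points and was paid for at least once. `W = ∅` covers the algorithm without points, for which no set
has been paid. -/
theorem exists_support {c : I} {cost : ℕ → ℝ} {w : ℕ → Finset ℕ} (hw : StrictMono w)
    {N : ℝ} (Q : Algorithm c)
    (hQ : (Q.map fun ax => pointCost cost w ax.2).sum < ENNReal.ofReal N) :
    ∃ W : Finset ℕ, (W = ∅ ∨ cost W.card < N) ∧ ∀ ax ∈ Q, ∀ j ∉ W, ax.2.1 j = c := by
  -- The induction has to remember that `W` is a member of the chain, in order to compare it with
  -- the set of the next point.
  suffices h : ∃ W : Finset ℕ, (W = ∅ ∨ ∃ i, W = w i ∧ cost W.card < N) ∧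
      ∀ ax ∈ Q, ∀ j ∉ W, ax.2.1 j = c by
    obtain ⟨W, h1, h2⟩ := h
    refine ⟨W, h1.imp_right ?_, h2⟩
    rintro ⟨i, -, h⟩
    exact h
  induction Q with
  | nil => exact ⟨∅, Or.inl rfl, by simp⟩
  | cons ax Q ih =>
    rw [List.map_cons, List.sum_cons] at hQ
    obtain ⟨W, hW, hWQ⟩ := ih (lt_of_le_of_lt le_add_self hQ)
    obtain ⟨i, hi⟩ := iInf_lt_iff.1 (lt_of_le_of_lt le_self_add hQ)
    obtain ⟨hi, hcost⟩ := iInf_lt_iff.1 hi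
    have hcost : cost (w i).card < N := (ENNReal.ofReal_lt_ofReal_iff'.1 hcost).1
    rcases hW with rfl | ⟨k, rfl, hk⟩
    · refine ⟨w i, Or.inr ⟨i, rfl, hcost⟩, fun bx hbx j hj => ?_⟩
      rcases List.mem_cons.1 hbx with rfl | hbx
      · exact hi j hj
      · exact hWQ bx hbx j (by simp)
    · rcases le_total i k with hik | hik
      · refine ⟨w k, Or.inr ⟨k, rfl, hk⟩, fun bx hbx j hj => ?_⟩
        rcases List.mem_cons.1 hbx with rfl | hbx
        · exact hi j fun h => hj (hw.monotone hik h)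
        · exact hWQ bx hbx j hj
      · refine ⟨w i, Or.inr ⟨i, rfl, hcost⟩, fun bx hbx j hj => ?_⟩
        rcases List.mem_cons.1 hbx with rfl | hbx
        · exact hi j hj
        · exact hWQ bx hbx j fun h => hj (hw.monotone hik h)

theorem exists_le_cost {cost : ℕ → ℝ} (h1 : ∀ k, 1 ≤ cost k) {s : ℝ} (hs : 0 ≤ s)
    (hcost : Asymptotics.IsTheta atTop cost fun k : ℕ => (k : ℝ) ^ s) :
    ∃ C : ℝ, 0 < C ∧ ∀ k : ℕ, (k : ℝ) ^ s ≤ C * cost k := by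
  obtain ⟨C, hC⟩ := hcost.2.bound
  obtain ⟨n, hn⟩ := eventually_atTop.1 hC
  refine ⟨max C 0 + (n : ℝ) ^ s + 1, by positivity, fun k => ?_⟩
  have hc := h1 k
  have h0 : (0 : ℝ) ≤ (n : ℝ) ^ s := by positivity
  by_cases hk : n ≤ k
  · have := hn k hk
    rw [Real.norm_of_nonneg (by positivity), Real.norm_of_nonneg (by linarith)] at this
    nlinarith [le_max_left C 0, le_max_right C 0]
  · have : (k : ℝ) ^ s ≤ (n : ℝ) ^ s :=
      Real.rpow_le_rpow (by positivity) (by exact_mod_cast (not_le.1 hk).le) hs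
    nlinarith [le_max_right C 0]

theorem exists_cost_le {cost : ℕ → ℝ} (hmono : Monotone cost) {s : ℝ} (hs : 0 ≤ s)
    (hcost : Asymptotics.IsTheta atTop cost fun k : ℕ => (k : ℝ) ^ s) :
    ∃ C : ℝ, 0 < C ∧ ∀ k : ℕ, cost k ≤ C * ((k : ℝ) + 1) ^ s := by
  obtain ⟨C, hC⟩ := hcost.1.bound
  obtain ⟨n, hn⟩ := eventually_atTop.1 hC
  refine ⟨max C 0 + |cost n| + 1, by positivity, fun k => ?_⟩
  have h1 : (1 : ℝ) ≤ ((k : ℝ) + 1) ^ s := Real.one_le_rpow (by linarith [Nat.cast_nonneg (α := ℝ) k]) hs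
  by_cases hk : n ≤ k
  · have := hn k hk
    rw [Real.norm_of_nonneg (r := (k : ℝ) ^ s) (by positivity)] at this
    have h2 : (k : ℝ) ^ s ≤ ((k : ℝ) + 1) ^ s :=
      Real.rpow_le_rpow (by positivity) (by linarith) hs
    have h3 := le_abs_self (cost k)
    rw [Real.norm_eq_abs] at this
    have h4 : C * (k : ℝ) ^ s ≤ max C 0 * ((k : ℝ) + 1) ^ s :=
      mul_le_mul (le_max_left _ _) h2 (by positivity) (le_max_right _ _)
    nlinarith [abs_nonneg (cost n)]
  · have h2 := hmono (not_le.1 hk).le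
    nlinarith [le_abs_self (cost n), le_max_right C 0, abs_nonneg (cost n)]

/-- A budget that can pay only for sets of at most `k` variables leaves `k` of the first `2k`
variables untouched. Each contributes at least `γ_{2k} C₀` to the squared error, hence `k γ_{2k} C₀
≤ ε²`, where `ε` behaves like `k^{-s/p}`. So the weights decay with exponent `1 + 2s/p`. -/
theorem ReachesWith.exists_weight_le {α : ℕ} (hα : 1 ≤ α) {c : I} {γ : ℕ → ℝ≥0}
    (hγ : Antitone γ) {γ' : Finset ℕ → ℝ≥0} (hγ' : ∀ j, γ' {j} = γ j)
    (hsum : Summable fun u => (γ' u : ℝ) * (α : ℝ) ^ u.card) {cost : ℕ → ℝ}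
    (h1 : ∀ k, 1 ≤ cost k) {s : ℝ} (hs : 0 < s)
    (hcost : Asymptotics.IsTheta atTop cost fun k : ℕ => (k : ℝ) ^ s)
    {p : ℝ} (hp : 0 < p) (h : ReachesWith α c γ' cost p) :
    ∃ C : ℝ, ∀ j : ℕ, (γ j : ℝ) ≤ C * ((j : ℝ) + 1) ^ (-(1 + 2 * s / p)) := by
  classical
  obtain ⟨C, hC, h⟩ := h
  obtain ⟨C₁, hC₁, hlow⟩ := exists_le_cost h1 hs.le hcost
  set κ := kernelMean (sobKernel α c) with hκ
  have hκ0 : 0 < κ := kernelMean_pos hα c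
  -- Chosen so that the budget `(C + 1) ε^{-p}` at `ε = (C₂/k)^{s/p}` forces the set of used
  -- variables to have at most `k` elements; the summand `1` keeps it at least `1`.
  set C₂ : ℝ := (C₁ * (C + 1)) ^ s⁻¹ + 1 with hC₂
  have hC₂0 : 1 ≤ C₂ := by
    have : (0 : ℝ) ≤ (C₁ * (C + 1)) ^ s⁻¹ := by positivity
    linarith
  set r : ℝ := 2 * s / p with hr
  have hr0 : 0 < r := by positivity
  have key : ∀ k : ℕ, C₂ ≤ k → (γ (2 * k) : ℝ) ≤ C₂ ^ r / κ * (k : ℝ) ^ (-(1 + r)) := fun k hk => by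
    have hk0 : (0 : ℝ) < k := by linarith
    set ε : ℝ := (C₂ / k) ^ (s / p) with hε
    have hq0 : 0 < C₂ / k := by positivity
    have hε0 : 0 < ε := Real.rpow_pos_of_pos hq0 _
    have hε1 : ε ≤ 1 := Real.rpow_le_one hq0.le ((div_le_one hk0).2 hk) (by positivity)
    obtain ⟨Q, hQ, w, hw, hc⟩ := h ε hε0 hε1
    have hεp : ε ^ (-p) = (k / C₂) ^ s := by
      rw [hε, ← Real.rpow_mul hq0.le, ← inv_div, Real.inv_rpow (by positivity),
        ← Real.rpow_neg (by positivity)]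
      congr 1
      field_simp
    have hεp0 := Real.rpow_pos_of_pos hε0 (-p)
    obtain ⟨W, hW, hWQ⟩ := exists_support hw (N := (C + 1) * ε ^ (-p)) Q
      (hc.trans_lt ((ENNReal.ofReal_lt_ofReal_iff (by positivity)).2 (by nlinarith)))
    have hWk : W.card ≤ k := by
      rcases hW with rfl | hW
      · simp
      have h2 : (W.card : ℝ) ^ s ≤ C₁ * (C + 1) * (k / C₂) ^ s := by
        refine (hlow W.card).trans ?_
        rw [mul_assoc, ← hεp]
        exact mul_le_mul_of_nonneg_left hW.le hC₁.le
      have h3 := Real.rpow_le_rpow (by positivity) h2 (inv_nonneg.2 hs.le)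
      rw [Real.mul_rpow (by positivity) (by positivity), Real.rpow_rpow_inv (by positivity) hs.ne',
        Real.rpow_rpow_inv (by positivity) hs.ne'] at h3
      have h4 : (C₁ * (C + 1)) ^ s⁻¹ * (k / C₂) ≤ k := by
        rw [mul_div_assoc', div_le_iff₀ (by linarith), mul_comm]
        exact mul_le_mul_of_nonneg_left (by linarith) hk0.le
      exact_mod_cast h3.trans h4
    have h5 := sum_le_of_worstCaseError_le hα hsum hε0 hQ (Finset.range (2 * k) \ W)
    have h6 : (k : ℝ) * (γ (2 * k) * κ) ≤ ε ^ 2 := by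
      refine le_trans ?_ h5
      have hcard : (k : ℝ) ≤ (Finset.range (2 * k) \ W).card := by
        have := Finset.le_card_sdiff W (Finset.range (2 * k))
        rw [Finset.card_range] at this
        exact_mod_cast (by omega : k ≤ (Finset.range (2 * k) \ W).card)
      refine (mul_le_mul_of_nonneg_right hcard (by positivity)).trans ?_
      rw [← nsmul_eq_mul]
      refine Finset.card_nsmul_le_sum _ _ _ fun j hj => ?_
      rw [Finset.mem_sdiff, Finset.mem_range] at hj
      rw [sqErr_singleton_of_anchored hα fun ax hax => hWQ ax hax j hj.2, hγ']
      exact mul_le_mul_of_nonneg_right (by exact_mod_cast hγ hj.1.le) hκ0.le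
    have h7 : ε ^ 2 = C₂ ^ r * (k : ℝ) ^ (-r) := by
      rw [hε, ← Real.rpow_natCast, ← Real.rpow_mul hq0.le, Real.div_rpow (by linarith) hk0.le,
        Real.rpow_neg hk0.le, div_eq_mul_inv]
      have : s / p * ((2 : ℕ) : ℝ) = r := by rw [hr]; push_cast; ring
      rw [this]
    rw [h7] at h6
    rw [neg_add, Real.rpow_add hk0, Real.rpow_neg_one, div_mul_eq_mul_div, le_div_iff₀ hκ0]
    rw [mul_comm (k : ℝ), ← le_div_iff₀ hk0] at h6
    refine h6.trans_eq ?_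
    field_simp
  -- For large `j` the bound is used at `k = j / 2`, where `k ≥ C₂` and `k ≥ (j + 1)/4`. The
  -- finitely many other `j` only need `γ j ≤ γ 0`.
  obtain ⟨n, hn⟩ := exists_nat_ge (2 * C₂ + 4)
  refine ⟨max (C₂ ^ r / κ * 4 ^ (1 + r)) (γ 0 * ((n : ℝ) + 1) ^ (1 + r)), fun j => ?_⟩
  have hj0 : (0 : ℝ) < (j : ℝ) + 1 := by positivity
  by_cases hj : n ≤ j
  · have hjn : 2 * C₂ + 4 ≤ (j : ℝ) := hn.trans (by exact_mod_cast hj)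
    have hdiv : (j : ℝ) ≤ 2 * (j / 2 : ℕ) + 1 := by exact_mod_cast (by omega : j ≤ 2 * (j / 2) + 1)
    have hk : C₂ ≤ (j / 2 : ℕ) := by linarith
    have h2 : (γ j : ℝ) ≤ γ (2 * (j / 2)) := by exact_mod_cast hγ (Nat.mul_div_le j 2)
    refine (h2.trans (key _ hk)).trans ?_
    refine le_trans ?_ (mul_le_mul_of_nonneg_right (le_max_left _ _) (by positivity))
    rw [mul_assoc]
    refine mul_le_mul_of_nonneg_left ?_ (by positivity)
    have h3 : ((j / 2 : ℕ) : ℝ) ^ (-(1 + r)) ≤ (((j : ℝ) + 1) / 4) ^ (-(1 + r)) :=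
      Real.rpow_le_rpow_of_nonpos (by positivity) (by linarith) (by linarith)
    refine h3.trans_eq ?_
    rw [Real.div_rpow hj0.le (by norm_num), Real.rpow_neg (by norm_num : (0 : ℝ) ≤ 4)]
    field_simp
  · refine le_trans ?_ (mul_le_mul_of_nonneg_right (le_max_right _ _) (by positivity))
    rw [mul_assoc]
    have h2 : (γ j : ℝ) ≤ γ 0 := by exact_mod_cast hγ (Nat.zero_le j)
    refine h2.trans (le_mul_of_one_le_right (by positivity) ?_)
    rw [Real.rpow_neg hj0.le, ← div_eq_mul_inv, one_le_div (by positivity)]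
    exact Real.rpow_le_rpow hj0.le (by
      have : j ≤ n := (not_le.1 hj).le
      gcongr) (by linarith)

end


noncomputable section

/-! ### Decay of the weights -/

theorem eq_univ_or_eq_Iio_of_antitone {γ : ℕ → ℝ≥0} (hγ : Antitone γ) :
    {j | 0 < γ j} = Set.univ ∨ ∃ N, {j | 0 < γ j} = Set.Iio N := by
  classical
  by_cases h : ∀ j, 0 < γ j
  · exact Or.inl (Set.eq_univ_of_forall h)
  · push Not at h
    refine Or.inr ⟨Nat.find h, Set.ext fun j => ⟨fun hj => ?_, fun hj => ?_⟩⟩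
    · by_contra hc
      have h1 : γ j ≤ γ (Nat.find h) := hγ (not_lt.1 hc)
      exact absurd (h1.trans (Nat.find_spec h)) (not_le.2 hj)
    · exact not_le.1 (Nat.find_min h hj)

/-- The positive weights occupy an initial segment of `ℕ`, so counting them and indexing them give
the same set, whether finite or not. -/
theorem setOf_natCast_lt_encard {γ : ℕ → ℝ≥0} (hγ : Antitone γ) :
    {j : ℕ | (j : ℕ∞) < {j | 0 < γ j}.encard} = {j | 0 < γ j} := by
  rcases eq_univ_or_eq_Iio_of_antitone hγ with h | ⟨N, h⟩
  · rw [h, Set.encard_univ]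
    ext j
    simp
  · have : (Set.Iio N).encard = N := by
      rw [← Finset.coe_Iio, Set.encard_coe_eq_coe_finsetCard, Nat.card_Iio]
    rw [h, this]
    ext j
    simp

theorem cutOff_one_singleton {Γ γ : ℕ → ℝ≥0} (hΓ1 : Γ 1 = 1) (j : ℕ) :
    cutOff 1 (podWeights Γ γ) {j} = γ j := by
  rw [cutOff, if_pos (by simp), podWeights_singleton hΓ1]

theorem activeSets_cutOff_one {Γ γ : ℕ → ℝ≥0} (hΓ1 : Γ 1 = 1) :
    activeSets (cutOff 1 (podWeights Γ γ)) = (fun j : ℕ => ({j} : Finset ℕ)) '' {j | 0 < γ j} := by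
  ext u
  constructor
  · rintro ⟨hu, hpos⟩
    have hcard : u.card = 1 := by
      have h1 : u.card ≤ 1 := by
        by_contra hc
        rw [cutOff, if_neg (by exact_mod_cast hc)] at hpos
        exact lt_irrefl _ hpos
      have := hu.card_pos
      omega
    obtain ⟨j, rfl⟩ := Finset.card_eq_one.1 hcard
    rw [cutOff_one_singleton hΓ1] at hpos
    exact ⟨j, hpos, rfl⟩
  · rintro ⟨j, hj, rfl⟩
    exact ⟨Finset.singleton_nonempty j, by rw [cutOff_one_singleton hΓ1]; exact hj⟩

theorem setOf_lt_encard_activeSets {Γ γ : ℕ → ℝ≥0} (hΓ1 : Γ 1 = 1) (hγ : Antitone γ) :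
    {j : ℕ | (j : ℕ∞) < (activeSets (cutOff 1 (podWeights Γ γ))).encard} = {j | 0 < γ j} := by
  rw [activeSets_cutOff_one hΓ1, Set.InjOn.encard_image Finset.singleton_injective.injOn,
    setOf_natCast_lt_encard hγ]

theorem hatWeights_singleton {Γ γ : ℕ → ℝ≥0} (hΓ1 : Γ 1 = 1) (K : I → I → ℝ) (j : ℕ) :
    hatWeights K (cutOff 1 (podWeights Γ γ)) {j} = γ j * kernelMean K := by
  rw [hatWeights, cutOff_one_singleton hΓ1, Finset.card_singleton, pow_one]

theorem isOrdering_singleton {Γ γ : ℕ → ℝ≥0} (hΓ1 : Γ 1 = 1) (hγ : Antitone γ) {K : I → I → ℝ}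
    (hK : 0 < kernelMean K) :
    IsOrdering K (cutOff 1 (podWeights Γ γ)) fun j => {j} := by
  rw [IsOrdering, setOf_lt_encard_activeSets hΓ1 hγ, activeSets_cutOff_one hΓ1]
  refine ⟨Finset.singleton_injective.injOn.bijOn_image, fun i _ j _ hij => ?_⟩
  simp only [hatWeights_singleton hΓ1]
  exact mul_le_mul_of_nonneg_right (by exact_mod_cast hγ hij) hK.le

/-- Polynomial upper bounds for the weights bound the decay from below. -/
theorem le_decay {Γ γ : ℕ → ℝ≥0} (hΓ1 : Γ 1 = 1) (hγ : Antitone γ) {K : I → I → ℝ}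
    (hK : 0 < kernelMean K) {r C : ℝ} (h : ∀ j : ℕ, (γ j : ℝ) ≤ C * ((j : ℝ) + 1) ^ (-r)) :
    (r : EReal) ≤ decay K (podWeights Γ γ) 1 := by
  by_contra! hlt
  obtain ⟨r', h1, h2⟩ := EReal.lt_iff_exists_real_btwn.1 hlt
  refine absurd (le_sSup ?_) (not_le.2 h1)
  refine ⟨r', rfl, fun j => {j}, isOrdering_singleton hΓ1 hγ hK, ?_⟩
  have h2' : r' < r := by exact_mod_cast h2
  have hlim : Tendsto (fun j : ℕ => (C * kernelMean K) * ((j : ℝ) + 1) ^ (-(r - r'))) atTop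
      (𝓝 0) := by
    have h3 : Tendsto (fun j : ℕ => (j : ℝ) + 1) atTop atTop :=
      tendsto_atTop_add_const_right _ _ tendsto_natCast_atTop_atTop
    simpa using ((tendsto_rpow_neg_atTop (by linarith : 0 < r - r')).comp h3).const_mul
      (C * kernelMean K)
  refine squeeze_zero (fun j => ?_) (fun j => ?_) hlim
  · refine mul_nonneg ?_ (by positivity)
    split_ifs
    · rw [hatWeights_singleton hΓ1]
      positivity
    · exact le_rfl
  · have hj : (0 : ℝ) < (j : ℝ) + 1 := by positivity
    have h4 : (if (j : ℕ∞) < (activeSets (cutOff 1 (podWeights Γ γ))).encard then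
        hatWeights K (cutOff 1 (podWeights Γ γ)) {j} else 0) ≤ γ j * kernelMean K := by
      split_ifs
      · rw [hatWeights_singleton hΓ1]
      · positivity
    refine (mul_le_mul_of_nonneg_right h4 (by positivity)).trans ?_
    have h5 : ((j : ℝ) + 1) ^ (-(r - r')) = ((j : ℝ) + 1) ^ (-r) * ((j : ℝ) + 1) ^ r' := by
      rw [← Real.rpow_add hj]
      congr 1
      ring
    rw [h5]
    have h6 := mul_le_mul_of_nonneg_right (h j)
      (mul_nonneg hK.le (Real.rpow_pos_of_pos hj r').le)
    nlinarith [h6]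

/-- Below the decay, the weights have polynomial upper bounds. -/
theorem exists_le_of_lt_decay {Γ γ : ℕ → ℝ≥0} (hΓ1 : Γ 1 = 1) (hγ : Antitone γ) {K : I → I → ℝ}
    (hK : 0 < kernelMean K) {r : ℝ} (h : (r : EReal) < decay K (podWeights Γ γ) 1) :
    ∃ C : ℝ, 0 < C ∧ ∀ j : ℕ, (γ j : ℝ) ≤ C * ((j : ℝ) + 1) ^ (-r) := by
  classical
  obtain ⟨_, ⟨r', rfl, e, ⟨hbij, hanti⟩, hlim⟩, hr⟩ := lt_sSup_iff.1 h
  have hr' : r < r' := by exact_mod_cast hr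
  have hS : ∀ j : ℕ, (j : ℕ∞) < (activeSets (cutOff 1 (podWeights Γ γ))).encard ↔ 0 < γ j :=
    fun j => Set.ext_iff.1 (setOf_lt_encard_activeSets (Γ := Γ) hΓ1 hγ) j
  -- Ties allow orderings other than the natural one. The positions of `{0}, …, {j}` are `j + 1`
  -- distinct numbers, so one of them is at least `j`; by monotonicity the entry at position `j`
  -- dominates the weight of that set, which is at least `γ j C₀`.
  have key : ∀ j, 0 < γ j → γ j * kernelMean K ≤ hatWeights K (cutOff 1 (podWeights Γ γ)) (e j) := by
    intro j hj
    have hex : ∀ k : ℕ, ∃ i : ℕ, k ≤ j → 0 < γ i ∧ e i = {k} := fun k => by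
      by_cases hk : k ≤ j
      · have hmem : ({k} : Finset ℕ) ∈ activeSets (cutOff 1 (podWeights Γ γ)) := by
          rw [activeSets_cutOff_one hΓ1]
          exact ⟨k, hj.trans_le (hγ hk), rfl⟩
        obtain ⟨i, hi, hie⟩ := hbij.surjOn hmem
        exact ⟨i, fun _ => ⟨(hS i).1 hi, hie⟩⟩
      · exact ⟨0, fun h => absurd h hk⟩
    choose g hg using hex
    obtain ⟨k, hk, hjk⟩ : ∃ k ≤ j, j ≤ g k := by
      by_contra! hc
      obtain ⟨x, hx, y, hy, hxy, hgxy⟩ := Finset.exists_ne_map_eq_of_card_lt_of_maps_to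
        (s := Finset.range (j + 1)) (t := Finset.range j) (f := g) (by simp)
        (fun k hk => by
          simpa using hc k (Nat.lt_succ_iff.1 (by simpa using hk)))
      have hx := hg x (Nat.lt_succ_iff.1 (by simpa using hx))
      have hy := hg y (Nat.lt_succ_iff.1 (by simpa using hy))
      exact hxy (Finset.singleton_injective (by rw [← hx.2, ← hy.2, hgxy]))
    have h1 := hanti (a := j) (b := g k) ((hS j).2 hj) ((hS _).2 (hg k hk).1) hjk
    simp only [(hg k hk).2, hatWeights_singleton hΓ1] at h1
    refine le_trans (mul_le_mul_of_nonneg_right ?_ hK.le) h1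
    exact_mod_cast hγ hk
  obtain ⟨B, hB⟩ := hlim.bddAbove_range
  refine ⟨(max B 1) / kernelMean K, by positivity, fun j => ?_⟩
  have hj : (0 : ℝ) < (j : ℝ) + 1 := by positivity
  by_cases hγj : 0 < γ j
  · have h1 := hB ⟨j, rfl⟩
    simp only [if_pos ((hS j).2 hγj)] at h1
    have h2 := mul_le_mul_of_nonneg_right (key j hγj) (Real.rpow_pos_of_pos hj r').le
    have h3 : (γ j : ℝ) ≤ max B 1 / kernelMean K * ((j : ℝ) + 1) ^ (-r') := by
      rw [Real.rpow_neg hj.le, ← div_eq_mul_inv, le_div_iff₀ (Real.rpow_pos_of_pos hj _),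
        le_div_iff₀ hK]
      nlinarith [le_max_left B 1]
    refine h3.trans (mul_le_mul_of_nonneg_left ?_ (by positivity))
    exact Real.rpow_le_rpow_of_exponent_le (by linarith [Nat.cast_nonneg (α := ℝ) j]) (by linarith)
  · have : γ j = 0 := le_antisymm (not_lt.1 hγj) zero_le
    rw [this]
    positivity

/-! ### Sums of product and order-dependent weights -/

/-- `(|v|!)^q ∏_{j ∈ v} a_j`. -/
def podProd (q : ℝ) (a : ℕ → ℝ) (v : Finset ℕ) : ℝ := (v.card.factorial : ℝ) ^ q * ∏ j ∈ v, a j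

theorem podProd_nonneg {q : ℝ} {a : ℕ → ℝ} (ha : ∀ j, 0 ≤ a j) (v : Finset ℕ) :
    0 ≤ podProd q a v :=
  mul_nonneg (by positivity) (Finset.prod_nonneg fun j _ => ha j)

theorem pow_card_mul_podProd (q c : ℝ) (a : ℕ → ℝ) (v : Finset ℕ) :
    c ^ v.card * podProd q a v = podProd q (fun j => c * a j) v := by
  rw [podProd, podProd, Finset.prod_mul_distrib, Finset.prod_const]
  ring

theorem podProd_mono {q : ℝ} {a a' : ℕ → ℝ} (ha : ∀ j, 0 ≤ a j) (h : ∀ j, a j ≤ a' j)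
    (v : Finset ℕ) : podProd q a v ≤ podProd q a' v :=
  mul_le_mul_of_nonneg_left (Finset.prod_le_prod (fun j _ => ha j) fun j _ => h j) (by positivity)

theorem factorial_succ_rpow_le {q : ℝ} (hq : 0 ≤ q) (k : ℕ) :
    ((k + 1).factorial : ℝ) ^ q ≤ (2 ^ q) ^ k * (k.factorial : ℝ) ^ q := by
  rw [Nat.factorial_succ, Nat.cast_mul, Real.mul_rpow (by positivity) (by positivity)]
  refine mul_le_mul_of_nonneg_right ?_ (by positivity)
  rw [← Real.rpow_natCast, ← Real.rpow_mul (by norm_num), mul_comm q, Real.rpow_mul (by norm_num),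
    Real.rpow_natCast]
  refine Real.rpow_le_rpow (by positivity) ?_ hq
  exact_mod_cast Nat.lt_two_pow_self (n := k)

/-- The factorial grows by the factor `(k+1)^q ≤ (2^q)^k`, `k = |v|`, which is absorbed into the
numbers attached to the elements of `v`. This frees the factor `a i` at the price of a constant in
each remaining factor. -/
theorem podProd_insert_le {q : ℝ} (hq : 0 ≤ q) {a : ℕ → ℝ} (ha : ∀ j, 0 ≤ a j) {i : ℕ}
    {v : Finset ℕ} (hi : i ∉ v) :
    podProd q a (insert i v) ≤ a i * podProd q (fun j => 2 ^ q * a j) v := by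
  rw [← pow_card_mul_podProd, podProd, podProd, Finset.card_insert_of_notMem hi,
    Finset.prod_insert hi]
  have h := mul_le_mul_of_nonneg_right (factorial_succ_rpow_le hq v.card)
    (mul_nonneg (ha i) (Finset.prod_nonneg fun j (_ : j ∈ v) => ha j))
  refine h.trans_eq ?_
  ring

/-- The standard bound for elementary symmetric polynomials, by induction on the number of
variables; the step uses the first two terms of the binomial expansion of `(a L + S)^{k+1}`. -/
theorem sum_powersetCard_prod_le {a : ℕ → ℝ} (ha : ∀ j, 0 ≤ a j) (L k : ℕ) :
    ∑ v ∈ Finset.powersetCard k (Finset.range L), ∏ j ∈ v, a j ≤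
      (∑ j ∈ Finset.range L, a j) ^ k / k.factorial := by
  classical
  induction L generalizing k with
  | zero =>
    cases k with
    | zero => simp
    | succ k =>
      rw [Finset.powersetCard_eq_empty.2 (by simp)]
      simp
  | succ L ih =>
    cases k with
    | zero => simp
    | succ k =>
      have hL : L ∉ Finset.range L := by simp
      have hS : 0 ≤ ∑ j ∈ Finset.range L, a j := Finset.sum_nonneg fun j _ => ha j
      rw [Finset.range_add_one, Finset.powersetCard_succ_insert hL, Finset.sum_union]
      · rw [Finset.sum_image, Finset.sum_insert hL]
        · have e : ∀ v ∈ Finset.powersetCard k (Finset.range L),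
              ∏ j ∈ insert L v, a j = a L * ∏ j ∈ v, a j := fun v hv => by
            rw [Finset.prod_insert fun h => hL ((Finset.mem_powersetCard.1 hv).1 h)]
          rw [Finset.sum_congr rfl e, ← Finset.mul_sum]
          refine (add_le_add (ih (k + 1)) (mul_le_mul_of_nonneg_left (ih k) (ha L))).trans ?_
          set S := ∑ j ∈ Finset.range L, a j
          have hb : S ^ (k + 1) + (k + 1 : ℕ) * (a L * S ^ k) ≤ (a L + S) ^ (k + 1) := by
            rw [add_pow, Finset.sum_range_succ', Finset.sum_range_succ']
            have : 0 ≤ ∑ i ∈ Finset.range k, a L ^ (i + 1 + 1) * S ^ (k + 1 - (i + 1 + 1)) *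
                ((k + 1).choose (i + 1 + 1) : ℝ) :=
              Finset.sum_nonneg fun i _ => by
                have := ha L
                positivity
            simp only [zero_add, pow_one, pow_zero, Nat.choose_one_right, Nat.choose_zero_right,
              Nat.sub_zero, Nat.add_sub_cancel]
            push_cast at this ⊢
            nlinarith [this]
          rw [Nat.factorial_succ, Nat.cast_mul]
          have hk : (0 : ℝ) < k.factorial := by positivity
          have hk1 : (0 : ℝ) < (k + 1 : ℕ) := by positivity
          refine le_trans (le_of_eq ?_) (div_le_div_of_nonneg_right hb (by positivity))
          field_simp
        · intro v hv w hw hvw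
          have hv' := fun h => hL ((Finset.mem_powersetCard.1 hv).1 h)
          have hw' := fun h => hL ((Finset.mem_powersetCard.1 hw).1 h)
          rw [← Finset.erase_insert hv', ← Finset.erase_insert hw', hvw]
      · rw [Finset.disjoint_left]
        intro v hv hv'
        obtain ⟨w, -, rfl⟩ := Finset.mem_image.1 hv'
        exact hL ((Finset.mem_powersetCard.1 hv).1 (Finset.mem_insert_self _ _))

/-- The ratio of consecutive terms is `S (k+1)^{q-1}`, which tends to `0`. -/
theorem summable_pow_mul_factorial_rpow (S : ℝ) {q : ℝ} (hq : q < 1) (hS : 0 ≤ S) :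
    Summable fun k : ℕ => (k.factorial : ℝ) ^ q * (S ^ k / k.factorial) := by
  rcases hS.eq_or_lt with rfl | hS
  · refine summable_of_ne_finset_zero (s := {0}) fun k hk => ?_
    simp [show k ≠ 0 by simpa using hk]
  refine summable_of_ratio_test_tendsto_lt_one (l := 0) (by norm_num)
    (Eventually.of_forall fun k => by positivity) ?_
  have h3 : Tendsto (fun j : ℕ => (j : ℝ) + 1) atTop atTop :=
    tendsto_atTop_add_const_right _ _ tendsto_natCast_atTop_atTop
  have h := ((tendsto_rpow_neg_atTop (by linarith : 0 < 1 - q)).comp h3).const_mul S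
  rw [mul_zero] at h
  refine h.congr fun k => ?_
  have hk : (0 : ℝ) < (k : ℝ) + 1 := by positivity
  rw [Real.norm_of_nonneg (by positivity), Real.norm_of_nonneg (by positivity),
    Nat.factorial_succ, Nat.cast_mul, Real.mul_rpow (by positivity) (by positivity),
    Function.comp_apply, neg_sub, Real.rpow_sub_one hk.ne']
  have hf : (0 : ℝ) < (k.factorial : ℝ) ^ q := by positivity
  push_cast
  field_simp
  rw [pow_succ']

theorem sum_powerset_eq_sum_powersetCard {f g : Finset ℕ → ℝ} {F : ℕ → ℝ} (L : ℕ)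
    (hfg : ∀ v, f v = F v.card * g v) :
    ∑ v ∈ (Finset.range L).powerset, f v =
      ∑ k ∈ Finset.range (L + 1), F k * ∑ v ∈ Finset.powersetCard k (Finset.range L), g v := by
  rw [Finset.sum_powerset, Finset.card_range]
  refine Finset.sum_congr rfl fun k _ => ?_
  rw [Finset.mul_sum]
  refine Finset.sum_congr rfl fun v hv => ?_
  rw [hfg, (Finset.mem_powersetCard.1 hv).2]

theorem exists_sum_podProd_le {q : ℝ} (hq : q < 1) {a : ℕ → ℝ} (ha : ∀ j, 0 ≤ a j)
    (hs : Summable a) :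
    ∃ C : ℝ, ∀ L, ∑ v ∈ (Finset.range L).powerset, podProd q a v ≤ C := by
  refine ⟨∑' k : ℕ, (k.factorial : ℝ) ^ q * ((∑' j, a j) ^ k / k.factorial), fun L => ?_⟩
  have hS : 0 ≤ ∑' j, a j := tsum_nonneg ha
  have hsum := summable_pow_mul_factorial_rpow (∑' j, a j) hq hS
  rw [sum_powerset_eq_sum_powersetCard L (f := podProd q a) (F := fun k => (k.factorial : ℝ) ^ q)
    (g := fun v => ∏ j ∈ v, a j) fun v => rfl]
  refine le_trans (Finset.sum_le_sum fun k _ => ?_)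
    (hsum.sum_le_tsum (Finset.range (L + 1)) fun k _ => by positivity)
  refine mul_le_mul_of_nonneg_left ((sum_powersetCard_prod_le ha L k).trans ?_) (by positivity)
  refine div_le_div_of_nonneg_right ?_ (by positivity)
  exact pow_le_pow_left₀ (Finset.sum_nonneg fun j _ => ha j)
    (hs.sum_le_tsum _ fun j _ => ha j) k

/-- Write `x^θ = x · x^{θ-1}` and bound each term by the whole sum in the second factor. -/
theorem sum_rpow_le_rpow_sum {ι : Type*} (s : Finset ι) {f : ι → ℝ} (hf : ∀ i ∈ s, 0 ≤ f i)
    {θ : ℝ} (hθ : 1 ≤ θ) : ∑ i ∈ s, f i ^ θ ≤ (∑ i ∈ s, f i) ^ θ := by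
  set S := ∑ i ∈ s, f i with hS
  have hS0 : 0 ≤ S := Finset.sum_nonneg hf
  have e : ∀ x : ℝ, 0 ≤ x → x ^ θ = x * x ^ (θ - 1) := fun x hx => by
    rcases hx.eq_or_lt with rfl | hx
    · rw [Real.zero_rpow (by linarith), zero_mul]
    · rw [Real.rpow_sub_one hx.ne']
      field_simp
  rw [e S hS0]
  nth_rewrite 1 [hS]
  rw [Finset.sum_mul]
  refine Finset.sum_le_sum fun i hi => ?_
  rw [e _ (hf i hi)]
  exact mul_le_mul_of_nonneg_left (Real.rpow_le_rpow (hf i hi)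
    (Finset.single_le_sum hf hi) (by linarith)) (hf i hi)

theorem rpow_sum_le_sum_rpow {ι : Type*} (s : Finset ι) {f : ι → ℝ} (hf : ∀ i ∈ s, 0 ≤ f i)
    {θ : ℝ} (h0 : 0 < θ) (h1 : θ ≤ 1) : (∑ i ∈ s, f i) ^ θ ≤ ∑ i ∈ s, f i ^ θ := by
  have h := sum_rpow_le_rpow_sum s (f := fun i => f i ^ θ) (θ := θ⁻¹)
    (fun i hi => Real.rpow_nonneg (hf i hi) _) ((one_le_inv₀ h0).2 h1)
  rw [Finset.sum_congr rfl fun i hi => Real.rpow_rpow_inv (hf i hi) h0.ne'] at h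
  have h2 := Real.rpow_le_rpow (Finset.sum_nonneg hf) h h0.le
  rwa [Real.rpow_inv_rpow (Finset.sum_nonneg fun i hi => Real.rpow_nonneg (hf i hi) _) h0.ne'] at h2

/-- Since `l` may leave `ql ≥ 1`, the factorials need not be summable directly. One passes to a
smaller power `m ≤ l` with `qm < 1` and `dm > 1`, for which both the factorials and the weights are
under control, and returns to `l` by monotonicity of `ℓ^p` norms. -/
theorem exists_sum_podProd_rpow_le {q d C : ℝ} (hq : 0 ≤ q) (hqd : q < d) {γ : ℕ → ℝ≥0}
    (hγ : ∀ j : ℕ, (γ j : ℝ) ≤ C * ((j : ℝ) + 1) ^ (-d)) {l : ℝ} (hl : 0 < l) (hld : 1 < l * d)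
    {c : ℝ} (hc : 0 ≤ c) :
    ∃ C' : ℝ, ∀ L, ∑ v ∈ (Finset.range L).powerset, podProd q (fun j => c * γ j) v ^ l ≤ C' := by
  have hd : 0 < d := hq.trans_lt hqd
  have hC : 0 ≤ C := by simpa using (NNReal.coe_nonneg (γ 0)).trans (hγ 0)
  -- The power is `m = 1/d'`: `d' > q` gives `qm < 1`, `d' < d` gives summability of the `m`-th
  -- powers of the weights, and `d' > 1/l` gives `m < l`.
  set d' := (max q l⁻¹ + d) / 2 with hd'
  have hmax : max q l⁻¹ < d := max_lt hqd (by rwa [inv_lt_iff_one_lt_mul₀' hl])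
  have h1 : q < d' := by linarith [le_max_left q l⁻¹]
  have h2 : l⁻¹ < d' := by linarith [le_max_right q l⁻¹]
  have h3 : d' < d := by linarith
  have hd'0 : 0 < d' := hq.trans_lt h1
  set m := d'⁻¹ with hm
  have hm0 : 0 < m := inv_pos.2 hd'0
  have hml : 1 ≤ l / m := by
    rw [one_le_div hm0, hm, inv_le_comm₀ hd'0 hl]
    exact h2.le
  have ha : ∀ j, 0 ≤ c * (γ j : ℝ) := fun j => mul_nonneg hc (γ j).2
  have hsum : Summable fun j => (c * (γ j : ℝ)) ^ m := by
    have hs : Summable fun j : ℕ => (c * C) ^ m * ((j + 1 : ℕ) : ℝ) ^ (-(d * m)) := by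
      refine Summable.mul_left _ ?_
      refine (summable_nat_add_iff (f := fun n : ℕ => (n : ℝ) ^ (-(d * m))) 1).2 ?_
      rw [Real.summable_nat_rpow, neg_lt_neg_iff, hm, ← div_eq_mul_inv]
      exact (one_lt_div hd'0).2 h3
    refine Summable.of_nonneg_of_le (fun j => Real.rpow_nonneg (ha j) _) (fun j => ?_) hs
    have hj : (0 : ℝ) ≤ (j : ℝ) + 1 := by positivity
    rw [Nat.cast_add_one, ← neg_mul, Real.rpow_mul hj, ← Real.mul_rpow (by positivity)
      (Real.rpow_nonneg hj _), mul_assoc]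
    exact Real.rpow_le_rpow (ha j) (mul_le_mul_of_nonneg_left (hγ j) hc) hm0.le
  have hqm : q * m < 1 := by rw [hm, ← div_eq_mul_inv, div_lt_one hd'0]; exact h1
  obtain ⟨C', hC'⟩ := exists_sum_podProd_le hqm (fun j => Real.rpow_nonneg (ha j) m) hsum
  have e : ∀ v, podProd q (fun j => c * γ j) v ^ m =
      podProd (q * m) (fun j => (c * (γ j : ℝ)) ^ m) v := fun v => by
    rw [podProd, Real.mul_rpow (by positivity) (Finset.prod_nonneg fun j _ => ha j),
      ← Real.rpow_mul (by positivity), ← Real.finsetProd_rpow _ _ fun j _ => ha j, podProd]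
  refine ⟨C' ^ (l / m), fun L => ?_⟩
  have h4 : ∀ v, podProd q (fun j => c * γ j) v ^ l =
      (podProd q (fun j => c * γ j) v ^ m) ^ (l / m) := fun v => by
    rw [← Real.rpow_mul (podProd_nonneg ha v), mul_div_cancel₀ _ hm0.ne']
  simp_rw [h4, e]
  have hnn : ∀ v, 0 ≤ podProd (q * m) (fun j => (c * (γ j : ℝ)) ^ m) v :=
    podProd_nonneg fun j => Real.rpow_nonneg (ha j) m
  refine (sum_rpow_le_rpow_sum _ (fun v _ => hnn v) hml).trans ?_
  exact Real.rpow_le_rpow (Finset.sum_nonneg fun v _ => hnn v) (hC' L) (by positivity)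

theorem summable_of_sum_powerset_le {f : Finset ℕ → ℝ} (hf : ∀ u, 0 ≤ f u) {C : ℝ}
    (hC : ∀ L, ∑ v ∈ (Finset.range L).powerset, f v ≤ C) : Summable f := by
  refine summable_of_sum_le hf (c := C) fun s => ?_
  obtain ⟨L, hL⟩ : ∃ L, s ⊆ (Finset.range L).powerset := by
    refine ⟨(s.biUnion id).sup id + 1, fun u hu => Finset.mem_powerset.2 fun j hj => ?_⟩
    rw [Finset.mem_range, Nat.lt_succ_iff]
    exact Finset.le_sup (f := id) (Finset.mem_biUnion.2 ⟨u, hu, hj⟩)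
  exact (Finset.sum_le_sum_of_subset_of_nonneg hL fun u _ _ => hf u).trans (hC L)

theorem tsum_le_of_sum_powerset_le {f : Finset ℕ → ℝ} (hf : ∀ u, 0 ≤ f u) {C : ℝ}
    (hC : ∀ L, ∑ v ∈ (Finset.range L).powerset, f v ≤ C) : ∑' u, f u ≤ C := by
  refine (summable_of_sum_powerset_le hf hC).tsum_le_of_sum_le fun s => ?_
  obtain ⟨L, hL⟩ : ∃ L, s ⊆ (Finset.range L).powerset := by
    refine ⟨(s.biUnion id).sup id + 1, fun u hu => Finset.mem_powerset.2 fun j hj => ?_⟩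
    rw [Finset.mem_range, Nat.lt_succ_iff]
    exact Finset.le_sup (f := id) (Finset.mem_biUnion.2 ⟨u, hu, hj⟩)
  exact (Finset.sum_le_sum_of_subset_of_nonneg hL fun u _ _ => hf u).trans (hC L)

/-- Non-empty sets are sorted by their largest element `i`. This is the decomposition on which the
levels and the component-by-component construction rest. -/
theorem sum_powerset_range (f : Finset ℕ → ℝ) (L : ℕ) :
    ∑ u ∈ (Finset.range L).powerset, f u =
      f ∅ + ∑ i ∈ Finset.range L, ∑ v ∈ (Finset.range i).powerset, f (insert i v) := by
  induction L with
  | zero => simp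
  | succ L ih =>
    rw [Finset.range_add_one, Finset.sum_powerset_insert (by simp), ih,
      Finset.sum_insert (by simp)]
    ring

theorem podWeights_le {Γ γ : ℕ → ℝ≥0} (hΓ0 : Γ 0 = 1) {C q : ℝ}
    (hΓ : ∀ k : ℕ, 1 ≤ k → (Γ k : ℝ) ≤ C * (k.factorial : ℝ) ^ q) (hC : 1 ≤ C) (u : Finset ℕ) :
    (podWeights Γ γ u : ℝ) ≤ C * podProd q (fun j => γ j) u := by
  rw [podWeights, podProd, NNReal.coe_mul, NNReal.coe_prod, ← mul_assoc]
  refine mul_le_mul_of_nonneg_right ?_ (by positivity)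
  rcases Nat.eq_zero_or_pos u.card with h | h
  · rw [h, hΓ0]
    simpa using hC
  · exact hΓ _ h

end


noncomputable section

/-! ### Walsh coefficients of the features -/

/-- A sequence of iterated primitives of a function that is constant on either side of `0`. -/
structure IsPrimitiveChain (F : ℕ → ℝ → ℝ) : Prop where
  abs_zero_le : ∀ y, |F 0 y| ≤ 1
  zero_neg : ∀ y y', y < 0 → y' < 0 → F 0 y = F 0 y'
  zero_pos : ∀ y y', 0 < y → 0 < y' → F 0 y = F 0 y'
  intervalIntegrable : ∀ s y y', IntervalIntegrable (F s) volume y y'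
  sub_eq : ∀ s y y', F (s + 1) y' - F (s + 1) y = ∫ x in y..y', F s x
  abs_apply_le : ∀ s y, |y| ≤ 1 → |F s y| ≤ 1

theorem integral_posPow_zero {s : ℕ} {m y : ℝ} (hm : m ≤ 0) (hy : m ≤ y) :
    ∫ x in m..y, posPow x 0 s = posPow y 0 (s + 1) / (s + 1) := by
  rcases le_or_gt 0 y with h | h
  · rw [intervalIntegral_posPow_left hm h]
    rcases h.eq_or_lt with rfl | h
    · simp [posPow]
    · simp [posPow, h]
  · rw [posPow, if_neg h.not_gt, zero_div]
    refine (intervalIntegral.integral_congr fun x hx => ?_).trans intervalIntegral.integral_zero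
    rw [Set.uIcc_of_le hy] at hx
    simp [posPow, (hx.2.trans h.le).not_gt]

theorem intervalIntegrable_posPow_zero (s : ℕ) (y y' : ℝ) :
    IntervalIntegrable (fun x => posPow x 0 s) volume y y' := by
  have h : IntervalIntegrable (fun x => (max x 0 + 1) ^ s) volume y y' :=
    Continuous.intervalIntegrable (by fun_prop) _ _
  refine h.mono_fun (measurable_posPow_left 0 s).aestronglyMeasurable (ae_of_all _ fun x => ?_)
  have h0 : (0 : ℝ) ≤ max x 0 + 1 := by positivity
  simp only [Real.norm_eq_abs]
  rw [abs_of_nonneg (by positivity : 0 ≤ (max x 0 + 1) ^ s), posPow]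
  split_ifs with hx
  · rw [sub_zero, abs_of_nonneg (by positivity)]
    exact pow_le_pow_left₀ hx.le (by linarith [le_max_left x 0]) _
  · simpa using pow_nonneg h0 s

theorem abs_posPow_zero_le (s : ℕ) {y : ℝ} (hy : |y| ≤ 1) : |posPow y 0 s| ≤ 1 := by
  rw [posPow]
  split_ifs with h
  · rw [sub_zero, abs_pow]
    exact pow_le_one₀ (abs_nonneg _) hy
  · simp

theorem isPrimitiveChain_posPow : IsPrimitiveChain fun s y => posPow y 0 s / s.factorial where
  abs_zero_le y := by
    simp only [posPow, pow_zero]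
    split_ifs <;> simp
  zero_neg y y' h h' := by simp [posPow, h.not_gt, h'.not_gt]
  zero_pos y y' h h' := by simp [posPow, h, h']
  intervalIntegrable s y y' := (intervalIntegrable_posPow_zero s y y').div_const _
  sub_eq s y y' := by
    set m := min 0 (min y y')
    have h1 := integral_posPow_zero (s := s) (m := m) (y := y) (min_le_left _ _)
      ((min_le_right _ _).trans (min_le_left _ _))
    have h2 := integral_posPow_zero (s := s) (m := m) (y := y') (min_le_left _ _)
      ((min_le_right _ _).trans (min_le_right _ _))
    rw [intervalIntegral.integral_div, ← intervalIntegral.integral_interval_sub_left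
      (intervalIntegrable_posPow_zero s m y') (intervalIntegrable_posPow_zero s m y), h1, h2,
      Nat.factorial_succ, Nat.cast_mul]
    push_cast
    field_simp
  abs_apply_le s y hy := abs_div_factorial_le_one (abs_posPow_zero_le s hy) _

/-- A monomial of degree `r` must appear at position `α - 1` of its chain, so the chain starts with
`e = α - 1 - r` zeros. -/
theorem isPrimitiveChain_pow (e : ℕ) :
    IsPrimitiveChain fun s y => if s < e then 0 else y ^ (s - e) / (s - e).factorial where
  abs_zero_le y := by split_ifs <;> simp
  zero_neg y y' _ _ := by simp
  zero_pos y y' _ _ := by simp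
  intervalIntegrable s y y' := by
    split_ifs
    · exact intervalIntegrable_const
    · exact Continuous.intervalIntegrable (by fun_prop) _ _
  sub_eq s y y' := by
    rcases lt_trichotomy (s + 1) e with h | h | h
    · simp [h, (by omega : s < e)]
    · simp [h, (by omega : s < e)]
    · have h1 : ¬ s + 1 < e := by omega
      have h2 : ¬ s < e := by omega
      simp only [h1, h2, if_false, intervalIntegral.integral_div, integral_pow]
      rw [(by omega : s + 1 - e = s - e + 1), Nat.factorial_succ, Nat.cast_mul]
      push_cast
      field_simp
  abs_apply_le s y hy := by
    split_ifs
    · simp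
    · refine abs_div_factorial_le_one ?_ _
      rw [abs_pow]
      exact pow_le_one₀ (abs_nonneg _) hy

theorem isPrimitiveChain_zero : IsPrimitiveChain fun _ _ => 0 where
  abs_zero_le y := by simp
  zero_neg y y' _ _ := rfl
  zero_pos y y' _ _ := rfl
  intervalIntegrable s y y' := intervalIntegrable_const
  sub_eq s y y' := by simp
  abs_apply_le s y hy := by simp

/-- Each integration of a reflected function costs a sign; the offset `e` lets the sign be `+` at
the position that is needed. -/
theorem IsPrimitiveChain.reflect {F : ℕ → ℝ → ℝ} (hF : IsPrimitiveChain F) (e : ℕ) :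
    IsPrimitiveChain fun s y => (-1) ^ (s + e) * F s (-y) where
  abs_zero_le y := by simpa [abs_mul] using hF.abs_zero_le (-y)
  zero_neg y y' h h' := by rw [hF.zero_pos (-y) (-y') (by linarith) (by linarith)]
  zero_pos y y' h h' := by rw [hF.zero_neg (-y) (-y') (by linarith) (by linarith)]
  intervalIntegrable s y y' := by
    have := (IntervalIntegrable.iff_comp_neg (f := F s) (a := -y) (b := -y')).1
      (hF.intervalIntegrable s _ _)
    rw [neg_neg, neg_neg] at this
    exact this.const_mul _
  sub_eq s y y' := by
    rw [intervalIntegral.integral_const_mul, intervalIntegral.integral_comp_neg (f := F s),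
      ← hF.sub_eq, ← mul_sub, (by omega : s + 1 + e = s + e + 1), pow_succ]
    ring
  abs_apply_le s y hy := by
    rw [abs_mul, abs_pow, abs_neg, abs_one, one_pow, one_mul]
    exact hF.abs_apply_le s _ (by rwa [abs_neg])

/-- Truncated powers on either side of the knot and Taylor monomials are all `α - 1` times
integrated step functions or zero, up to translation. The Walsh estimates thus need only one proof.
-/
theorem exists_isPrimitiveChain_rawFeat {α : ℕ} (hα : 1 ≤ α) (c : I) (ω : ℝ) :
    ∃ F : ℕ → ℝ → ℝ, IsPrimitiveChain F ∧ ∃ t ∈ Set.Icc (0 : ℝ) 1,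
      ∀ x : I, rawFeat α c x ω = F (α - 1) ((x : ℝ) - t) := by
  by_cases h : ω ≤ 1
  · by_cases hc : (c : ℝ) < ω
    · refine ⟨_, isPrimitiveChain_posPow, ω, ⟨c.2.1.trans hc.le, h⟩, fun x => ?_⟩
      simp only [rawFeat, h, remFeat, hc, if_true, posPow, sub_pos, sub_zero]
    · by_cases h0 : 0 ≤ ω
      · refine ⟨_, isPrimitiveChain_posPow.reflect (α - 1), ω, ⟨h0, h⟩, fun x => ?_⟩
        simp only [rawFeat, h, remFeat, hc, if_true, if_false, posPow, neg_sub, sub_pos, sub_zero]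
        rw [← two_mul, pow_mul]
        norm_num
      · refine ⟨_, isPrimitiveChain_zero, 0, by simp, fun x => ?_⟩
        have hx : ¬ (x : ℝ) < ω := by linarith [x.2.1]
        simp only [rawFeat, h, remFeat, hc, if_true, if_false, posPow, hx, zero_div]
  · by_cases hr : ∃ r ∈ Finset.Ico 1 α, ω = r + 1
    · obtain ⟨r, hr, rfl⟩ := hr
      refine ⟨_, isPrimitiveChain_pow (α - 1 - r), c, c.2, fun x => ?_⟩
      have := Finset.mem_Ico.1 hr
      rw [rawFeat_natCast c x hr, polyFeat, if_neg (by omega),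
        (by omega : α - 1 - (α - 1 - r) = r)]
    · push Not at hr
      refine ⟨_, isPrimitiveChain_zero, 0, by simp, fun x => ?_⟩
      rw [rawFeat, if_neg h, Finset.sum_eq_zero fun r h => if_neg (hr r h)]

/-- `b^{-(l_1 + … + l_s)}`, where `l_1 > l_2 > …` are the positions of the nonzero digits of `k`;
all of them are taken if there are less than `s`. -/
def walshRate (b : ℕ) : ℕ → (n : ℕ) → (Fin n → ZMod b) → ℝ
  | _, 0, _ => 1
  | 0, _ + 1, _ => 1
  | s + 1, n + 1, k => if k (Fin.last n) = 0 then walshRate b (s + 1) n (Fin.init k)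
      else ((b : ℝ) ^ (n + 1))⁻¹ * walshRate b s n (Fin.init k)

theorem walshRate_zero_left {b n : ℕ} (k : Fin n → ZMod b) : walshRate b 0 n k = 1 := by
  cases n <;> rfl

theorem walshRate_nonneg (s : ℕ) {b n : ℕ} (k : Fin n → ZMod b) : 0 ≤ walshRate b s n k := by
  induction n generalizing s with
  | zero => simp [walshRate]
  | succ n ih =>
    cases s with
    | zero => simp [walshRate]
    | succ s =>
      rw [walshRate]
      split_ifs
      · exact ih _ _
      · exact mul_nonneg (by positivity) (ih _ _)

/-! ### Walsh coefficients on digit vectors and their decay. -/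

section Walsh

variable {b : ℕ} [Fact b.Prime]

/-- The number `∑_l v_l b^{-l}` with the base `b` digits `v`. -/
def gridVal {n : ℕ} (v : Fin n → ZMod b) : ℝ := ∑ l, ((v l).val : ℝ) / (b : ℝ) ^ ((l : ℕ) + 1)

/-- The Walsh coefficients of a function on the digit vectors. -/
def walshCoeff {n : ℕ} (g : (Fin n → ZMod b) → ℝ) (k : Fin n → ZMod b) : ℂ :=
  ((b : ℂ) ^ n)⁻¹ * ∑ v, ZMod.stdAddChar (-(k ⬝ᵥ v)) * (g v : ℂ)

theorem one_lt_base : (1 : ℝ) < b := by exact_mod_cast (Fact.out : b.Prime).one_lt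

theorem base_pos : (0 : ℝ) < b := zero_lt_one.trans one_lt_base

theorem gridVal_snoc {n : ℕ} (v : Fin n → ZMod b) (z : ZMod b) :
    gridVal (Fin.snoc v z : Fin (n + 1) → ZMod b) =
      gridVal v + (z.val : ℝ) / (b : ℝ) ^ (n + 1) := by
  rw [gridVal, Fin.sum_univ_castSucc]
  simp [gridVal]

theorem sum_snoc {M : Type*} [AddCommMonoid M] {n : ℕ} (f : (Fin (n + 1) → ZMod b) → M) :
    ∑ v, f v = ∑ v : Fin n → ZMod b, ∑ z, f (Fin.snoc v z) := by
  rw [← (Fin.snocEquiv fun _ : Fin (n + 1) => ZMod b).sum_comp, Fintype.sum_prod_type,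
    Finset.sum_comm]
  rfl

theorem dotProduct_snoc {n : ℕ} (k : Fin (n + 1) → ZMod b) (v : Fin n → ZMod b) (z : ZMod b) :
    k ⬝ᵥ (Fin.snoc v z : Fin (n + 1) → ZMod b) = Fin.init k ⬝ᵥ v + k (Fin.last n) * z := by
  simp [dotProduct, Fin.sum_univ_castSucc, Fin.init]

/-- The finest digit is split off, with its sum outermost. The variant below puts that sum
innermost, where a vanishing character sum can be applied cell by cell. -/
theorem walshCoeff_succ {n : ℕ} (g : (Fin (n + 1) → ZMod b) → ℝ) (k : Fin (n + 1) → ZMod b) :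
    walshCoeff g k = (b : ℂ)⁻¹ * ∑ z, ZMod.stdAddChar (-(k (Fin.last n) * z)) *
      walshCoeff (fun v => g (Fin.snoc v z)) (Fin.init k) := by
  simp only [walshCoeff, sum_snoc, dotProduct_snoc, neg_add, AddChar.map_add_eq_mul]
  rw [Finset.sum_comm, pow_succ, mul_inv]
  simp only [Finset.mul_sum]
  refine Finset.sum_congr rfl fun z _ => Finset.sum_congr rfl fun v _ => ?_
  ring

theorem walshCoeff_succ' {n : ℕ} (g : (Fin (n + 1) → ZMod b) → ℝ) (k : Fin (n + 1) → ZMod b) :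
    walshCoeff g k = ((b : ℂ) ^ n)⁻¹ * ∑ v, ZMod.stdAddChar (-(Fin.init k ⬝ᵥ v)) *
      ((b : ℂ)⁻¹ * ∑ z, ZMod.stdAddChar (-(k (Fin.last n) * z)) * (g (Fin.snoc v z) : ℂ)) := by
  simp only [walshCoeff, sum_snoc, dotProduct_snoc, neg_add, AddChar.map_add_eq_mul]
  rw [pow_succ, mul_inv]
  simp only [Finset.mul_sum]
  refine Finset.sum_congr rfl fun z _ => Finset.sum_congr rfl fun v _ => ?_
  ring

theorem sum_stdAddChar_neg_mul {a : ZMod b} (ha : a ≠ 0) :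
    ∑ z, (ZMod.stdAddChar (-(a * z)) : ℂ) = 0 := by
  have h := AddChar.sum_mulShift (-a) (ZMod.isPrimitive_stdAddChar b)
  rw [if_neg (by simpa using ha), Nat.cast_zero] at h
  rw [← h]
  exact Finset.sum_congr rfl fun z _ => by ring_nf

theorem norm_inv_mul_sum_le {g : ZMod b → ℂ} {C : ℝ} (hg : ∀ z, ‖g z‖ ≤ C) (a : ZMod b) :
    ‖(b : ℂ)⁻¹ * ∑ z, ZMod.stdAddChar (-(a * z)) * g z‖ ≤ C := by
  have hb := base_pos (b := b)
  rw [norm_mul, norm_inv, Complex.norm_natCast, inv_mul_le_iff₀ hb]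
  refine (norm_sum_le _ _).trans ((Finset.sum_le_card_nsmul _ _ C fun z _ => ?_).trans ?_)
  · rw [norm_mul, AddChar.norm_apply, one_mul]
    exact hg z
  · rw [Finset.card_univ, ZMod.card, nsmul_eq_mul]

/-- The integer `b^n ∑_l v_l b^{-l}`. -/
def gridIndex : (n : ℕ) → (Fin n → ZMod b) → ℕ
  | 0, _ => 0
  | n + 1, v => b * gridIndex n (Fin.init v) + (v (Fin.last n)).val

theorem gridVal_eq {n : ℕ} (v : Fin n → ZMod b) : gridVal v = gridIndex n v / (b : ℝ) ^ n := by
  have hb := base_pos (b := b)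
  induction n with
  | zero => simp [gridVal, gridIndex]
  | succ n ih =>
    rw [gridIndex, ← Fin.snoc_init_self v, gridVal_snoc, Fin.init_snoc, Fin.snoc_last, ih]
    push_cast
    field_simp
    ring

theorem gridIndex_injective (n : ℕ) : Function.Injective (gridIndex (b := b) n) := by
  have hb : 0 < b := (Fact.out : b.Prime).pos
  induction n with
  | zero => exact fun v w _ => Subsingleton.elim _ _
  | succ n ih =>
    intro v w h
    simp only [gridIndex] at h
    have h1 : gridIndex n (Fin.init v) = gridIndex n (Fin.init w) := by
      have := congrArg (· / b) h
      simpa [Nat.mul_add_div hb, Nat.div_eq_of_lt (ZMod.val_lt _)] using this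
    have h2 : v (Fin.last n) = w (Fin.last n) := ZMod.val_injective b (by rw [h1] at h; omega)
    rw [← Fin.snoc_init_self v, ← Fin.snoc_init_self w, ih h1, h2]

theorem gridIndex_lt {n : ℕ} (v : Fin n → ZMod b) : gridIndex n v < b ^ n := by
  induction n with
  | zero => simp [gridIndex]
  | succ n ih =>
    rw [gridIndex, pow_succ']
    calc b * gridIndex n (Fin.init v) + (v (Fin.last n)).val
        < b * gridIndex n (Fin.init v) + b := by gcongr; exact ZMod.val_lt _
      _ = b * (gridIndex n (Fin.init v) + 1) := by ring
      _ ≤ b * b ^ n := Nat.mul_le_mul_left _ (ih _)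

theorem gridVal_nonneg {n : ℕ} (v : Fin n → ZMod b) : 0 ≤ gridVal v := by
  rw [gridVal_eq]
  positivity

theorem gridVal_lt_one {n : ℕ} (v : Fin n → ZMod b) : gridVal v < 1 := by
  have hb := base_pos (b := b)
  rw [gridVal_eq, div_lt_one (by positivity)]
  exact_mod_cast gridIndex_lt v

theorem card_gridVal_mem_le (n : ℕ) (t : ℝ) :
    (Finset.univ.filter fun v : Fin n → ZMod b =>
      t < gridVal v + ((b : ℝ) ^ n)⁻¹ ∧ gridVal v ≤ t).card ≤ 1 := by
  have hb := base_pos (b := b)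
  rw [Finset.card_le_one]
  intro v hv w hw
  simp only [Finset.mem_filter, Finset.mem_univ, true_and] at hv hw
  have hn : (0 : ℝ) < (b : ℝ) ^ n := by positivity
  have key : ∀ v w : Fin n → ZMod b, gridVal v < gridVal w + ((b : ℝ) ^ n)⁻¹ →
      gridIndex n v ≤ gridIndex n w := fun v w h => by
    rw [gridVal_eq, gridVal_eq, inv_eq_one_div, ← add_div, div_lt_div_iff_of_pos_right hn] at h
    exact Nat.lt_succ_iff.1 (by exact_mod_cast h)
  exact gridIndex_injective n (le_antisymm (key v w (by linarith)) (key w v (by linarith)))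

/-- At most one grid cell contains the jump `t`, so a mean of terms supported on that cell gains the
factor `b^{-n}`. -/
theorem norm_inv_mul_sum_le_of_support {n : ℕ} (t : ℝ) {g : (Fin n → ZMod b) → ℂ} {C : ℝ}
    (hC : 0 ≤ C) (hg : ∀ v, ‖g v‖ ≤ C)
    (h0 : ∀ v, ¬ (t < gridVal v + ((b : ℝ) ^ n)⁻¹ ∧ gridVal v ≤ t) → g v = 0) :
    ‖((b : ℂ) ^ n)⁻¹ * ∑ v, g v‖ ≤ C * ((b : ℝ) ^ n)⁻¹ := by
  classical
  have hb := base_pos (b := b)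
  rw [norm_mul, norm_inv, norm_pow, Complex.norm_natCast, mul_comm]
  refine mul_le_mul_of_nonneg_right ?_ (by positivity)
  rw [← Finset.sum_filter_of_ne (p := fun v => t < gridVal v + ((b : ℝ) ^ n)⁻¹ ∧ gridVal v ≤ t)
    fun v _ hv => by_contra fun h => hv (h0 v h)]
  refine (norm_sum_le _ _).trans ((Finset.sum_le_card_nsmul _ _ C fun v _ => hg v).trans ?_)
  rw [nsmul_eq_mul]
  exact mul_le_of_le_one_left hC (by exact_mod_cast card_gridVal_mem_le n t)

theorem walshCoeff_sub {n : ℕ} (g g' : (Fin n → ZMod b) → ℝ) (k : Fin n → ZMod b) :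
    walshCoeff g k - walshCoeff g' k = walshCoeff (fun v => g v - g' v) k := by
  simp only [walshCoeff, ← mul_sub, ← Finset.sum_sub_distrib, Complex.ofReal_sub]

theorem walshCoeff_integral {n : ℕ} {g : (Fin n → ZMod b) → ℝ → ℝ} {y y' : ℝ}
    (hg : ∀ v, IntervalIntegrable (g v) volume y y') (k : Fin n → ZMod b) :
    walshCoeff (fun v => ∫ x in y..y', g v x) k = ∫ x in y..y', walshCoeff (fun v => g v x) k := by
  have hi : ∀ v, IntervalIntegrable (fun x => (ZMod.stdAddChar (-(k ⬝ᵥ v)) : ℂ) * (g v x : ℂ))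
      volume y y' := fun v => IntervalIntegrable.const_mul ⟨(hg v).1.ofReal, (hg v).2.ofReal⟩ _
  simp only [walshCoeff]
  rw [intervalIntegral.integral_const_mul, intervalIntegral.integral_finsetSum fun v _ => hi v]
  simp only [intervalIntegral.integral_const_mul, intervalIntegral.integral_ofReal]

theorem digit_div_le (z : ZMod b) (n : ℕ) :
    (z.val : ℝ) / (b : ℝ) ^ (n + 1) ≤ ((b : ℝ) ^ n)⁻¹ - ((b : ℝ) ^ (n + 1))⁻¹ := by
  have hb := base_pos (b := b)
  have hz : (z.val : ℝ) + 1 ≤ b := by exact_mod_cast ZMod.val_lt z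
  have : ((b : ℝ) ^ n)⁻¹ - ((b : ℝ) ^ (n + 1))⁻¹ = (b - 1) / (b : ℝ) ^ (n + 1) := by
    field_simp
    ring
  rw [this]
  exact div_le_div_of_nonneg_right (by linarith) (by positivity)

/-- Induction on the number of digits, removing the finest one. If it is zero in `k`, the
coefficient is a mean of coefficients with shifted knots. If it is nonzero, the character sum over
that digit removes everything not depending on it: for a step function only the cell of the jump
survives, and for a primitive one integration over a length at most `b · b^{-(n+1)}` is gained while
one order of smoothness is spent. The knot may lie slightly left of `0`, because the induction
shifts it by the removed digit. -/
theorem IsPrimitiveChain.norm_walshCoeff_le {F : ℕ → ℝ → ℝ} (hF : IsPrimitiveChain F) (s : ℕ)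
    {n : ℕ} (k : Fin n → ZMod b) {t : ℝ} (h0 : -((b : ℝ) ^ n)⁻¹ ≤ t) (h1 : t ≤ 1) :
    ‖walshCoeff (fun v => F s (gridVal v - t)) k‖ ≤ (b : ℝ) ^ (s + 1) * walshRate b (s + 1) n k := by
  have hb1 := one_lt_base (b := b)
  have hb := base_pos (b := b)
  induction n generalizing s t with
  | zero =>
    have : walshCoeff (fun v => F s (gridVal v - t)) k = F s (-t) := by
      simp [walshCoeff, gridVal]
    rw [this, Complex.norm_real, walshRate, mul_one]
    refine (hF.abs_apply_le s _ (abs_le.2 ⟨by linarith, ?_⟩)).trans (one_le_pow₀ hb1.le)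
    simp at h0
    linarith
  | succ n ih =>
    have hz0 : ∀ z : ZMod b, 0 ≤ (z.val : ℝ) / (b : ℝ) ^ (n + 1) := fun z => by positivity
    have hz1 := fun z : ZMod b => digit_div_le z n
    have e : ∀ (s : ℕ) (z : ZMod b) (v : Fin n → ZMod b),
        F s (gridVal (Fin.snoc v z : Fin (n + 1) → ZMod b) - t) =
          F s (gridVal v - (t - (z.val : ℝ) / (b : ℝ) ^ (n + 1))) := fun s z v => by
      rw [gridVal_snoc]
      ring_nf
    by_cases hk : k (Fin.last n) = 0
    · rw [walshRate, if_pos hk, walshCoeff_succ]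
      simp only [e]
      exact norm_inv_mul_sum_le (fun z => ih s _ (by linarith [hz1 z]) (by linarith [hz0 z])) _
    · rw [walshRate, if_neg hk]
      cases s with
      | zero =>
        rw [walshRate_zero_left, mul_one, walshCoeff_succ']
        have hr : (b : ℝ) ^ (0 + 1) * ((b : ℝ) ^ (n + 1))⁻¹ = 1 * ((b : ℝ) ^ n)⁻¹ := by
          field_simp
          ring
        rw [hr]
        refine norm_inv_mul_sum_le_of_support t zero_le_one (fun v => ?_) fun v hv => ?_
        · rw [norm_mul, AddChar.norm_apply, one_mul]
          refine norm_inv_mul_sum_le (fun z => ?_) _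
          rw [Complex.norm_real]
          exact hF.abs_zero_le _
        · have hconst : ∀ z : ZMod b, F 0 (gridVal (Fin.snoc v z : Fin (n + 1) → ZMod b) - t) =
              F 0 (gridVal v - t) := fun z => by
            rw [gridVal_snoc]
            have hz2 := hz0 z
            have hz3 := hz1 z
            have hz4 : 0 < ((b : ℝ) ^ (n + 1))⁻¹ := by positivity
            by_cases h : gridVal v ≤ t
            · have h' : ¬ t < gridVal v + ((b : ℝ) ^ n)⁻¹ := fun h'' => hv ⟨h'', h⟩
              have h5 : 0 < ((b : ℝ) ^ n)⁻¹ := by positivity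
              exact hF.zero_neg _ _ (by linarith) (by linarith)
            · exact hF.zero_pos _ _ (by linarith) (by linarith)
          simp only [hconst, ← Finset.sum_mul, sum_stdAddChar_neg_mul hk, zero_mul, mul_zero]
      | succ s =>
        -- The value with last digit `0` may be subtracted for free, as the characters of the last
        -- digit sum to zero; the difference is an integral of `F s`.
        have hsub : walshCoeff (fun v => F (s + 1) (gridVal v - t)) k =
            (b : ℂ)⁻¹ * ∑ z, ZMod.stdAddChar (-(k (Fin.last n) * z)) *
              ∫ y in (0 : ℝ)..(z.val : ℝ) / (b : ℝ) ^ (n + 1),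
                walshCoeff (fun v => F s (gridVal v - (t - y))) (Fin.init k) := by
          have h2 : ∀ z : ZMod b, ∫ y in (0 : ℝ)..(z.val : ℝ) / (b : ℝ) ^ (n + 1),
                walshCoeff (fun v => F s (gridVal v - (t - y))) (Fin.init k) =
              walshCoeff (fun v => F (s + 1) (gridVal (Fin.snoc v z : Fin (n + 1) → ZMod b) - t))
                (Fin.init k) - walshCoeff (fun v => F (s + 1) (gridVal v - t)) (Fin.init k) :=
            fun z => by
            rw [walshCoeff_sub, ← walshCoeff_integral]
            · congr 1
              funext v
              rw [hF.sub_eq, gridVal_snoc]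
              have := intervalIntegral.integral_comp_add_left (F s) (a := 0)
                (b := (z.val : ℝ) / (b : ℝ) ^ (n + 1)) (gridVal v - t)
              rw [add_zero] at this
              rw [(by ring : gridVal v + (z.val : ℝ) / (b : ℝ) ^ (n + 1) - t =
                gridVal v - t + (z.val : ℝ) / (b : ℝ) ^ (n + 1)), ← this]
              refine intervalIntegral.integral_congr fun y _ => ?_
              ring_nf
            · intro v
              have := (hF.intervalIntegrable s (gridVal v - t)
                (gridVal v - t + (z.val : ℝ) / (b : ℝ) ^ (n + 1))).comp_add_left (gridVal v - t)
              simp only [sub_self, add_sub_cancel_left] at this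
              refine this.congr fun y _ => ?_
              ring_nf
          simp only [h2, mul_sub, Finset.sum_sub_distrib, ← Finset.sum_mul,
            sum_stdAddChar_neg_mul hk, zero_mul, sub_zero]
          rw [walshCoeff_succ]
        rw [hsub]
        refine norm_inv_mul_sum_le (fun z => ?_) _
        have hr := walshRate_nonneg (s + 1) (Fin.init k)
        have h3 := intervalIntegral.norm_integral_le_of_norm_le_const
          (a := 0) (b := (z.val : ℝ) / (b : ℝ) ^ (n + 1))
          (f := fun y => walshCoeff (fun v => F s (gridVal v - (t - y))) (Fin.init k))
          (C := (b : ℝ) ^ (s + 1) * walshRate b (s + 1) n (Fin.init k)) fun y hy => by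
            rw [Set.uIoc_of_le (hz0 z)] at hy
            exact ih s _ (by linarith [hz1 z, hy.2]) (by linarith [hy.1])
        refine h3.trans ?_
        rw [sub_zero, abs_of_nonneg (hz0 z)]
        have hz : (z.val : ℝ) / (b : ℝ) ^ (n + 1) ≤ b * ((b : ℝ) ^ (n + 1))⁻¹ := by
          rw [div_eq_mul_inv]
          exact mul_le_mul_of_nonneg_right (by exact_mod_cast (ZMod.val_lt z).le) (by positivity)
        calc _ ≤ (b : ℝ) ^ (s + 1) * walshRate b (s + 1) n (Fin.init k) *
              (b * ((b : ℝ) ^ (n + 1))⁻¹) := mul_le_mul_of_nonneg_left hz (by positivity)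
          _ = _ := by ring

end Walsh

end

noncomputable section

/-! ### Discretisation error of the grid and sums of Walsh bounds. -/

section Walsh

variable {b : ℕ} [Fact b.Prime]

theorem sum_zmod_val {M : Type*} [AddCommMonoid M] (f : ℕ → M) :
    ∑ z : ZMod b, f z.val = ∑ i ∈ Finset.range b, f i :=
  Finset.sum_nbij ZMod.val (fun z _ => Finset.mem_range.2 (ZMod.val_lt z))
    (ZMod.val_injective b).injOn
    (fun i hi => ⟨(i : ZMod b), by simp,
      ZMod.val_cast_of_lt (Finset.mem_range.1 (by exact_mod_cast hi))⟩)
    fun z _ => rfl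

theorem integral_eq_sum_grid {f : ℝ → ℝ} (hf : ∀ y y', IntervalIntegrable f volume y y') (n : ℕ) :
    ∫ x in (0 : ℝ)..1, f x =
      ∑ v : Fin n → ZMod b, ∫ x in gridVal v..gridVal v + ((b : ℝ) ^ n)⁻¹, f x := by
  have hb := base_pos (b := b)
  induction n with
  | zero => simp [gridVal]
  | succ n ih =>
    rw [ih, sum_snoc]
    refine Finset.sum_congr rfl fun v _ => ?_
    have h := intervalIntegral.sum_integral_adjacent_intervals (f := f) (μ := volume)
      (a := fun i : ℕ => gridVal v + (i : ℝ) / (b : ℝ) ^ (n + 1)) (n := b) fun k _ => hf _ _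
    rw [← sum_zmod_val (b := b)] at h
    have e : ((b : ℝ) ^ n)⁻¹ = (b : ℝ) / (b : ℝ) ^ (n + 1) := by
      field_simp
      ring
    simp only [Nat.cast_zero, zero_div, add_zero] at h
    rw [e, ← h]
    refine Finset.sum_congr rfl fun z _ => ?_
    rw [gridVal_snoc]
    congr 1
    push_cast
    ring

theorem IsPrimitiveChain.abs_sub_le {F : ℕ → ℝ → ℝ} (hF : IsPrimitiveChain F) (s : ℕ) {y y' : ℝ}
    (hy : |y| ≤ 1) (hy' : |y'| ≤ 1) : |F (s + 1) y' - F (s + 1) y| ≤ |y' - y| := by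
  rw [hF.sub_eq]
  have := intervalIntegral.norm_integral_le_of_norm_le_const (a := y) (b := y') (f := F s) (C := 1)
    fun x hx => hF.abs_apply_le s x (by
      rw [abs_le] at hy hy' ⊢
      rcases Set.mem_uIoc.1 hx with h | h
      · exact ⟨by linarith, by linarith⟩
      · exact ⟨by linarith, by linarith⟩)
  simpa using this

/-- A step function is misrepresented only on the cell of its jump; the later members of the chain
are Lipschitz with constant `1`, so each cell contributes at most its mesh. -/
theorem IsPrimitiveChain.abs_mean_sub_le {F : ℕ → ℝ → ℝ} (hF : IsPrimitiveChain F) (s n : ℕ)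
    {t : ℝ} (h0 : 0 ≤ t) (h1 : t ≤ 1) :
    |((b : ℝ) ^ n)⁻¹ * ∑ v : Fin n → ZMod b, F s (gridVal v - t) - ∫ x in (0 : ℝ)..1, F s (x - t)| ≤
      2 * ((b : ℝ) ^ n)⁻¹ := by
  have hb := base_pos (b := b)
  set h := ((b : ℝ) ^ n)⁻¹ with hh
  have hpos : 0 < h := by positivity
  have hi : ∀ y y', IntervalIntegrable (fun x => F s (x - t)) volume y y' := fun y y' => by
    simpa using (hF.intervalIntegrable s (y - t) (y' - t)).comp_sub_right t
  set D : (Fin n → ZMod b) → ℝ := fun v =>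
    h⁻¹ * ∫ x in gridVal v..gridVal v + h, (F s (gridVal v - t) - F s (x - t)) with hD
  have hsum : h * ∑ v : Fin n → ZMod b, F s (gridVal v - t) - ∫ x in (0 : ℝ)..1, F s (x - t) =
      h * ∑ v, D v := by
    rw [integral_eq_sum_grid (b := b) hi n, Finset.mul_sum, Finset.mul_sum,
      ← Finset.sum_sub_distrib]
    refine Finset.sum_congr rfl fun v _ => ?_
    simp only [hD]
    rw [intervalIntegral.integral_sub intervalIntegrable_const (hi _ _),
      intervalIntegral.integral_const, add_sub_cancel_left, smul_eq_mul, ← hh,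
      mul_inv_cancel_left₀ hpos.ne']
  have hbound : ∀ (v : Fin n → ZMod b) (C : ℝ), (∀ x, gridVal v ≤ x → x ≤ gridVal v + h →
      |F s (gridVal v - t) - F s (x - t)| ≤ C) → |D v| ≤ C := fun v C hC => by
    have := intervalIntegral.norm_integral_le_of_norm_le_const (a := gridVal v)
      (b := gridVal v + h) (f := fun x => F s (gridVal v - t) - F s (x - t)) (C := C)
      fun x hx => by
        rw [Set.uIoc_of_le (by linarith)] at hx
        exact hC x hx.1.le hx.2
    simp only [hD]
    rw [abs_mul, abs_of_pos (inv_pos.2 hpos), inv_mul_le_iff₀ hpos]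
    simpa [abs_of_pos hpos, mul_comm] using this
  have hle1 : ∀ v : Fin n → ZMod b, gridVal v + h ≤ 1 := fun v => by
    rw [hh, gridVal_eq, inv_eq_one_div, ← add_div, div_le_one (by positivity)]
    exact_mod_cast gridIndex_lt v
  rw [hsum]
  cases s with
  | zero =>
    have := norm_inv_mul_sum_le_of_support (n := n) t (g := fun v => (D v : ℂ)) (C := 2)
      (by norm_num) (fun v => ?_) fun v hv => ?_
    · have e : |h * ∑ v, D v| = ‖((b : ℂ) ^ n)⁻¹ * ∑ v, (D v : ℂ)‖ := by
        rw [← Real.norm_eq_abs, ← Complex.norm_real, hh]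
        push_cast
        rfl
      rw [e]
      exact this
    · rw [Complex.norm_real]
      refine hbound v 2 fun x _ _ => (abs_sub _ _).trans ?_
      linarith [hF.abs_zero_le (gridVal v - t), hF.abs_zero_le (x - t)]
    · have : D v = 0 := by
        simp only [hD]
        rw [intervalIntegral.integral_of_le (by linarith), integral_Ioc_eq_integral_Ioo,
          setIntegral_congr_fun (g := fun _ => 0) measurableSet_Ioo, integral_zero, mul_zero]
        intro x hx
        have hx1 := hx.1
        have hx2 := hx.2
        simp only
        rw [sub_eq_zero]
        by_cases hvt : gridVal v ≤ t
        · have h' : ¬ t < gridVal v + h := fun h'' => hv ⟨h'', hvt⟩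
          exact hF.zero_neg _ _ (by linarith) (by linarith)
        · exact hF.zero_pos _ _ (by linarith) (by linarith)
      simp [this]
  | succ s =>
    have hDv : ∀ v, |D v| ≤ h := fun v => hbound v h fun x hx1 hx2 => by
      have hv := gridVal_nonneg v
      have hv1 := hle1 v
      refine (hF.abs_sub_le s (abs_le.2 ⟨by linarith, by linarith⟩)
        (abs_le.2 ⟨by linarith, by linarith⟩)).trans ?_
      rw [abs_le]
      exact ⟨by linarith, by linarith⟩
    rw [abs_mul, abs_of_pos hpos]
    have h2 : |∑ v, D v| ≤ (b : ℝ) ^ n * h := by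
      refine (Finset.abs_sum_le_sum_abs _ _).trans
        ((Finset.sum_le_card_nsmul _ _ h fun v _ => hDv v).trans ?_)
      simp
    rw [hh, mul_inv_cancel₀ (by positivity)] at h2
    nlinarith

/-- The points of the grid with mesh `b^{-n}`. -/
def gridPt {n : ℕ} (v : Fin n → ZMod b) : I := ⟨gridVal v, gridVal_nonneg v, (gridVal_lt_one v).le⟩

theorem walshCoeff_const_mul {n : ℕ} (a : ℝ) (g : (Fin n → ZMod b) → ℝ) (k : Fin n → ZMod b) :
    walshCoeff (fun v => a * g v) k = a * walshCoeff g k := by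
  simp only [walshCoeff, Finset.mul_sum, Complex.ofReal_mul]
  exact Finset.sum_congr rfl fun v _ => by ring

theorem norm_walshCoeff_feat_le {α : ℕ} (hα : 1 ≤ α) (c : I) (ω : ℝ) {n : ℕ} (k : Fin n → ZMod b) :
    ‖walshCoeff (fun v => feat α c (gridPt v) ω) k‖ ≤ √α * (b : ℝ) ^ α * walshRate b α n k := by
  have hb := base_pos (b := b)
  obtain ⟨F, hF, t, ht, hFt⟩ := exists_isPrimitiveChain_rawFeat hα c ω
  simp only [feat, hFt]
  rw [walshCoeff_const_mul, norm_mul, Complex.norm_real, Real.norm_of_nonneg (Real.sqrt_nonneg _),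
    mul_assoc]
  refine mul_le_mul_of_nonneg_left ?_ (Real.sqrt_nonneg _)
  have h : 0 < ((b : ℝ) ^ n)⁻¹ := by positivity
  have := hF.norm_walshCoeff_le (α - 1) k (t := t) (by linarith [ht.1]) ht.2
  rwa [Nat.sub_add_cancel hα] at this

/-- First order in the mesh suffices even for higher order rules, because their points have `n = αm`
digits. -/
theorem abs_mean_feat_sub_le {α : ℕ} (hα : 1 ≤ α) (c : I) (ω : ℝ) (n : ℕ) :
    |((b : ℝ) ^ n)⁻¹ * ∑ v : Fin n → ZMod b, feat α c (gridPt v) ω - ∫ x, feat α c x ω| ≤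
      2 * √α * ((b : ℝ) ^ n)⁻¹ := by
  obtain ⟨F, hF, t, ht, hFt⟩ := exists_isPrimitiveChain_rawFeat hα c ω
  simp only [feat, hFt]
  rw [integral_const_mul, integral_unitInterval fun x => F (α - 1) (x - t), ← Finset.mul_sum,
    mul_left_comm, ← mul_sub, abs_mul, abs_of_nonneg (Real.sqrt_nonneg _), mul_comm 2, mul_assoc]
  exact mul_le_mul_of_nonneg_left (hF.abs_mean_sub_le (α - 1) n ht.1 ht.2) (Real.sqrt_nonneg _)

theorem sum_walshRate_rpow_succ (s n : ℕ) (θ : ℝ) :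
    ∑ k : Fin (n + 1) → ZMod b, walshRate b (s + 1) (n + 1) k ^ θ =
      ∑ k : Fin n → ZMod b, walshRate b (s + 1) n k ^ θ +
        (b - 1) * (((b : ℝ) ^ (n + 1))⁻¹ ^ θ * ∑ k : Fin n → ZMod b, walshRate b s n k ^ θ) := by
  classical
  have hb := base_pos (b := b)
  rw [sum_snoc, Finset.mul_sum, Finset.mul_sum, ← Finset.sum_add_distrib]
  refine Finset.sum_congr rfl fun k _ => ?_
  simp only [walshRate, Fin.snoc_last, Fin.init_snoc]
  rw [← Finset.add_sum_erase _ _ (Finset.mem_univ (0 : ZMod b)), if_pos rfl]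
  congr 1
  rw [Finset.sum_congr rfl fun z hz => by rw [if_neg (Finset.ne_of_mem_erase hz)],
    Finset.sum_const, Finset.card_erase_of_mem (Finset.mem_univ _), Finset.card_univ, ZMod.card,
    nsmul_eq_mul, Nat.cast_sub (Fact.out : b.Prime).one_lt.le, Nat.cast_one,
    Real.mul_rpow (by positivity) (walshRate_nonneg _ _)]

/-- By induction on `s`, the sum in which only the `s` leading nonzero digits are weighted grows at
most like `b^{(1 - s/α) n}`: it starts at `b^n`, and each weighted digit removes a factor `b^{1/α}`
per digit position. At `s = α` the sum is bounded. -/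
theorem exists_sum_walshRate_rpow_le {α : ℕ} (hα : 1 ≤ α) {θ : ℝ} (hθ : 1 < α * θ) :
    ∃ C : ℝ, ∀ n, ∑ k : Fin n → ZMod b, walshRate b α n k ^ θ ≤ C := by
  have hb1 := one_lt_base (b := b)
  have hb := base_pos (b := b)
  have hα0 : (0 : ℝ) < α := by exact_mod_cast hα
  -- `x` is the growth rate lost per weighted digit; the assumption on `θ` says exactly that `η =
  -- b^{-θ} x < 1`, so a convergent geometric series is left over in each step.
  set x : ℝ := (b : ℝ) ^ (α : ℝ)⁻¹ with hx
  have hx1 : 1 ≤ x := Real.one_le_rpow hb1.le (by positivity)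
  have hx0 : 0 < x := by linarith
  set y : ℝ := ((b : ℝ)⁻¹) ^ θ with hy
  have hy0 : 0 < y := Real.rpow_pos_of_pos (by positivity) _
  set η := y * x with hη
  have hη0 : 0 < η := by positivity
  have hη1 : η < 1 := by
    rw [hη, hy, hx, Real.inv_rpow hb.le, ← Real.rpow_neg hb.le, ← Real.rpow_add hb]
    refine Real.rpow_lt_one_of_one_lt_of_neg hb1 ?_
    rw [neg_add_lt_iff_lt_add, add_zero, inv_lt_iff_one_lt_mul₀ hα0]
    linarith
  have hy1 : y ≤ 1 := Real.rpow_le_one (by positivity) (inv_le_one_of_one_le₀ hb1.le) (by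
    by_contra! h
    nlinarith)
  have hypow : ∀ n : ℕ, (((b : ℝ) ^ n)⁻¹) ^ θ = y ^ n := fun n => by
    rw [hy, ← inv_pow, ← Real.rpow_natCast, ← Real.rpow_mul (by positivity), mul_comm,
      Real.rpow_mul (by positivity), Real.rpow_natCast]
  have key : ∀ s ≤ α, ∃ C : ℝ, 0 ≤ C ∧ ∀ n, ∑ k : Fin n → ZMod b, walshRate b s n k ^ θ ≤
      C * (x ^ (α - s)) ^ n := by
    intro s
    induction s with
    | zero =>
      refine fun _ => ⟨1, zero_le_one, fun n => le_of_eq ?_⟩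
      have hxα : x ^ α = b := by
        rw [hx, ← Real.rpow_natCast, ← Real.rpow_mul hb.le, inv_mul_cancel₀ hα0.ne', Real.rpow_one]
      simp [walshRate_zero_left, hxα]
    | succ s ih =>
      intro hs
      obtain ⟨C, hC0, hC⟩ := ih (by omega)
      set X := x ^ (α - (s + 1)) with hX
      have hX1 : 1 ≤ X := one_le_pow₀ hx1
      have hX2 : x ^ (α - s) = X * x := by rw [hX, ← pow_succ]; congr 1; omega
      set A := (b - 1) * C with hA
      have hA0 : 0 ≤ A := mul_nonneg (by linarith) hC0
      have hstep : ∀ n, ∑ k : Fin n → ZMod b, walshRate b (s + 1) n k ^ θ ≤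
          1 + ∑ i ∈ Finset.range n, A * (X ^ i * η ^ i) := by
        intro n
        induction n with
        | zero => simp [walshRate]
        | succ n ihn =>
          rw [sum_walshRate_rpow_succ, Finset.sum_range_succ, ← add_assoc, hypow]
          refine add_le_add ihn ?_
          rw [hA, mul_assoc]
          refine mul_le_mul_of_nonneg_left ?_ (by linarith)
          calc y ^ (n + 1) * ∑ k : Fin n → ZMod b, walshRate b s n k ^ θ
              ≤ y ^ n * (C * (X * x) ^ n) := by
                refine mul_le_mul (pow_le_pow_of_le_one hy0.le hy1 (Nat.le_succ n))
                  (hX2 ▸ hC n) (Finset.sum_nonneg fun k _ =>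
                    Real.rpow_nonneg (walshRate_nonneg _ _) _) (by positivity)
            _ = C * (X ^ n * η ^ n) := by rw [hη, mul_pow, mul_pow]; ring
      refine ⟨1 + A * (1 - η)⁻¹, by have := inv_pos.2 (sub_pos.2 hη1); positivity, fun n => ?_⟩
      refine (hstep n).trans ?_
      have hXn : 1 ≤ X ^ n := one_le_pow₀ hX1
      have hsum : ∑ i ∈ Finset.range n, A * (X ^ i * η ^ i) ≤ A * (X ^ n * (1 - η)⁻¹) := by
        rw [← Finset.mul_sum]
        refine mul_le_mul_of_nonneg_left ?_ hA0
        calc ∑ i ∈ Finset.range n, X ^ i * η ^ i ≤ ∑ i ∈ Finset.range n, X ^ n * η ^ i :=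
              Finset.sum_le_sum fun i hi => mul_le_mul_of_nonneg_right
                (pow_le_pow_right₀ hX1 (Finset.mem_range.1 hi).le) (by positivity)
          _ = X ^ n * ∑ i ∈ Finset.range n, η ^ i := (Finset.mul_sum _ _ _).symm
          _ ≤ X ^ n * (1 - η)⁻¹ := by
              refine mul_le_mul_of_nonneg_left ?_ (by positivity)
              rw [← tsum_geometric_of_lt_one hη0.le hη1]
              exact (summable_geometric_of_lt_one hη0.le hη1).sum_le_tsum _
                fun i _ => by positivity
      nlinarith
  obtain ⟨C, -, hC⟩ := key α le_rfl
  exact ⟨C, fun n => by simpa using hC n⟩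

end Walsh

end

noncomputable section

/-! ### Polynomial lattice rules as digital nets -/

section PolyLattice

variable {b : ℕ} [Fact b.Prime]

/-- The minimal polynomial of a primitive element of the field with `b^n` elements. -/
theorem exists_irreducible_natDegree (b : ℕ) [Fact b.Prime] {n : ℕ} (hn : n ≠ 0) :
    ∃ p : (ZMod b)[X], Irreducible p ∧ p.natDegree = n := by
  obtain ⟨x, hx⟩ := Field.exists_primitive_element (ZMod b) (GaloisField b n)
  refine ⟨minpoly (ZMod b) x, minpoly.irreducible (Algebra.IsIntegral.isIntegral x), ?_⟩
  rw [(Field.primitive_element_iff_minpoly_natDegree_eq (ZMod b) x).1 hx, GaloisField.finrank b hn]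

theorem coeff_toLaurent (f : (ZMod b)[X]) (z : ℤ) :
    (toLaurent b f).coeff z = if z ≤ 0 then f.coeff (-z).toNat else 0 := by
  induction f using Polynomial.induction_on' with
  | add f g hf hg =>
    rw [toLaurent, map_add, HahnSeries.coeff_add, ← toLaurent, ← toLaurent, hf, hg]
    split_ifs <;> simp
  | monomial i a =>
    rw [toLaurent, Polynomial.aeval_monomial, HahnSeries.single_pow, one_pow,
      Polynomial.coeff_monomial,
      -- Ring homomorphisms out of `ZMod b` are unique, so the algebra map is the embedding of
      -- constants.
      RingHom.congr_fun (Subsingleton.elim (algebraMap (ZMod b) ((ZMod b)⸨X⸩)) HahnSeries.C) a,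
      HahnSeries.C_mul_eq_smul, HahnSeries.coeff_smul, HahnSeries.coeff_single]
    by_cases h : z = -(i : ℤ)
    · subst h
      simp
    · have h1 : ¬ z = i • (-1 : ℤ) := by simpa using h
      rw [if_neg h1, smul_zero]
      split_ifs with h2 h3
      · omega
      · rfl
      · rfl

theorem toLaurent_ne_zero {f : (ZMod b)[X]} (hf : f ≠ 0) : toLaurent b f ≠ 0 := by
  intro h
  have := coeff_toLaurent f (-(f.natDegree : ℤ))
  rw [h, if_pos (by simp), neg_neg, Int.toNat_natCast] at this
  exact hf (Polynomial.leadingCoeff_eq_zero.1 this.symm)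

theorem order_toLaurent {f : (ZMod b)[X]} (hf : f ≠ 0) :
    (toLaurent b f).order = -(f.natDegree : ℤ) := by
  refine le_antisymm (HahnSeries.order_le_of_coeff_ne_zero ?_) ?_
  · rw [coeff_toLaurent, if_pos (by simp), neg_neg, Int.toNat_natCast]
    exact fun h => hf (Polynomial.leadingCoeff_eq_zero.1 h)
  · have h := HahnSeries.coeff_order_eq_zero.not.2 (toLaurent_ne_zero hf)
    rw [coeff_toLaurent] at h
    split_ifs at h with h0
    · have := Polynomial.le_natDegree_of_ne_zero h
      omega
    · exact absurd rfl h

/-- The first `n` digits of the Laurent series of `a q / p`. -/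
def digitMap (p : (ZMod b)[X]) (m n : ℕ) (q : (ZMod b)[X]) : (Fin m → ZMod b) →+ (Fin n → ZMod b) where
  toFun a l := (toLaurent b (Polynomial.ofFn m a * q) / toLaurent b p).coeff ((l : ℤ) + 1)
  map_zero' := by
    ext l
    simp [toLaurent]
  map_add' a a' := by
    ext l
    simp [toLaurent, add_mul, add_div]

theorem digitMap_sub (p : (ZMod b)[X]) {m n : ℕ} (q q' : (ZMod b)[X]) (a : Fin m → ZMod b) :
    digitMap p m n (q - q') a = digitMap p m n q a - digitMap p m n q' a := by
  ext l
  simp [digitMap, toLaurent, mul_sub, sub_div]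

/-- Up to a polynomial part, `aq/p` equals `r/p` with `r = aq mod p`. Irreducibility and the degree
bounds give `r ≠ 0`, and the expansion of `r/p` starts at position `n - deg r`, which lies among the
first `n` digits. -/
theorem digitMap_ne_zero {p q : (ZMod b)[X]} {m n : ℕ} (hp : Irreducible p) (hpn : p.natDegree = n)
    (hmn : m ≤ n) (hq0 : q ≠ 0) (hq : q.degree < n) {a : Fin m → ZMod b} (ha : a ≠ 0) :
    digitMap p m n q a ≠ 0 := by
  intro h
  have hp0 := hp.ne_zero
  have hpd : p.degree = n := by rw [Polynomial.degree_eq_natDegree hp0, hpn]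
  have ha0 : Polynomial.ofFn m a ≠ 0 := fun h0 =>
    ha (Polynomial.injective_ofFn m (h0.trans (map_zero _).symm))
  set f := Polynomial.ofFn m a * q with hf
  have hdvd : ¬ p ∣ f := fun hd => by
    rcases hp.prime.dvd_or_dvd hd with hd | hd
    · refine ha0 (Polynomial.eq_zero_of_dvd_of_degree_lt hd ?_)
      rw [hpd]
      exact (Polynomial.ofFn_degree_lt a).trans_le (by exact_mod_cast hmn)
    · exact hq0 (Polynomial.eq_zero_of_dvd_of_degree_lt hd (by rwa [hpd]))
  set r := f % p with hr
  have hr0 : r ≠ 0 := fun h0 => hdvd ((EuclideanDomain.mod_eq_zero).1 h0)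
  have hrd : r.natDegree < n := by
    rw [← hpn]
    exact Polynomial.natDegree_mod_lt f (by
      rw [hpn]
      rintro rfl
      exact hp.not_isUnit (Polynomial.isUnit_iff_degree_eq_zero.2 hpd))
  have hTp := toLaurent_ne_zero hp0
  set G := toLaurent b r / toLaurent b p with hG
  have hG0 : G ≠ 0 := div_ne_zero (toLaurent_ne_zero hr0) hTp
  have hsum : toLaurent b f / toLaurent b p = toLaurent b (f / p) + G := by
    rw [hG, eq_comm, ← mul_right_inj' hTp, mul_add, mul_div_cancel₀ _ hTp, mul_div_cancel₀ _ hTp]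
    conv_rhs => rw [← EuclideanDomain.div_add_mod f p]
    simp [toLaurent, hr]
  have hord : G.order = (n : ℤ) - r.natDegree := by
    have h1 : (G * toLaurent b p).order = G.order + (toLaurent b p).order :=
      HahnSeries.order_mul hG0 hTp
    rw [hG, div_mul_cancel₀ _ hTp, ← hG, order_toLaurent hr0, order_toLaurent hp0, hpn] at h1
    omega
  have hcoeff := HahnSeries.coeff_order_eq_zero.not.2 hG0
  have h2 := congrFun h ⟨n - r.natDegree - 1, by omega⟩
  have h3 : (((n - r.natDegree - 1 : ℕ) : ℤ) + 1) = G.order := by omega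
  simp only [digitMap, AddMonoidHom.coe_mk, ZeroHom.coe_mk, Pi.zero_apply] at h2
  rw [← hf, h3, hsum, HahnSeries.coeff_add, coeff_toLaurent, if_neg (by omega), zero_add] at h2
  exact hcoeff h2

/-- Additivity in `q` turns the nonvanishing into injectivity, and both sides have `b^n` elements. A
random generator thus sends a fixed nonzero `a` to a uniformly distributed grid point. -/
theorem bijective_digitMap {p : (ZMod b)[X]} {m n : ℕ} (hp : Irreducible p) (hpn : p.natDegree = n)
    (hmn : m ≤ n) {a : Fin m → ZMod b} (ha : a ≠ 0) :
    Function.Bijective fun q : Fin n → ZMod b => digitMap p m n (Polynomial.ofFn n q) a := by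
  refine Function.Injective.bijective_of_finite fun q q' h => ?_
  by_contra hne
  refine digitMap_ne_zero hp hpn hmn (q := Polynomial.ofFn n (q - q')) ?_
    (Polynomial.ofFn_degree_lt _) ha ?_
  · exact fun h0 => hne (sub_eq_zero.1 (Polynomial.injective_ofFn n (h0.trans (map_zero _).symm)))
  · rw [map_sub, digitMap_sub]
    exact sub_eq_zero.2 h

/-- The digit vector of `h`. -/
def digitVec (b m h : ℕ) (r : Fin m) : ZMod b := ((h / b ^ (r : ℕ) % b : ℕ) : ZMod b)

theorem digitPoly_eq (m h : ℕ) : digitPoly b m h = Polynomial.ofFn m (digitVec b m h) := by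
  rw [digitPoly, Polynomial.ofFn_eq_sum_monomial, Finset.sum_range]
  exact Finset.sum_congr rfl fun r _ => Polynomial.C_mul_X_pow_eq_monomial

theorem eq_of_digits_eq {b : ℕ} (m : ℕ) {h h' : ℕ} (hh : h < b ^ m) (hh' : h' < b ^ m)
    (H : ∀ r < m, h / b ^ r % b = h' / b ^ r % b) : h = h' := by
  induction m generalizing h h' with
  | zero =>
    rw [pow_zero] at hh hh'
    omega
  | succ m ih =>
    have h0 := H 0 (by omega)
    rw [pow_zero, Nat.div_one, Nat.div_one] at h0
    have h1 : h / b = h' / b := by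
      refine ih (Nat.div_lt_of_lt_mul (by rwa [← pow_succ'])) (Nat.div_lt_of_lt_mul (by rwa [← pow_succ']))
        fun r hr => ?_
      have := H (r + 1) (by omega)
      rwa [pow_succ', ← Nat.div_div_eq_div_mul, ← Nat.div_div_eq_div_mul] at this
    rw [← Nat.div_add_mod h b, ← Nat.div_add_mod h' b, h0, h1]

theorem sum_digitVec {M : Type*} [AddCommMonoid M] (m : ℕ) (f : (Fin m → ZMod b) → M) :
    ∑ h ∈ Finset.range (b ^ m), f (digitVec b m h) = ∑ a, f a := by
  have hb : 0 < b := (Fact.out : b.Prime).pos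
  rw [Finset.sum_range]
  refine Function.Bijective.sum_comp (e := fun h : Fin (b ^ m) => digitVec b m h) ?_ f
  rw [Fintype.bijective_iff_injective_and_card]
  refine ⟨fun h h' hhh => Fin.ext (eq_of_digits_eq m h.2 h'.2 fun r hr => ?_), by simp⟩
  have := congrArg ZMod.val (congrFun hhh ⟨r, hr⟩)
  simpa [digitVec, ZMod.val_natCast] using this

theorem gridIndex_div_mod {n : ℕ} (v : Fin n → ZMod b) (i : Fin n) :
    gridIndex n v / b ^ (n - 1 - (i : ℕ)) % b = (v i).val := by
  have hb : 0 < b := (Fact.out : b.Prime).pos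
  induction n with
  | zero => exact i.elim0
  | succ n ih =>
    rw [gridIndex]
    induction i using Fin.lastCases with
    | last =>
      simp [Nat.mod_eq_of_lt (ZMod.val_lt _)]
    | cast i =>
      have := i.2
      rw [Fin.val_castSucc, (by omega : n + 1 - 1 - (i : ℕ) = n - 1 - i + 1), pow_succ',
        ← Nat.div_div_eq_div_mul, Nat.mul_add_div hb, Nat.div_eq_of_lt (ZMod.val_lt _), add_zero, ih]
      rfl

theorem digits_gridVal {n : ℕ} (v : Fin n → ZMod b) (i : ℕ) :
    (Real.digits (gridVal v) b i : ℕ) = if h : i < n then (v ⟨i, h⟩).val else 0 := by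
  have hb := base_pos (b := b)
  have e : (Real.digits (gridVal v) b i : ℕ) = ⌊gridVal v * (b : ℝ) ^ (i + 1)⌋₊ % b := rfl
  rw [e, gridVal_eq]
  split_ifs with h
  · have h1 : (gridIndex n v : ℝ) / (b : ℝ) ^ n * (b : ℝ) ^ (i + 1) =
        (gridIndex n v : ℝ) / ((b ^ (n - 1 - i) : ℕ) : ℝ) := by
      have h2 : (b : ℝ) ^ n = (b : ℝ) ^ (n - 1 - i) * (b : ℝ) ^ (i + 1) := by
        rw [← pow_add]
        congr 1
        omega
      rw [h2]
      push_cast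
      field_simp
    rw [h1, Nat.floor_div_natCast, Nat.floor_natCast]
    exact gridIndex_div_mod v ⟨i, h⟩
  · have h1 : (gridIndex n v : ℝ) / (b : ℝ) ^ n * (b : ℝ) ^ (i + 1) =
        ((gridIndex n v * b ^ (i - n) * b : ℕ) : ℝ) := by
      have h2 : (b : ℝ) ^ (i + 1) = (b : ℝ) ^ n * ((b : ℝ) ^ (i - n) * b) := by
        rw [← pow_succ, ← pow_add]
        congr 1
        omega
      rw [h2]
      push_cast
      field_simp
    rw [h1, Nat.floor_natCast, Nat.mul_mod_left]

/-- Both numbers have terminating expansions, so the digit-wise sum also stops after `n` digits and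
stays on the grid. -/
theorem digitalShift_gridVal {n : ℕ} (v δ : Fin n → ZMod b) :
    digitalShift b (gridVal v) (gridVal δ) = gridPt (v + δ) := by
  refine Subtype.ext ?_
  simp only [digitalShift, gridPt, Real.ofDigits]
  have hval : ∀ i, ((Real.digits (gridVal v) b i + Real.digits (gridVal δ) b i : Fin b) : ℕ) =
      if h : i < n then ((v + δ) ⟨i, h⟩).val else 0 := fun i => by
    rw [Fin.val_add, digits_gridVal, digits_gridVal]
    split_ifs with h
    · rw [Pi.add_apply, ZMod.val_add]
    · simp
  rw [tsum_eq_sum (s := Finset.range n) fun i hi => by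
    rw [Real.ofDigitsTerm, hval, dif_neg (by simpa using hi), Nat.cast_zero, zero_mul],
    Finset.sum_range]
  refine Finset.sum_congr rfl fun i _ => ?_
  rw [Real.ofDigitsTerm, hval, dif_pos i.2, div_eq_mul_inv]

theorem truncEval_eq (m n : ℕ) (p q : (ZMod b)[X]) (h : ℕ) :
    truncEval b n (toLaurent b (digitPoly b m h * q) / toLaurent b p) =
      gridVal (digitMap p m n q (digitVec b m h)) := by
  rw [truncEval, gridVal, ← Finset.Ico_succ_right_eq_Icc, Finset.sum_Ico_eq_sum_range,
    Finset.sum_range]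
  refine Finset.sum_congr rfl fun l _ => ?_
  rw [digitPoly_eq, add_comm 1]
  simp [digitMap]

/-- The rule with generating vector `q` and digital shift `δ`. -/
def digitRule {p : (ZMod b)[X]} {m n : ℕ} (hp : Irreducible p) (hpn : p.natDegree = n) (hm : 1 ≤ m)
    (hmn : m ≤ n) (q δ : ℕ → Fin n → ZMod b) : PolyLatticeRule b where
  m := m
  n := n
  one_le_m := hm
  m_le_n := hmn
  modulus := p
  irreducible_modulus := hp
  natDegree_modulus := hpn
  gen j := Polynomial.ofFn n (q j)
  shift j := gridVal (δ j)
  shift_mem _ := ⟨gridVal_nonneg _, gridVal_lt_one _⟩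

theorem digitRule_point {p : (ZMod b)[X]} {m n : ℕ} (hp : Irreducible p) (hpn : p.natDegree = n)
    (hm : 1 ≤ m) (hmn : m ≤ n) (q δ : ℕ → Fin n → ZMod b) (h j : ℕ) :
    (digitRule hp hpn hm hmn q δ).point h j =
      gridPt (digitMap p m n (Polynomial.ofFn n (q j)) (digitVec b m h) + δ j) := by
  rw [PolyLatticeRule.point]
  simp only [digitRule]
  rw [truncEval_eq, digitalShift_gridVal]

end PolyLattice

end

noncomputable section

/-! ### Component-by-component construction -/

section DualNet

variable {b : ℕ} [Fact b.Prime] {m n : ℕ}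

theorem stdAddChar_sum {ι : Type*} (s : Finset ι) (f : ι → ZMod b) :
    (ZMod.stdAddChar (∑ j ∈ s, f j) : ℂ) = ∏ j ∈ s, ZMod.stdAddChar (f j) := by
  classical
  induction s using Finset.induction_on with
  | empty => simp
  | insert i s hi ih => rw [Finset.sum_insert hi, Finset.prod_insert hi, AddChar.map_add_eq_mul, ih]

/-- Orthogonality of characters; the composed character is trivial only if `φ` is, since the
standard character is injective. -/
theorem sum_stdAddChar_comp {G : Type*} [AddCommGroup G] [Fintype G] (φ : G →+ ZMod b)
    [Decidable (∀ a, φ a = 0)] :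
    ∑ a, (ZMod.stdAddChar (φ a) : ℂ) = if ∀ a, φ a = 0 then (Fintype.card G : ℂ) else 0 := by
  classical
  have h := AddChar.sum_eq_ite ((ZMod.stdAddChar (N := b)).compAddMonoidHom φ)
  have hiff : (ZMod.stdAddChar (N := b)).compAddMonoidHom φ = 0 ↔ ∀ a, φ a = 0 := by
    refine ⟨fun h0 a => ?_, fun h0 => ?_⟩
    · have := DFunLike.congr_fun h0 a
      rw [AddChar.compAddMonoidHom_apply, AddChar.zero_apply] at this
      exact ZMod.injective_stdAddChar (this.trans (AddChar.map_zero_eq_one _).symm)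
    · ext a
      simp [AddChar.compAddMonoidHom_apply, h0 a]
  simp only [AddChar.compAddMonoidHom_apply, hiff] at h
  exact h

theorem sum_stdAddChar_dotProduct {k : Fin n → ZMod b} (hk : k ≠ 0) :
    ∑ v : Fin n → ZMod b, (ZMod.stdAddChar (k ⬝ᵥ v) : ℂ) = 0 := by
  classical
  have h := sum_stdAddChar_comp (G := Fin n → ZMod b) (b := b)
    { toFun := fun v => k ⬝ᵥ v, map_zero' := dotProduct_zero _, map_add' := dotProduct_add _ }
  refine h.trans (if_neg fun h0 => hk (funext fun l => ?_))
  simpa using h0 (Pi.single l 1)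

open Classical in
/-- The indicator of the dual net, on the frequencies supported in `w`. -/
def dualInd (A : ℕ → (Fin m → ZMod b) →+ (Fin n → ZMod b)) {w : Finset ℕ}
    (κ : w → Fin n → ZMod b) : ℝ :=
  if ∀ a, ∑ j, κ j ⬝ᵥ A j a = 0 then 1 else 0

/-- The sum of `∏ ρ(κ_j)` over the dual net, restricted to frequencies with support `w`. -/
def dualSum (A : ℕ → (Fin m → ZMod b) →+ (Fin n → ZMod b)) (ρ : (Fin n → ZMod b) → ℝ)
    (w : Finset ℕ) : ℝ :=
  ∑ κ ∈ Fintype.piFinset fun _ : w => Finset.univ.erase 0, dualInd A κ * ∏ j, ρ (κ j)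

theorem dualInd_nonneg (A : ℕ → (Fin m → ZMod b) →+ (Fin n → ZMod b)) {w : Finset ℕ}
    (κ : w → Fin n → ZMod b) : 0 ≤ dualInd A κ := by
  rw [dualInd]
  split_ifs <;> norm_num

theorem dualSum_nonneg (A : ℕ → (Fin m → ZMod b) →+ (Fin n → ZMod b))
    {ρ : (Fin n → ZMod b) → ℝ} (hρ : ∀ k, 0 ≤ ρ k) (w : Finset ℕ) : 0 ≤ dualSum A ρ w :=
  Finset.sum_nonneg fun κ _ => mul_nonneg (dualInd_nonneg A κ) (Finset.prod_nonneg fun _ _ => hρ _)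

theorem dualSum_congr {A A' : ℕ → (Fin m → ZMod b) →+ (Fin n → ZMod b)}
    (ρ : (Fin n → ZMod b) → ℝ) {w : Finset ℕ} (h : ∀ j ∈ w, A j = A' j) :
    dualSum A ρ w = dualSum A' ρ w := by
  have e : ∀ κ : w → Fin n → ZMod b, dualInd A κ = dualInd A' κ := fun κ => by
    simp only [dualInd]
    congr 1
    refine propext (forall_congr' fun a => ?_)
    rw [Finset.sum_congr rfl fun j _ => by rw [h j j.2]]
  simp only [dualSum, e]

theorem mean_prod_stdAddChar (A : ℕ → (Fin m → ZMod b) →+ (Fin n → ZMod b)) {w : Finset ℕ}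
    (κ : w → Fin n → ZMod b) :
    ((b : ℂ) ^ m)⁻¹ * ∑ a, ∏ j, (ZMod.stdAddChar (κ j ⬝ᵥ A j a) : ℂ) = dualInd A κ := by
  classical
  have hb : (b : ℂ) ≠ 0 := by exact_mod_cast (Fact.out : b.Prime).ne_zero
  have h := sum_stdAddChar_comp (G := Fin m → ZMod b) (b := b)
    { toFun := fun a => ∑ j, κ j ⬝ᵥ A j a
      map_zero' := by simp
      map_add' := fun a a' => by simp [dotProduct_add, Finset.sum_add_distrib] }
  have h' : ∑ a, ∏ j, (ZMod.stdAddChar (κ j ⬝ᵥ A j a) : ℂ) =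
      if ∀ a, ∑ j, κ j ⬝ᵥ A j a = 0 then (Fintype.card (Fin m → ZMod b) : ℂ) else 0 :=
    (Finset.sum_congr rfl fun a _ =>
      (stdAddChar_sum Finset.univ fun j => κ j ⬝ᵥ A j a).symm).trans h
  rw [h', dualInd]
  split_ifs with h1
  · simp [hb]
  · simp

/-- Multiplying out the Walsh expansions gives characters of `a`, and averaging over `a` retains
only frequencies of the dual net. -/
theorem norm_mean_prod_le (A : ℕ → (Fin m → ZMod b) →+ (Fin n → ZMod b)) (w : Finset ℕ)
    {g : ℕ → (Fin n → ZMod b) → ℂ} {c : ℕ → (Fin n → ZMod b) → ℂ} {ρ : (Fin n → ZMod b) → ℝ} {C : ℝ}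
    (hg : ∀ j v, g j v = ∑ k ∈ Finset.univ.erase 0, c j k * ZMod.stdAddChar (k ⬝ᵥ v))
    (hc : ∀ j k, ‖c j k‖ ≤ C * ρ k) :
    ‖((b : ℂ) ^ m)⁻¹ * ∑ a, ∏ j ∈ w, g j (A j a)‖ ≤ C ^ w.card * dualSum A ρ w := by
  have e : ((b : ℂ) ^ m)⁻¹ * ∑ a, ∏ j ∈ w, g j (A j a) =
      ∑ κ ∈ Fintype.piFinset fun _ : w => Finset.univ.erase 0, (dualInd A κ : ℂ) * ∏ j : w, c j (κ j) := by
    have h1 : ∀ a, ∏ j ∈ w, g j (A j a) = ∑ κ ∈ Fintype.piFinset fun _ : w => Finset.univ.erase 0,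
        ∏ j : w, (c j (κ j) * ZMod.stdAddChar (κ j ⬝ᵥ A j a)) := fun a => by
      rw [← Finset.prod_coe_sort, Finset.prod_congr rfl fun (j : w) _ => hg j (A j a),
        Finset.prod_univ_sum]
    simp only [h1]
    rw [Finset.sum_comm, Finset.mul_sum]
    refine Finset.sum_congr rfl fun κ _ => ?_
    rw [← mean_prod_stdAddChar]
    simp only [Finset.prod_mul_distrib, ← Finset.mul_sum]
    ring
  rw [e, dualSum, Finset.mul_sum]
  refine (norm_sum_le _ _).trans (Finset.sum_le_sum fun κ _ => ?_)
  rw [norm_mul, Complex.norm_real, Real.norm_of_nonneg (dualInd_nonneg A κ), norm_prod,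
    mul_left_comm]
  refine mul_le_mul_of_nonneg_left ?_ (dualInd_nonneg A κ)
  refine (Finset.prod_le_prod (fun j _ => norm_nonneg _) fun (j : w) _ => hc j (κ j)).trans_eq ?_
  rw [Finset.prod_mul_distrib, Finset.prod_const, Finset.card_univ, Fintype.card_coe]

theorem dualSum_rpow_le (A : ℕ → (Fin m → ZMod b) →+ (Fin n → ZMod b))
    {ρ : (Fin n → ZMod b) → ℝ} (hρ : ∀ k, 0 ≤ ρ k) (w : Finset ℕ) {e : ℝ} (he : 0 < e)
    (he1 : e ≤ 1) : dualSum A ρ w ^ e ≤ dualSum A (fun k => ρ k ^ e) w := by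
  have h := rpow_sum_le_sum_rpow (Fintype.piFinset fun _ : w => Finset.univ.erase 0)
    (f := fun κ : w → Fin n → ZMod b => dualInd A κ * ∏ j, ρ (κ j))
    (fun κ _ => mul_nonneg (dualInd_nonneg A κ) (Finset.prod_nonneg fun j _ => hρ _)) he he1
  refine h.trans_eq (Finset.sum_congr rfl fun κ _ => ?_)
  rw [Real.mul_rpow (dualInd_nonneg A κ) (Finset.prod_nonneg fun j _ => hρ _),
    ← Real.finsetProd_rpow _ _ fun j _ => hρ _]
  congr 1
  rw [dualInd]
  split_ifs
  · exact Real.one_rpow _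
  · exact Real.zero_rpow he.ne'

/-- The mean of the dual sum over the generator of one of the coordinates. -/
theorem mean_dualSum_update {B : (Fin n → ZMod b) → (Fin m → ZMod b) →+ (Fin n → ZMod b)}
    (hB : ∀ a, a ≠ 0 → Function.Bijective fun q => B q a) (q : ℕ → Fin n → ZMod b)
    (ρ : (Fin n → ZMod b) → ℝ) {i : ℕ} {w : Finset ℕ} (hi : i ∉ w) :
    ((b : ℝ) ^ n)⁻¹ * ∑ x, dualSum (fun j => B (Function.update q i x j)) ρ (insert i w) =
      ((b : ℝ) ^ m)⁻¹ * (∑ k ∈ Finset.univ.erase 0, ρ k) ^ (w.card + 1) := by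
  classical
  have hb : (b : ℂ) ≠ 0 := by exact_mod_cast (Fact.out : b.Prime).ne_zero
  have hbr : (b : ℝ) ≠ 0 := by exact_mod_cast (Fact.out : b.Prime).ne_zero
  set i' : ↥(insert i w) := ⟨i, Finset.mem_insert_self i w⟩ with hi'
  -- A frequency with nonzero component at `i` lies in the dual net for exactly the fraction
  -- `b^{-m}` of the generators: for `a ≠ 0` the point `B x a` is uniform and its character averages
  -- to zero, so only `a = 0` contributes.
  have key : ∀ κ ∈ Fintype.piFinset fun _ : ↥(insert i w) => Finset.univ.erase (0 : Fin n → ZMod b),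
      ((b : ℝ) ^ n)⁻¹ * ∑ x, dualInd (fun j => B (Function.update q i x j)) κ = ((b : ℝ) ^ m)⁻¹ := by
    intro κ hκ
    have hκi : κ i' ≠ 0 := Finset.ne_of_mem_erase (Fintype.mem_piFinset.1 hκ i')
    have hC : ((b : ℂ) ^ n)⁻¹ * ∑ x, ((dualInd (fun j => B (Function.update q i x j)) κ : ℝ) : ℂ) =
        ((b : ℂ) ^ m)⁻¹ := by
      simp only [← mean_prod_stdAddChar]
      have h1 : ∀ x a, ∏ j : ↥(insert i w),
          (ZMod.stdAddChar (κ j ⬝ᵥ B (Function.update q i x j) a) : ℂ) =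
          ZMod.stdAddChar (κ i' ⬝ᵥ B x a) *
            ∏ j ∈ Finset.univ.erase i', ZMod.stdAddChar (κ j ⬝ᵥ B (q j) a) := fun x a => by
        rw [← Finset.mul_prod_erase _ _ (Finset.mem_univ i')]
        congr 1
        · simp [hi']
        · refine Finset.prod_congr rfl fun j hj => ?_
          rw [Function.update_of_ne]
          intro hji
          exact Finset.ne_of_mem_erase hj (Subtype.ext hji)
      simp only [h1]
      rw [← Finset.mul_sum, Finset.sum_comm]
      have h2 : ∀ a, ∑ x, (ZMod.stdAddChar (κ i' ⬝ᵥ B x a) : ℂ) *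
          ∏ j ∈ Finset.univ.erase i', ZMod.stdAddChar (κ j ⬝ᵥ B (q j) a) =
          if a = 0 then (b : ℂ) ^ n else 0 := fun a => by
        split_ifs with ha
        · subst ha
          simp
        · rw [← Finset.sum_mul, Function.Bijective.sum_comp (hB a ha)
            fun v => (ZMod.stdAddChar (κ i' ⬝ᵥ v) : ℂ), sum_stdAddChar_dotProduct hκi, zero_mul]
      simp only [h2, Finset.sum_ite_eq', Finset.mem_univ, if_true]
      field_simp
    apply Complex.ofReal_injective
    push_cast
    exact hC
  simp only [dualSum]
  rw [Finset.sum_comm, Finset.mul_sum]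
  have h3 : ∀ κ ∈ Fintype.piFinset fun _ : ↥(insert i w) => Finset.univ.erase (0 : Fin n → ZMod b),
      ((b : ℝ) ^ n)⁻¹ * ∑ x, dualInd (fun j => B (Function.update q i x j)) κ * ∏ j, ρ (κ j) =
        ((b : ℝ) ^ m)⁻¹ * ∏ j, ρ (κ j) := fun κ hκ => by
    rw [← Finset.sum_mul, ← mul_assoc, key κ hκ]
  rw [Finset.sum_congr rfl h3, ← Finset.mul_sum,
    ← Finset.prod_univ_sum (fun _ : ↥(insert i w) => Finset.univ.erase (0 : Fin n → ZMod b))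
      fun _ k => ρ k, Finset.prod_const, Finset.card_univ, Fintype.card_coe,
    Finset.card_insert_of_notMem hi]

/-- The `e`-th powers are averaged over the generator, and some generator is no worse than the mean.
Subadditivity of powers at most `1` is used twice, for the sum over `w` and inside the dual sum.
Undoing the power turns the mean `b^{-m}` into the rate `b^{-m/e}`. -/
theorem exists_dualSum_update_le {B : (Fin n → ZMod b) → (Fin m → ZMod b) →+ (Fin n → ZMod b)}
    (hB : ∀ a, a ≠ 0 → Function.Bijective fun q => B q a) (q : ℕ → Fin n → ZMod b)
    {ρ : (Fin n → ZMod b) → ℝ} (hρ : ∀ k, 0 ≤ ρ k) {β : Finset ℕ → ℝ} (hβ : ∀ w, 0 ≤ β w)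
    {e pp : ℝ} (he : 0 < e) (he1 : e ≤ 1) (hpp : 0 < pp) (hepp : pp * e ≤ 1) (i : ℕ) :
    ∃ x, ∑ w ∈ (Finset.range i).powerset,
        β w * dualSum (fun j => B (Function.update q i x j)) ρ (insert i w) ^ pp ≤
      (((b : ℝ) ^ m)⁻¹ * ∑ w ∈ (Finset.range i).powerset,
        β w ^ e * (∑ k ∈ Finset.univ.erase 0, ρ k ^ (pp * e)) ^ (w.card + 1)) ^ e⁻¹ := by
  classical
  have hb := base_pos (b := b)
  set Y := fun (x : Fin n → ZMod b) (w : Finset ℕ) =>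
    dualSum (fun j => B (Function.update q i x j)) ρ (insert i w) with hY
  have hY0 : ∀ x w, 0 ≤ Y x w := fun x w => dualSum_nonneg _ hρ _
  set F := fun x => ∑ w ∈ (Finset.range i).powerset, β w * Y x w ^ pp with hF
  set M := ((b : ℝ) ^ m)⁻¹ * ∑ w ∈ (Finset.range i).powerset,
        β w ^ e * (∑ k ∈ Finset.univ.erase 0, ρ k ^ (pp * e)) ^ (w.card + 1) with hM
  have hterm : ∀ x w, 0 ≤ β w * Y x w ^ pp := fun x w =>
    mul_nonneg (hβ w) (Real.rpow_nonneg (hY0 x w) _)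
  have hF0 : ∀ x, 0 ≤ F x := fun x => Finset.sum_nonneg fun w _ => hterm x w
  have h1 : ∀ x, F x ^ e ≤ ∑ w ∈ (Finset.range i).powerset, β w ^ e *
      dualSum (fun j => B (Function.update q i x j)) (fun k => ρ k ^ (pp * e)) (insert i w) := by
    intro x
    refine (rpow_sum_le_sum_rpow _ (fun w _ => hterm x w) he he1).trans
      (Finset.sum_le_sum fun w _ => ?_)
    rw [Real.mul_rpow (hβ w) (Real.rpow_nonneg (hY0 x w) _), ← Real.rpow_mul (hY0 x w)]
    exact mul_le_mul_of_nonneg_left (dualSum_rpow_le _ hρ _ (by positivity) hepp)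
      (Real.rpow_nonneg (hβ w) _)
  have h2 : ∑ x, F x ^ e ≤ ∑ _x : Fin n → ZMod b, M := by
    refine (Finset.sum_le_sum fun x _ => h1 x).trans_eq ?_
    rw [Finset.sum_comm, Finset.sum_const, Finset.card_univ, nsmul_eq_mul, hM, Finset.mul_sum,
      Finset.mul_sum]
    refine Finset.sum_congr rfl fun w hw => ?_
    have hi : i ∉ w := fun h => by
      have := Finset.mem_powerset.1 hw h
      simp at this
    have h3 := mean_dualSum_update hB q (fun k => ρ k ^ (pp * e)) hi
    rw [inv_mul_eq_iff_eq_mul₀ (by positivity)] at h3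
    rw [← Finset.mul_sum, h3, Fintype.card_fun, ZMod.card, Fintype.card_fin]
    push_cast
    ring
  obtain ⟨x, -, hx⟩ := Finset.exists_le_of_sum_le Finset.univ_nonempty h2
  refine ⟨x, ?_⟩
  have := Real.rpow_le_rpow (Real.rpow_nonneg (hF0 x) _) hx (inv_pos.2 he).le
  rwa [Real.rpow_rpow_inv (hF0 x) he.ne'] at this

/-- The component-by-component construction of a generating vector. -/
theorem exists_dualSum_le {B : (Fin n → ZMod b) → (Fin m → ZMod b) →+ (Fin n → ZMod b)}
    (hB : ∀ a, a ≠ 0 → Function.Bijective fun q => B q a)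
    {ρ : (Fin n → ZMod b) → ℝ} (hρ : ∀ k, 0 ≤ ρ k) {β : Finset ℕ → ℝ} (hβ : ∀ w, 0 ≤ β w)
    {e pp : ℝ} (he : 0 < e) (he1 : e ≤ 1) (hpp : 0 < pp) (hepp : pp * e ≤ 1) (L : ℕ) :
    ∃ q : ℕ → Fin n → ZMod b, ∀ i < L, ∑ w ∈ (Finset.range i).powerset,
        β w * dualSum (fun j => B (q j)) ρ (insert i w) ^ pp ≤
      (((b : ℝ) ^ m)⁻¹ * ∑ w ∈ (Finset.range i).powerset,
        β w ^ e * (∑ k ∈ Finset.univ.erase 0, ρ k ^ (pp * e)) ^ (w.card + 1)) ^ e⁻¹ := by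
  induction L with
  | zero => exact ⟨0, fun i hi => absurd hi (by omega)⟩
  | succ L ih =>
    obtain ⟨q, hq⟩ := ih
    obtain ⟨x, hx⟩ := exists_dualSum_update_le hB q hρ hβ he he1 hpp hepp L
    refine ⟨Function.update q L x, fun i hi => ?_⟩
    rcases Nat.lt_succ_iff_lt_or_eq.1 hi with hi | rfl
    · refine le_trans (le_of_eq ?_) (hq i hi)
      refine Finset.sum_congr rfl fun w hw => ?_
      -- The bounds already obtained involve only generators with index below `L`, which the new
      -- choice does not touch.
      rw [dualSum_congr (A' := fun j => B (q j))]
      intro j hj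
      have : j < L := by
        rcases Finset.mem_insert.1 hj with rfl | hj
        · exact hi
        · have := Finset.mem_range.1 (Finset.mem_powerset.1 hw hj)
          omega
      simp only [Function.update_of_ne this.ne]
    · exact hx

end DualNet

end

noncomputable section

/-! ### The error of digital nets for products -/

section NetError

variable {b : ℕ} [Fact b.Prime] {m n : ℕ}

/-- The mean over the digit vectors. -/
def gridMean (g : (Fin n → ZMod b) → ℝ) : ℝ := ((b : ℝ) ^ n)⁻¹ * ∑ v, g v

def gridCenter (g : (Fin n → ZMod b) → ℝ) (v : Fin n → ZMod b) : ℝ := g v - gridMean g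

theorem walshCoeff_zero (g : (Fin n → ZMod b) → ℝ) : walshCoeff g 0 = gridMean g := by
  simp [walshCoeff, gridMean]

theorem sum_stdAddChar_dotProduct_left (v : Fin n → ZMod b) :
    ∑ k : Fin n → ZMod b, (ZMod.stdAddChar (k ⬝ᵥ v) : ℂ) = if v = 0 then (b : ℂ) ^ n else 0 := by
  split_ifs with h
  · simp [h]
  · simp only [dotProduct_comm _ v]
    exact sum_stdAddChar_dotProduct h

theorem gridCenter_eq_sum (g : (Fin n → ZMod b) → ℝ) (v : Fin n → ZMod b) :
    (gridCenter g v : ℂ) =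
      ∑ k ∈ Finset.univ.erase 0, walshCoeff g k * ZMod.stdAddChar (k ⬝ᵥ v) := by
  have hb : (b : ℂ) ≠ 0 := by exact_mod_cast (Fact.out : b.Prime).ne_zero
  have h : ∑ k, walshCoeff g k * ZMod.stdAddChar (k ⬝ᵥ v) = g v := by
    simp only [walshCoeff, mul_assoc, Finset.sum_mul, ← Finset.mul_sum]
    rw [Finset.sum_comm]
    have h1 : ∀ x, ∑ k, (ZMod.stdAddChar (-(k ⬝ᵥ x)) : ℂ) * ((g x : ℂ) * ZMod.stdAddChar (k ⬝ᵥ v)) =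
        if v = x then (g x : ℂ) * (b : ℂ) ^ n else 0 := fun x => by
      have h2 := sum_stdAddChar_dotProduct_left (v - x)
      simp only [sub_eq_zero] at h2
      rw [← mul_ite_zero, ← h2, Finset.mul_sum]
      refine Finset.sum_congr rfl fun k _ => ?_
      rw [dotProduct_sub, sub_eq_add_neg, AddChar.map_add_eq_mul]
      ring
    simp only [h1, Finset.sum_ite_eq, Finset.mem_univ, if_true]
    field_simp
  rw [gridCenter, Complex.ofReal_sub, ← h, ← walshCoeff_zero,
    ← Finset.add_sum_erase _ _ (Finset.mem_univ (0 : Fin n → ZMod b))]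
  simp

theorem walshCoeff_gridCenter (g : (Fin n → ZMod b) → ℝ) {k : Fin n → ZMod b} (hk : k ≠ 0) :
    walshCoeff (gridCenter g) k = walshCoeff g k := by
  have h : ∑ v : Fin n → ZMod b, (ZMod.stdAddChar (-(k ⬝ᵥ v)) : ℂ) = 0 := by
    simp only [← neg_dotProduct]
    exact sum_stdAddChar_dotProduct (neg_ne_zero.2 hk)
  simp only [walshCoeff, gridCenter, Complex.ofReal_sub, mul_sub, Finset.sum_sub_distrib,
    ← Finset.sum_mul, h, zero_mul, sub_zero]

/-- The Wiener–Khinchin identity on the digit group: expanding one factor leaves the conjugate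
coefficient of the other. -/
theorem autocorrelation_eq_sum (g : (Fin n → ZMod b) → ℝ) (v : Fin n → ZMod b) :
    ((gridMean fun x => gridCenter g (v + x) * gridCenter g x : ℝ) : ℂ) =
      ∑ k ∈ Finset.univ.erase 0, ((‖walshCoeff g k‖ ^ 2 : ℝ) : ℂ) * ZMod.stdAddChar (k ⬝ᵥ v) := by
  have h : ∀ k ∈ Finset.univ.erase (0 : Fin n → ZMod b),
      ((b : ℂ) ^ n)⁻¹ * ∑ x, ZMod.stdAddChar (k ⬝ᵥ x) * (gridCenter g x : ℂ) =
        starRingEnd ℂ (walshCoeff g k) := fun k hk => by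
    rw [← walshCoeff_gridCenter g (Finset.ne_of_mem_erase hk), walshCoeff, map_mul, map_inv₀,
      map_pow, map_sum, Complex.conj_natCast]
    simp only [map_mul, Complex.conj_ofReal, AddChar.map_neg_eq_conj, Complex.conj_conj]
  rw [gridMean]
  push_cast
  simp only [gridCenter_eq_sum g (v + _), Finset.sum_mul, dotProduct_add, AddChar.map_add_eq_mul]
  rw [Finset.sum_comm, Finset.mul_sum]
  refine Finset.sum_congr rfl fun k hk => ?_
  rw [← Complex.ofReal_pow, ← Complex.normSq_eq_norm_sq, ← Complex.mul_conj, ← h k hk]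
  simp only [Finset.mul_sum]
  rw [Finset.sum_mul]
  refine Finset.sum_congr rfl fun x _ => ?_
  ring

/-- The error of the digitally shifted net for a product function. -/
def netErr (A : ℕ → (Fin m → ZMod b) →+ (Fin n → ZMod b)) (δ : ℕ → Fin n → ZMod b)
    (g : ℕ → (Fin n → ZMod b) → ℝ) (J : ℕ → ℝ) (u : Finset ℕ) : ℝ :=
  gridMean (fun a => ∏ j ∈ u, g j (A j a + δ j)) - ∏ j ∈ u, J j

def netTerm (A : ℕ → (Fin m → ZMod b) →+ (Fin n → ZMod b)) (δ : ℕ → Fin n → ZMod b)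
    (g : ℕ → (Fin n → ZMod b) → ℝ) (w : Finset ℕ) : ℝ :=
  gridMean fun a => ∏ j ∈ w, gridCenter (g j) (A j a + δ j)

theorem netTerm_empty (A : ℕ → (Fin m → ZMod b) →+ (Fin n → ZMod b)) (δ : ℕ → Fin n → ZMod b)
    (g : ℕ → (Fin n → ZMod b) → ℝ) : netTerm A δ g ∅ = 1 := by
  have hb := base_pos (b := b)
  simp [netTerm, gridMean, hb.ne']

/-- Each factor is its grid mean plus a centred part, and the product is multiplied out. The term `w
= ∅` alone meets the exact integrals and carries the discretisation error. -/
theorem netErr_eq_sum (A : ℕ → (Fin m → ZMod b) →+ (Fin n → ZMod b)) (δ : ℕ → Fin n → ZMod b)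
    (g : ℕ → (Fin n → ZMod b) → ℝ) (J : ℕ → ℝ) (u : Finset ℕ) :
    netErr A δ g J u = ∑ w ∈ u.powerset, if w = ∅ then ∏ j ∈ u, gridMean (g j) - ∏ j ∈ u, J j
      else netTerm A δ g w * ∏ j ∈ u \ w, gridMean (g j) := by
  have h : gridMean (fun a => ∏ j ∈ u, g j (A j a + δ j)) =
      ∑ w ∈ u.powerset, netTerm A δ g w * ∏ j ∈ u \ w, gridMean (g j) := by
    have h1 : ∀ a, ∏ j ∈ u, g j (A j a + δ j) = ∑ w ∈ u.powerset,
        (∏ j ∈ w, gridCenter (g j) (A j a + δ j)) * ∏ j ∈ u \ w, gridMean (g j) := fun a => by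
      rw [← Finset.prod_add]
      exact Finset.prod_congr rfl fun j _ => by rw [gridCenter, sub_add_cancel]
    simp only [h1, netTerm, gridMean]
    rw [Finset.sum_comm, Finset.mul_sum]
    refine Finset.sum_congr rfl fun w _ => ?_
    rw [← Finset.sum_mul, mul_assoc]
  rw [netErr, h, ← Finset.add_sum_erase _ _ (Finset.empty_mem_powerset u),
    ← Finset.add_sum_erase u.powerset _ (Finset.empty_mem_powerset u), if_pos rfl,
    netTerm_empty, one_mul, Finset.sdiff_empty, add_sub_right_comm]
  congr 1
  exact Finset.sum_congr rfl fun w hw => (if_neg (Finset.ne_of_mem_erase hw)).symm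

theorem abs_prod_sub_prod_le {T J : ℕ → ℝ} {C ε : ℝ} (hC : 1 ≤ C) (hT : ∀ j, |T j| ≤ C)
    (hJ : ∀ j, |J j| ≤ C) (hTJ : ∀ j, |T j - J j| ≤ ε) (u : Finset ℕ) :
    |∏ j ∈ u, T j - ∏ j ∈ u, J j| ≤ (2 * C) ^ u.card * ε := by
  have hε : 0 ≤ ε := (abs_nonneg _).trans (hTJ 0)
  induction u using Finset.induction_on with
  | empty => simpa using hε
  | insert i u hi ih =>
    rw [Finset.prod_insert hi, Finset.prod_insert hi, Finset.card_insert_of_notMem hi]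
    have e : T i * ∏ j ∈ u, T j - J i * ∏ j ∈ u, J j =
        T i * (∏ j ∈ u, T j - ∏ j ∈ u, J j) + (T i - J i) * ∏ j ∈ u, J j := by ring
    have h1 : |∏ j ∈ u, J j| ≤ C ^ u.card := by
      rw [Finset.abs_prod]
      exact (Finset.prod_le_prod (fun _ _ => abs_nonneg _) fun j _ => hJ j).trans_eq (Finset.prod_const _)
    rw [e]
    refine (abs_add_le _ _).trans ?_
    rw [abs_mul, abs_mul]
    have h2 := mul_le_mul (hT i) ih (abs_nonneg _) (by linarith)
    have h3 := mul_le_mul (hTJ i) h1 (abs_nonneg _) hε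
    have h4 : C ^ u.card ≤ (2 * C) ^ u.card :=
      pow_le_pow_left₀ (by linarith) (by linarith) _
    have h5 : C ^ u.card * ε ≤ C * ((2 * C) ^ u.card * ε) := by
      have : 0 ≤ (2 * C) ^ u.card * ε := by positivity
      nlinarith
    calc _ ≤ C * ((2 * C) ^ u.card * ε) + ε * C ^ u.card := add_le_add h2 h3
      _ ≤ C * ((2 * C) ^ u.card * ε) + C * ((2 * C) ^ u.card * ε) := by linarith
      _ = (2 * C) ^ (u.card + 1) * ε := by ring

/-- Cauchy–Schwarz over the `2^{|u|}` terms of the expansion; such exponential factors are harmless,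
as they can be absorbed into the weights. -/
theorem netErr_sq_le (A : ℕ → (Fin m → ZMod b) →+ (Fin n → ZMod b)) (δ : ℕ → Fin n → ZMod b)
    {g : ℕ → (Fin n → ZMod b) → ℝ} {J : ℕ → ℝ} {C ε : ℝ} (hC : 1 ≤ C)
    (hg : ∀ j, |gridMean (g j)| ≤ C) (hJ : ∀ j, |J j| ≤ C) (hgJ : ∀ j, |gridMean (g j) - J j| ≤ ε)
    (u : Finset ℕ) :
    netErr A δ g J u ^ 2 ≤ 2 ^ u.card * (((2 * C) ^ u.card * ε) ^ 2 +
      ∑ w ∈ u.powerset.erase ∅, (C ^ (u \ w).card) ^ 2 * netTerm A δ g w ^ 2) := by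
  rw [netErr_eq_sum]
  refine sq_sum_le_card_mul_sum_sq.trans ?_
  rw [Finset.card_powerset, Nat.cast_pow, Nat.cast_ofNat]
  refine mul_le_mul_of_nonneg_left ?_ (by positivity)
  rw [← Finset.add_sum_erase _ _ (Finset.empty_mem_powerset u), if_pos rfl]
  refine add_le_add ?_ (Finset.sum_le_sum fun w hw => ?_)
  · rw [← sq_abs]
    exact pow_le_pow_left₀ (abs_nonneg _) (abs_prod_sub_prod_le hC hg hJ hgJ u) 2
  · rw [if_neg (Finset.ne_of_mem_erase hw), mul_pow, mul_comm]
    refine mul_le_mul_of_nonneg_right ?_ (sq_nonneg _)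
    rw [← sq_abs]
    refine pow_le_pow_left₀ (abs_nonneg _) ?_ 2
    rw [Finset.abs_prod]
    exact (Finset.prod_le_prod (fun _ _ => abs_nonneg _) fun j _ => hg j).trans_eq (Finset.prod_const _)

theorem abs_netTerm_zero_le (A : ℕ → (Fin m → ZMod b) →+ (Fin n → ZMod b))
    {g : ℕ → (Fin n → ZMod b) → ℝ} {C : ℝ} {r : (Fin n → ZMod b) → ℝ}
    (hg : ∀ j k, ‖walshCoeff (g j) k‖ ≤ C * r k) (w : Finset ℕ) :
    |netTerm A 0 g w| ≤ C ^ w.card * dualSum A r w := by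
  have h := norm_mean_prod_le A w (g := fun j v => (gridCenter (g j) v : ℂ))
    (fun j v => gridCenter_eq_sum (g j) v) hg
  refine le_trans (le_of_eq ?_) h
  rw [← Real.norm_eq_abs, ← Complex.norm_real, netTerm, gridMean]
  push_cast
  simp

/-- The extension of a finite list of shifts by `0`. -/
def extendShift {L : ℕ} (δ : Fin L → Fin n → ZMod b) (j : ℕ) : Fin n → ZMod b :=
  if h : j < L then δ ⟨j, h⟩ else 0

theorem mean_prod_extendShift {L : ℕ} {w : Finset ℕ} (hw : w ⊆ Finset.range L)
    (f : ℕ → (Fin n → ZMod b) → ℝ) :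
    (((b : ℝ) ^ n) ^ L)⁻¹ * ∑ δ : Fin L → Fin n → ZMod b, ∏ j ∈ w, f j (extendShift δ j) =
      ∏ j ∈ w, gridMean (f j) := by
  classical
  have hb := base_pos (b := b)
  have h1 : ∀ F : ℕ → ℝ, ∏ j ∈ w, F j = ∏ i : Fin L, if (i : ℕ) ∈ w then F i else 1 := fun F => by
    rw [← Finset.prod_range fun i => if i ∈ w then F i else 1, Finset.prod_ite_mem,
      Finset.inter_eq_right.2 hw]
  have h2 : ∀ δ : Fin L → Fin n → ZMod b, ∏ j ∈ w, f j (extendShift δ j) =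
      ∏ i : Fin L, if (i : ℕ) ∈ w then f i (δ i) else 1 := fun δ => by
    rw [h1]
    simp [extendShift]
  have h3 := Finset.prod_univ_sum (fun _ : Fin L => (Finset.univ : Finset (Fin n → ZMod b)))
    fun i v => if (i : ℕ) ∈ w then f i v else 1
  rw [Fintype.piFinset_univ] at h3
  rw [Finset.sum_congr rfl fun δ _ => h2 δ, ← h3, h1]
  have h4 : (((b : ℝ) ^ n) ^ L)⁻¹ = ∏ _i : Fin L, ((b : ℝ) ^ n)⁻¹ := by
    rw [Finset.prod_const, Finset.card_univ, Fintype.card_fin, inv_pow]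
  rw [h4, ← Finset.prod_mul_distrib]
  refine Finset.prod_congr rfl fun i _ => ?_
  split_ifs with h
  · rfl
  · simp [hb.ne']

theorem mean_mean_sub (f : (Fin m → ZMod b) → ℝ) :
    gridMean (fun a => gridMean fun a' => f (a - a')) = gridMean f := by
  have hb := base_pos (b := b)
  have h : ∀ a, ∑ a', f (a - a') = ∑ a', f a' := fun a =>
    (Equiv.subLeft a).sum_comp f
  simp only [gridMean, h]
  simp [hb.ne']

/-- A random shift suppresses all mixed products of Walsh coefficients. The square is a double mean
over `a` and `a'`; independent shifts turn each factor into an autocorrelation at `A_j (a - a')`, so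
only squared moduli on the dual net are left. Hence the shifted rules involve `r²` in place of the
square of a dual sum of `r`. -/
theorem mean_netTerm_sq_le (A : ℕ → (Fin m → ZMod b) →+ (Fin n → ZMod b))
    {g : ℕ → (Fin n → ZMod b) → ℝ} {C : ℝ} {r : (Fin n → ZMod b) → ℝ}
    (hg : ∀ j k, ‖walshCoeff (g j) k‖ ≤ C * r k) {L : ℕ} {w : Finset ℕ} (hw : w ⊆ Finset.range L) :
    (((b : ℝ) ^ n) ^ L)⁻¹ * ∑ δ : Fin L → Fin n → ZMod b, netTerm A (extendShift δ) g w ^ 2 ≤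
      (C ^ 2) ^ w.card * dualSum A (fun k => r k ^ 2) w := by
  have h1 : ∀ δ : ℕ → Fin n → ZMod b, netTerm A δ g w ^ 2 = gridMean fun a => gridMean fun a' =>
      ∏ j ∈ w, (gridCenter (g j) (A j a + δ j) * gridCenter (g j) (A j a' + δ j)) := fun δ => by
    simp only [netTerm, gridMean, sq, Finset.prod_mul_distrib]
    rw [mul_mul_mul_comm, Finset.sum_mul_sum, mul_assoc]
    simp only [Finset.mul_sum]
  have h2 : (((b : ℝ) ^ n) ^ L)⁻¹ * ∑ δ : Fin L → Fin n → ZMod b,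
      netTerm A (extendShift δ) g w ^ 2 = gridMean fun a => gridMean fun a' => ∏ j ∈ w,
        gridMean fun x => gridCenter (g j) (A j a + x) * gridCenter (g j) (A j a' + x) := by
    simp only [← mean_prod_extendShift hw, h1]
    simp only [gridMean, Finset.mul_sum]
    rw [Finset.sum_comm]
    refine Finset.sum_congr rfl fun a _ => ?_
    rw [Finset.sum_comm]
    refine Finset.sum_congr rfl fun a' _ => ?_
    refine Finset.sum_congr rfl fun δ _ => ?_
    ring
  have h3 : ∀ j a a', (gridMean fun x => gridCenter (g j) (A j a + x) * gridCenter (g j) (A j a' + x)) =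
      gridMean fun x => gridCenter (g j) (A j (a - a') + x) * gridCenter (g j) x := fun j a a' => by
    rw [gridMean, gridMean]
    congr 1
    rw [← Equiv.sum_comp (Equiv.addLeft (A j a')) fun x =>
      gridCenter (g j) (A j (a - a') + x) * gridCenter (g j) x]
    refine Finset.sum_congr rfl fun x _ => ?_
    simp only [Equiv.coe_addLeft, map_sub]
    congr 2
    abel
  simp only [h3] at h2
  rw [h2, mean_mean_sub fun a => ∏ j ∈ w,
    gridMean fun x => gridCenter (g j) (A j a + x) * gridCenter (g j) x]
  have h4 := norm_mean_prod_le A w (g := fun j v =>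
      ((gridMean fun x => gridCenter (g j) (v + x) * gridCenter (g j) x : ℝ) : ℂ))
    (c := fun j k => ((‖walshCoeff (g j) k‖ ^ 2 : ℝ) : ℂ)) (ρ := fun k => r k ^ 2) (C := C ^ 2)
    (fun j v => autocorrelation_eq_sum (g j) v) fun j k => by
      rw [Complex.norm_real, Real.norm_of_nonneg (by positivity), ← mul_pow]
      exact pow_le_pow_left₀ (norm_nonneg _) (hg j k) 2
  refine le_trans ?_ h4
  refine (le_abs_self _).trans (le_of_eq ?_)
  rw [← Real.norm_eq_abs, ← Complex.norm_real]
  congr 1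
  nth_rewrite 1 [gridMean]
  push_cast
  rfl

end NetError

end

noncomputable section

/-! ### The error of polynomial lattice rules for the features -/

section RuleError

variable {b : ℕ} [Fact b.Prime]

/-- The error of a rule for the feature `∏_{j ∈ u} φ(x_j, ω_j)`. -/
def ruleErr (α : ℕ) (c : I) (R : PolyLatticeRule b) (u : Finset ℕ) (ω : ℕ → ℝ) : ℝ :=
  ((b : ℝ) ^ R.m)⁻¹ * ∑ h ∈ Finset.range (b ^ R.m), prodFeat α c u ω (R.point h) -
    ∏ j ∈ u, ∫ x : I, feat α c x (ω j)

def ruleSqErr (α : ℕ) (c : I) (R : PolyLatticeRule b) (u : Finset ℕ) : ℝ :=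
  ∫ ω, ruleErr α c R u ω ^ 2 ∂featMeasurePi α

theorem measurable_integral_feat (α : ℕ) (c : I) : Measurable fun t => ∫ x : I, feat α c x t := by
  have h := (measurable_feat_uncurry α c).stronglyMeasurable.integral_prod_left'
    (μ := (volume : Measure I))
  exact h.measurable

theorem abs_integral_feat_le (α : ℕ) (c : I) (t : ℝ) : |∫ x : I, feat α c x t| ≤ √α :=
  abs_integral_le_of_forall_abs_le _ fun x => abs_feat_le α c x t

theorem measurable_ruleErr (α : ℕ) (c : I) (R : PolyLatticeRule b) (u : Finset ℕ) :
    Measurable (ruleErr α c R u) := by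
  refine Measurable.sub (Measurable.const_mul (Finset.measurable_sum _ fun h _ =>
    measurable_prodFeat_left α c u _) _) (Finset.measurable_prod _ fun j _ => ?_)
  exact (measurable_integral_feat α c).comp (measurable_pi_apply j)

theorem ruleErr_digitRule (α : ℕ) (c : I) {p : (ZMod b)[X]} {m n : ℕ} (hp : Irreducible p)
    (hpn : p.natDegree = n) (hm : 1 ≤ m) (hmn : m ≤ n) (q δ : ℕ → Fin n → ZMod b) (u : Finset ℕ)
    (ω : ℕ → ℝ) :
    ruleErr α c (digitRule hp hpn hm hmn q δ) u ω =
      netErr (fun j => digitMap p m n (Polynomial.ofFn n (q j))) δ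
        (fun j v => feat α c (gridPt v) (ω j)) (fun j => ∫ x : I, feat α c x (ω j)) u := by
  rw [ruleErr, netErr, gridMean, ← sum_digitVec]
  simp only [prodFeat, digitRule_point]
  rfl

theorem abs_gridMean_le {n : ℕ} {g : (Fin n → ZMod b) → ℝ} {C : ℝ} (hg : ∀ v, |g v| ≤ C) :
    |gridMean g| ≤ C := by
  have hb := base_pos (b := b)
  rw [gridMean, abs_mul, abs_of_pos (by positivity), inv_mul_le_iff₀ (by positivity)]
  refine (Finset.abs_sum_le_sum_abs _ _).trans
    ((Finset.sum_le_card_nsmul _ _ C fun v _ => hg v).trans ?_)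
  simp

/-- The bound for the Walsh coefficients of the features. -/
def featConst (α b : ℕ) : ℝ := √α * (b : ℝ) ^ α

theorem sqrt_le_featConst (α : ℕ) : √α ≤ featConst α b :=
  le_mul_of_one_le_right (Real.sqrt_nonneg _) (one_le_pow₀ (one_lt_base (b := b)).le)

theorem one_le_featConst {α : ℕ} (hα : 1 ≤ α) : 1 ≤ featConst α b :=
  le_trans (Real.one_le_sqrt.2 (by exact_mod_cast hα)) (sqrt_le_featConst α)

theorem pow_mul_add_sum_le {C ε : ℝ} (hC : 1 ≤ C) (u : Finset ℕ) {y : Finset ℕ → ℝ}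
    (hy : ∀ w, 0 ≤ y w) :
    2 ^ u.card * (((2 * C) ^ u.card * ε) ^ 2 +
      ∑ w ∈ u.powerset.erase ∅, (C ^ (u \ w).card) ^ 2 * ((C ^ 2) ^ w.card * y w)) ≤
      (8 * C ^ 2) ^ u.card * (ε ^ 2 + ∑ w ∈ u.powerset.erase ∅, y w) := by
  have h1 : ∑ w ∈ u.powerset.erase ∅, (C ^ (u \ w).card) ^ 2 * ((C ^ 2) ^ w.card * y w) =
      (C ^ 2) ^ u.card * ∑ w ∈ u.powerset.erase ∅, y w := by
    rw [Finset.mul_sum]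
    refine Finset.sum_congr rfl fun w hw => ?_
    have hwu := Finset.mem_powerset.1 (Finset.mem_of_mem_erase hw)
    rw [← pow_mul, mul_comm _ 2, pow_mul, ← mul_assoc, ← pow_add, Finset.card_sdiff_add_card_eq_card hwu]
  have h0 : 0 ≤ ∑ w ∈ u.powerset.erase ∅, y w := Finset.sum_nonneg fun w _ => hy w
  rw [h1]
  have e1 : (2 : ℝ) ^ u.card * ((2 * C) ^ u.card * ε) ^ 2 = (8 * C ^ 2) ^ u.card * ε ^ 2 := by
    rw [mul_pow, ← pow_mul, mul_comm u.card 2, pow_mul, ← mul_assoc, ← mul_pow]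
    ring_nf
  have e2 : (2 : ℝ) ^ u.card * (C ^ 2) ^ u.card ≤ (8 * C ^ 2) ^ u.card := by
    rw [← mul_pow]
    exact pow_le_pow_left₀ (by positivity) (by nlinarith) _
  rw [mul_add, mul_add, e1, ← mul_assoc]
  gcongr

theorem ruleErr_sq_le {α : ℕ} (hα : 1 ≤ α) (c : I) {m n : ℕ} {p : (ZMod b)[X]} (hp : Irreducible p)
    (hpn : p.natDegree = n) (hm : 1 ≤ m) (hmn : m ≤ n) (q δ : ℕ → Fin n → ZMod b) (u : Finset ℕ)
    (ω : ℕ → ℝ) :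
    ruleErr α c (digitRule hp hpn hm hmn q δ) u ω ^ 2 ≤
      2 ^ u.card * (((2 * featConst α b) ^ u.card * (2 * √α * ((b : ℝ) ^ n)⁻¹)) ^ 2 +
        ∑ w ∈ u.powerset.erase ∅, (featConst α b ^ (u \ w).card) ^ 2 *
          netTerm (fun j => digitMap p m n (Polynomial.ofFn n (q j))) δ
            (fun j v => feat α c (gridPt v) (ω j)) w ^ 2) := by
  rw [ruleErr_digitRule]
  exact netErr_sq_le _ _ (one_le_featConst hα)
    (fun j => (abs_gridMean_le fun v => abs_feat_le α c _ _).trans (sqrt_le_featConst α))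
    (fun j => (abs_integral_feat_le α c _).trans (sqrt_le_featConst α))
    (fun j => abs_mean_feat_sub_le hα c (ω j) n) u

theorem ruleSqErr_unshifted_le {α : ℕ} (hα : 1 ≤ α) (c : I) {m n : ℕ} {p : (ZMod b)[X]} (hp : Irreducible p)
    (hpn : p.natDegree = n) (hm : 1 ≤ m) (hmn : m ≤ n) (q : ℕ → Fin n → ZMod b) (u : Finset ℕ) :
    ruleSqErr α c (digitRule hp hpn hm hmn q 0) u ≤ (8 * featConst α b ^ 2) ^ u.card *
      ((2 * √α * ((b : ℝ) ^ n)⁻¹) ^ 2 + ∑ w ∈ u.powerset.erase ∅,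
        dualSum (fun j => digitMap p m n (Polynomial.ofFn n (q j))) (walshRate b α n) w ^ 2) := by
  have := isProbabilityMeasure_featMeasure hα
  set M := (8 * featConst α b ^ 2) ^ u.card *
      ((2 * √α * ((b : ℝ) ^ n)⁻¹) ^ 2 + ∑ w ∈ u.powerset.erase ∅,
        dualSum (fun j => digitMap p m n (Polynomial.ofFn n (q j))) (walshRate b α n) w ^ 2)
  have h : ∀ ω, ruleErr α c (digitRule hp hpn hm hmn q 0) u ω ^ 2 ≤ M := fun ω => by
    refine (ruleErr_sq_le hα c hp hpn hm hmn q 0 u ω).trans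
      (le_trans ?_ (pow_mul_add_sum_le (one_le_featConst hα) u fun w => sq_nonneg _))
    refine mul_le_mul_of_nonneg_left (add_le_add le_rfl (Finset.sum_le_sum fun w _ =>
      mul_le_mul_of_nonneg_left ?_ (sq_nonneg _))) (by positivity)
    rw [← pow_mul, mul_comm 2, pow_mul, ← mul_pow, ← sq_abs]
    exact pow_le_pow_left₀ (abs_nonneg _) (abs_netTerm_zero_le _
      (fun j k => norm_walshCoeff_feat_le hα c (ω j) k) w) 2
  refine (integral_mono_of_nonneg (ae_of_all _ fun ω => sq_nonneg _) (integrable_const M)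
    (ae_of_all _ h)).trans_eq ?_
  simp

/-- One shift has to serve all sets at once, so the whole weighted sum is averaged over the finitely
many shifts on the grid. -/
theorem exists_shift_sum_ruleSqErr_le {α : ℕ} (hα : 1 ≤ α) (c : I) {m n : ℕ} {p : (ZMod b)[X]} (hp : Irreducible p)
    (hpn : p.natDegree = n) (hm : 1 ≤ m) (hmn : m ≤ n) (q : ℕ → Fin n → ZMod b) {ι : Type*}
    (S : Finset ι) {f : ι → Finset ℕ} {W : ι → ℝ} (hW : ∀ x, 0 ≤ W x) {L : ℕ}
    (hf : ∀ x ∈ S, f x ⊆ Finset.range L) :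
    ∃ δ, ∑ x ∈ S, W x * ruleSqErr α c (digitRule hp hpn hm hmn q δ) (f x) ≤
      ∑ x ∈ S, W x * ((8 * featConst α b ^ 2) ^ (f x).card *
      ((2 * √α * ((b : ℝ) ^ n)⁻¹) ^ 2 + ∑ w ∈ (f x).powerset.erase ∅,
        dualSum (fun j => digitMap p m n (Polynomial.ofFn n (q j)))
          (fun k => walshRate b α n k ^ 2) w)) := by
  have := isProbabilityMeasure_featMeasure hα
  have hb := base_pos (b := b)
  set A := fun j => digitMap p m n (Polynomial.ofFn n (q j)) with hA
  set M : Finset ℕ → ℝ := fun u => (8 * featConst α b ^ 2) ^ u.card *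
      ((2 * √α * ((b : ℝ) ^ n)⁻¹) ^ 2 + ∑ w ∈ u.powerset.erase ∅,
        dualSum A (fun k => walshRate b α n k ^ 2) w) with hM
  set D : ℝ := ((b : ℝ) ^ n) ^ L with hD
  have hD0 : 0 < D := by positivity
  have hcard : (Fintype.card (Fin L → Fin n → ZMod b) : ℝ) = D := by simp [hD]
  have hint : ∀ R : PolyLatticeRule b, ∀ u, Integrable (fun ω => ruleErr α c R u ω ^ 2)
      (featMeasurePi α) := fun R u => by
    refine Integrable.of_bound ((measurable_ruleErr α c R u).pow_const 2).aestronglyMeasurable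
      ((√α ^ u.card + √α ^ u.card) ^ 2) (ae_of_all _ fun ω => ?_)
    rw [Real.norm_eq_abs, abs_pow]
    refine pow_le_pow_left₀ (abs_nonneg _) ((abs_sub _ _).trans (add_le_add ?_ ?_)) 2
    · rw [abs_mul, abs_of_pos (by positivity), inv_mul_le_iff₀ (by positivity)]
      refine (Finset.abs_sum_le_sum_abs _ _).trans
        ((Finset.sum_le_card_nsmul _ _ _ fun h _ => abs_prodFeat_le α c u ω _).trans ?_)
      simp
    · rw [Finset.abs_prod]
      exact (Finset.prod_le_prod (fun _ _ => abs_nonneg _)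
        fun j _ => abs_integral_feat_le α c (ω j)).trans_eq (Finset.prod_const _)
  have key : ∀ u ⊆ Finset.range L, ∑ δ : Fin L → Fin n → ZMod b,
      ruleSqErr α c (digitRule hp hpn hm hmn q (extendShift δ)) u ≤ D * M u := by
    intro u hu
    simp only [ruleSqErr]
    rw [← integral_finsetSum _ fun δ _ => hint _ u]
    refine (integral_mono_of_nonneg (ae_of_all _ fun ω => Finset.sum_nonneg fun δ _ => sq_nonneg _)
      (integrable_const (D * M u)) (ae_of_all _ fun ω => ?_)).trans_eq (by simp)
    refine (Finset.sum_le_sum fun δ _ =>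
      ruleErr_sq_le hα c hp hpn hm hmn q (extendShift δ) u ω).trans ?_
    rw [← Finset.mul_sum, Finset.sum_add_distrib, Finset.sum_const, Finset.card_univ, nsmul_eq_mul,
      hcard, Finset.sum_comm]
    have h1 := pow_mul_add_sum_le (ε := 2 * √α * ((b : ℝ) ^ n)⁻¹)
      (one_le_featConst (b := b) hα) u
      (y := fun w => dualSum A (fun k => walshRate b α n k ^ 2) w)
      fun w => dualSum_nonneg _ (fun k => sq_nonneg _) w
    refine le_trans ?_ (mul_le_mul_of_nonneg_left h1 hD0.le)
    rw [mul_left_comm D]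
    refine mul_le_mul_of_nonneg_left ?_ (by positivity)
    rw [mul_add D, Finset.mul_sum]
    refine add_le_add le_rfl (Finset.sum_le_sum fun w hw => ?_)
    rw [← Finset.mul_sum, mul_left_comm D]
    refine mul_le_mul_of_nonneg_left ?_ (sq_nonneg _)
    have hwu := Finset.mem_powerset.1 (Finset.mem_of_mem_erase hw)
    have h2 := mean_netTerm_sq_le A (fun j k => norm_walshCoeff_feat_le hα c (ω j) k)
      (hwu.trans hu)
    rwa [inv_mul_le_iff₀ hD0] at h2
  have hsum : ∑ δ : Fin L → Fin n → ZMod b, ∑ x ∈ S,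
      W x * ruleSqErr α c (digitRule hp hpn hm hmn q (extendShift δ)) (f x) ≤
      ∑ _δ : Fin L → Fin n → ZMod b, ∑ x ∈ S, W x * M (f x) := by
    rw [Finset.sum_comm, Finset.sum_const, Finset.card_univ, nsmul_eq_mul, hcard, Finset.mul_sum]
    refine Finset.sum_le_sum fun x hx => ?_
    rw [← Finset.mul_sum, mul_left_comm]
    exact mul_le_mul_of_nonneg_left (key _ (hf x hx)) (hW x)
  obtain ⟨δ, -, hδ⟩ := Finset.exists_le_of_sum_le Finset.univ_nonempty hsum
  exact ⟨_, hδ⟩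

end RuleError

end

noncomputable section

/-! ### The weighted error of a single level -/

theorem factorial_add_rpow_le {q : ℝ} (hq : 0 ≤ q) (i j : ℕ) :
    ((i + j).factorial : ℝ) ^ q ≤
      (2 ^ q) ^ i * (i.factorial : ℝ) ^ q * ((2 ^ q) ^ j * (j.factorial : ℝ) ^ q) := by
  have h : ((i + j).factorial : ℝ) ≤ 2 ^ (i + j) * (i.factorial * j.factorial) := by
    rw [← Nat.add_choose_mul_factorial_mul_factorial, mul_assoc]
    push_cast
    refine mul_le_mul_of_nonneg_right ?_ (by positivity)
    exact_mod_cast Nat.choose_le_two_pow (i + j) j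
  refine (Real.rpow_le_rpow (by positivity) h hq).trans_eq ?_
  rw [Real.mul_rpow (by positivity) (by positivity), Real.mul_rpow (by positivity) (by positivity),
    ← Real.rpow_natCast, ← Real.rpow_mul (by norm_num), mul_comm _ q, Real.rpow_mul (by norm_num),
    Real.rpow_natCast, pow_add]
  ring

theorem podProd_le_mul {q : ℝ} (hq : 0 ≤ q) {a : ℕ → ℝ} (ha : ∀ j, 0 ≤ a j) {w v : Finset ℕ}
    (h : w ⊆ v) : podProd q a v ≤
      podProd q (fun j => 2 ^ q * a j) w * podProd q (fun j => 2 ^ q * a j) (v \ w) := by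
  rw [← pow_card_mul_podProd, ← pow_card_mul_podProd, podProd, podProd, podProd,
    ← Finset.card_sdiff_add_card_eq_card h, ← Finset.prod_sdiff h, add_comm]
  have h1 := mul_le_mul_of_nonneg_right (factorial_add_rpow_le hq w.card (v \ w).card)
    (mul_nonneg (Finset.prod_nonneg fun j (_ : j ∈ v \ w) => ha j)
      (Finset.prod_nonneg fun j (_ : j ∈ w) => ha j))
  refine h1.trans_eq ?_
  ring

/-- Split `v` into `w` and `v \ w`. The POD products are submultiplicative up to a factor `2^q` per
element, and the sums over the two pieces decouple. -/
theorem sum_powerset_podProd_mul_le {q : ℝ} (hq : 0 ≤ q) {a : ℕ → ℝ} (ha : ∀ j, 0 ≤ a j)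
    {f : Finset ℕ → ℝ} (hf : ∀ w, 0 ≤ f w) (U : Finset ℕ) :
    ∑ v ∈ U.powerset, podProd q a v * ∑ w ∈ v.powerset, f w ≤
      (∑ z ∈ U.powerset, podProd q (fun j => 2 ^ q * a j) z) *
        ∑ w ∈ U.powerset, podProd q (fun j => 2 ^ q * a j) w * f w := by
  classical
  set a' := fun j => 2 ^ q * a j with ha'
  have ha0 : ∀ j, 0 ≤ a' j := fun j => mul_nonneg (by positivity) (ha j)
  have h1 : ∑ v ∈ U.powerset, podProd q a v * ∑ w ∈ v.powerset, f w ≤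
      ∑ v ∈ U.powerset, ∑ w ∈ U.powerset,
        if w ⊆ v then podProd q a' (v \ w) * (podProd q a' w * f w) else 0 := by
    refine Finset.sum_le_sum fun v hv => ?_
    rw [← Finset.sum_filter, Finset.mul_sum]
    have hfil : U.powerset.filter (fun w => w ⊆ v) = v.powerset := by
      ext w
      simp only [Finset.mem_filter, Finset.mem_powerset]
      exact ⟨fun h => h.2, fun h => ⟨h.trans (Finset.mem_powerset.1 hv), h⟩⟩
    rw [hfil]
    refine Finset.sum_le_sum fun w hw => ?_
    rw [← mul_assoc, mul_comm (podProd q a' (v \ w))]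
    exact mul_le_mul_of_nonneg_right (podProd_le_mul hq ha (Finset.mem_powerset.1 hw)) (hf w)
  refine h1.trans ?_
  rw [Finset.sum_comm, Finset.mul_sum]
  refine Finset.sum_le_sum fun w _ => ?_
  rw [← Finset.sum_filter, ← Finset.sum_mul]
  refine mul_le_mul_of_nonneg_right ?_ (mul_nonneg (podProd_nonneg ha0 w) (hf w))
  rw [← Finset.sum_image (s := U.powerset.filter (fun v => w ⊆ v)) (g := fun v => v \ w)
    (f := podProd q a')]
  · refine Finset.sum_le_sum_of_subset_of_nonneg (fun z hz => ?_) fun z _ _ => podProd_nonneg ha0 z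
    obtain ⟨v, hv, rfl⟩ := Finset.mem_image.1 hz
    exact Finset.mem_powerset.2 (Finset.sdiff_subset.trans
      (Finset.mem_powerset.1 (Finset.mem_filter.1 hv).1))
  · intro v hv v' hv' h
    have h2 := (Finset.mem_filter.1 hv).2
    have h3 := (Finset.mem_filter.1 hv').2
    rw [← Finset.sdiff_union_of_subset h2, ← Finset.sdiff_union_of_subset h3]
    exact congrArg (· ∪ w) h

theorem sum_le_sum_powerset_podProd {q : ℝ} {a : ℕ → ℝ} (ha : ∀ j, 0 ≤ a j) (L : ℕ) :
    ∑ i ∈ Finset.range L, a i ≤ ∑ v ∈ (Finset.range L).powerset, podProd q a v := by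
  rw [sum_powerset_range]
  have h : ∀ i ∈ Finset.range L,
      a i ≤ ∑ v ∈ (Finset.range i).powerset, podProd q a (insert i v) := fun i _ => by
    refine le_trans (le_of_eq ?_) (Finset.single_le_sum (f := fun v => podProd q a (insert i v))
      (fun v _ => podProd_nonneg ha _) (Finset.empty_mem_powerset _))
    simp [podProd]
  have h0 := podProd_nonneg (q := q) ha ∅
  linarith [Finset.sum_le_sum h]

/-- The construction controls, for each `i`, only sets with largest element `i`. Non-empty subsets
of `insert i v` that contain `i` are covered directly; the others have a largest element `k < i` and
cost `a_k η`, which sums to a multiple of `η`. The three factors `2^q` pay for extracting `i`, for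
splitting `v`, and for extracting `k`. -/
theorem exists_sum_podProd_mul_le {q d Cγ : ℝ} (hq : 0 ≤ q) (hqd : q < d) (hd : 1 < d)
    {γ : ℕ → ℝ≥0} (hγ : ∀ j : ℕ, (γ j : ℝ) ≤ Cγ * ((j : ℝ) + 1) ^ (-d)) {K : ℝ} (hK : 0 ≤ K) :
    ∃ C : ℝ, 0 ≤ C ∧ ∀ (L : ℕ) (J : Finset ℕ), J ⊆ Finset.range L → ∀ (Y : Finset ℕ → ℝ),
      (∀ w, 0 ≤ Y w) → ∀ η : ℝ, 0 ≤ η → (∀ i < L, ∑ w ∈ (Finset.range i).powerset,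
        podProd q (fun j => 2 ^ q * (2 ^ q * (2 ^ q * (K * γ j)))) w * Y (insert i w) ≤ η) →
      ∑ i ∈ J, ∑ v ∈ (Finset.range i).powerset, podProd q (fun j => K * γ j) (insert i v) *
        (η + ∑ w ∈ (insert i v).powerset.erase ∅, Y w) ≤ C * η * ∑ i ∈ J, (γ i : ℝ) := by
  classical
  set a0 : ℕ → ℝ := fun j => 2 ^ q * (K * γ j) with ha0
  set a1 : ℕ → ℝ := fun j => 2 ^ q * a0 j with ha1
  set a2 : ℕ → ℝ := fun j => 2 ^ q * a1 j with ha2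
  have h2q : (1 : ℝ) ≤ 2 ^ q := Real.one_le_rpow (by norm_num) hq
  have hg0 : ∀ j, 0 ≤ K * (γ j : ℝ) := fun j => by positivity
  have h0 : ∀ j, 0 ≤ a0 j := fun j => by positivity
  have h1 : ∀ j, 0 ≤ a1 j := fun j => mul_nonneg (by positivity) (h0 j)
  have h2 : ∀ j, 0 ≤ a2 j := fun j => mul_nonneg (by positivity) (h1 j)
  have hbound : ∀ c : ℝ, 0 ≤ c → ∃ B : ℝ, ∀ L, ∑ v ∈ (Finset.range L).powerset,
      podProd q (fun j => c * γ j) v ≤ B := fun c hc => by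
    simpa using exists_sum_podProd_rpow_le hq hqd hγ one_pos (by linarith) hc
  obtain ⟨B0, hB0⟩ := hbound (2 ^ q * K) (by positivity)
  obtain ⟨B1, hB1⟩ := hbound (2 ^ q * (2 ^ q * K)) (by positivity)
  have e0 : (fun j => 2 ^ q * K * (γ j : ℝ)) = a0 := by
    funext j
    simp only [ha0]
    ring
  have e1 : (fun j => 2 ^ q * (2 ^ q * K) * (γ j : ℝ)) = a1 := by
    funext j
    simp only [ha1, ha0]
    ring
  rw [e0] at hB0
  rw [e1] at hB1
  have hB00 : 0 ≤ B0 := (Finset.sum_nonneg fun v _ => podProd_nonneg h0 v).trans (hB0 0)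
  have hB10 : 0 ≤ B1 := (Finset.sum_nonneg fun v _ => podProd_nonneg h1 v).trans (hB1 0)
  refine ⟨K * (B0 + B1 * (1 + B1)), by positivity, fun L J hJ Y hY η hη hcbc => ?_⟩
  rw [Finset.mul_sum]
  refine Finset.sum_le_sum fun i hi => ?_
  have hiL : i < L := Finset.mem_range.1 (hJ hi)
  have hiv : ∀ v ∈ (Finset.range i).powerset, i ∉ v := fun v hv h => by
    have := Finset.mem_powerset.1 hv h
    simp at this
  set Y' : Finset ℕ → ℝ := fun w => if w = ∅ then 0 else Y w with hY'
  have hY'0 : ∀ w, 0 ≤ Y' w := fun w => by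
    simp only [hY']
    split_ifs
    · exact le_rfl
    · exact hY w
  have hsplit : ∀ v ∈ (Finset.range i).powerset, ∑ w ∈ (insert i v).powerset.erase ∅, Y w =
      ∑ w ∈ v.powerset, (Y (insert i w) + Y' w) := fun v hv => by
    have : ∑ w ∈ (insert i v).powerset.erase ∅, Y w = ∑ w ∈ (insert i v).powerset, Y' w := by
      rw [← Finset.add_sum_erase (insert i v).powerset Y' (Finset.empty_mem_powerset _)]
      simp only [hY', if_true, zero_add]
      exact Finset.sum_congr rfl fun w hw => (if_neg (Finset.ne_of_mem_erase hw)).symm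
    rw [this, Finset.sum_powerset_insert (hiv v hv), add_comm, ← Finset.sum_add_distrib]
    refine Finset.sum_congr rfl fun w _ => ?_
    simp [hY']
  have hA : ∑ w ∈ (Finset.range i).powerset, podProd q a1 w * Y (insert i w) ≤ η := by
    refine (Finset.sum_le_sum fun w _ => mul_le_mul_of_nonneg_right ?_ (hY _)).trans (hcbc i hiL)
    exact podProd_mono h1 (fun j => le_mul_of_one_le_left (h1 j) h2q) w
  have hB : ∑ w ∈ (Finset.range i).powerset, podProd q a1 w * Y' w ≤ B1 * η := by
    rw [sum_powerset_range]
    have hz : podProd q a1 ∅ * Y' ∅ = 0 := by simp [hY']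
    rw [hz, zero_add]
    calc ∑ k ∈ Finset.range i, ∑ w ∈ (Finset.range k).powerset,
          podProd q a1 (insert k w) * Y' (insert k w)
        ≤ ∑ k ∈ Finset.range i, a1 k * η := by
          refine Finset.sum_le_sum fun k hk => ?_
          have hki := Finset.mem_range.1 hk
          refine le_trans ?_ (mul_le_mul_of_nonneg_left (hcbc k (by omega)) (h1 k))
          rw [Finset.mul_sum]
          refine Finset.sum_le_sum fun w hw => ?_
          have hkw : k ∉ w := fun h => by
            have := Finset.mem_powerset.1 hw h
            simp at this
          have hne : Y' (insert k w) = Y (insert k w) := by simp [hY']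
          rw [hne, ← mul_assoc]
          exact mul_le_mul_of_nonneg_right (podProd_insert_le hq h1 hkw) (hY _)
      _ = (∑ k ∈ Finset.range i, a1 k) * η := (Finset.sum_mul _ _ _).symm
      _ ≤ B1 * η := mul_le_mul_of_nonneg_right
          ((sum_le_sum_powerset_podProd (q := q) h1 i).trans (hB1 i)) hη
  have hmain := sum_powerset_podProd_mul_le hq h0 (f := fun w => Y (insert i w) + Y' w)
    (fun w => add_nonneg (hY _) (hY'0 w)) (Finset.range i)
  simp only [mul_add (podProd q (fun j => 2 ^ q * a0 j) _), Finset.sum_add_distrib] at hmain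
  have hsum0 : 0 ≤ ∑ w ∈ (Finset.range i).powerset, podProd q a1 w * Y (insert i w) +
      ∑ w ∈ (Finset.range i).powerset, podProd q a1 w * Y' w :=
    add_nonneg (Finset.sum_nonneg fun w _ => mul_nonneg (podProd_nonneg h1 w) (hY _))
      (Finset.sum_nonneg fun w _ => mul_nonneg (podProd_nonneg h1 w) (hY'0 w))
  have hmain' := hmain.trans (mul_le_mul (hB1 i) (add_le_add hA hB) hsum0 hB10)
  calc ∑ v ∈ (Finset.range i).powerset, podProd q (fun j => K * γ j) (insert i v) *
        (η + ∑ w ∈ (insert i v).powerset.erase ∅, Y w)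
      ≤ ∑ v ∈ (Finset.range i).powerset, K * γ i * (podProd q a0 v * η + podProd q a0 v *
        (∑ w ∈ v.powerset, Y (insert i w) + ∑ w ∈ v.powerset, Y' w)) := by
        refine Finset.sum_le_sum fun v hv => ?_
        rw [hsplit v hv, Finset.sum_add_distrib, ← mul_add, ← mul_assoc]
        refine mul_le_mul_of_nonneg_right (podProd_insert_le hq hg0 (hiv v hv)) ?_
        exact add_nonneg hη (add_nonneg (Finset.sum_nonneg fun w _ => hY _)
          (Finset.sum_nonneg fun w _ => hY'0 w))
    _ = K * γ i * ((∑ v ∈ (Finset.range i).powerset, podProd q a0 v) * η +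
        ∑ v ∈ (Finset.range i).powerset, podProd q a0 v *
          (∑ w ∈ v.powerset, Y (insert i w) + ∑ w ∈ v.powerset, Y' w)) := by
        rw [← Finset.mul_sum, Finset.sum_add_distrib, Finset.sum_mul]
    _ ≤ K * γ i * (B0 * η + B1 * (η + B1 * η)) := by
        refine mul_le_mul_of_nonneg_left (add_le_add ?_ hmain') (hg0 i)
        exact mul_le_mul_of_nonneg_right (hB0 i) hη
    _ = K * (B0 + B1 * (1 + B1)) * η * γ i := by ring

/-! ### Rules for one level, with the rate `2τ` and the weights of the level as a factor. -/

section Level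

variable {b : ℕ} [Fact b.Prime]

/-- The averaging exponent is `1/(2τ)`. Then `τ < α` makes the Walsh bounds summable, and `2τ < d`
makes the weights summable. The free `pp` and `ρ` cover the square of a dual sum of rates
(unshifted) and a dual sum of squared rates (shifted). -/
theorem exists_generator_le (b : ℕ) [Fact b.Prime] {α : ℕ} (hα : 1 ≤ α) {q d Cγ : ℝ} (hq : 0 ≤ q)
    (hqd : q < d) {γ : ℕ → ℝ≥0} (hγ : ∀ j : ℕ, (γ j : ℝ) ≤ Cγ * ((j : ℝ) + 1) ^ (-d)) {τ : ℝ}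
    (hτ : 1 / 2 ≤ τ) (hτα : τ < α) (hτd : 2 * τ < d) {K : ℝ} (hK : 0 ≤ K) :
    ∃ C : ℝ, 0 ≤ C ∧ ∀ {m n : ℕ} {p : (ZMod b)[X]} (_ : Irreducible p) (_ : p.natDegree = n)
      (_ : m ≤ n) (L : ℕ) {pp : ℝ} {ρ : (Fin n → ZMod b) → ℝ} (_ : ∀ k, 0 ≤ ρ k) (_ : 0 < pp)
      (_ : pp ≤ 2 * τ) (_ : ∀ k, ρ k ^ (pp * (2 * τ)⁻¹) = walshRate b α n k ^ τ⁻¹),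
      ∃ g : ℕ → Fin n → ZMod b, ∀ i < L, ∑ w ∈ (Finset.range i).powerset,
        podProd q (fun j => K * γ j) w *
          dualSum (fun j => digitMap p m n (Polynomial.ofFn n (g j))) ρ (insert i w) ^ pp ≤
        C * ((b : ℝ) ^ m) ^ (-(2 * τ)) := by
  have hb := base_pos (b := b)
  have hτ0 : 0 < τ := by linarith
  have hα0 : (0 : ℝ) < α := by exact_mod_cast hα
  obtain ⟨CR, hCR⟩ := exists_sum_walshRate_rpow_le (b := b) hα (θ := τ⁻¹)
    (by rw [← div_eq_mul_inv]; exact (one_lt_div hτ0).2 hτα)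
  have hCR0 : 0 ≤ CR := (Finset.sum_nonneg fun k _ =>
    Real.rpow_nonneg (walshRate_nonneg _ _) _).trans (hCR 0)
  have he0 : 0 < (2 * τ)⁻¹ := by positivity
  have he1 : (2 * τ)⁻¹ ≤ 1 := inv_le_one_of_one_le₀ (by linarith)
  obtain ⟨S, hS⟩ := exists_sum_podProd_rpow_le hq hqd hγ he0
    (by rw [inv_mul_eq_div]; exact (one_lt_div (by positivity)).2 hτd)
    (c := CR ^ (2 * τ) * K) (by positivity)
  have hnn : ∀ w, 0 ≤ podProd q (fun j => K * (γ j : ℝ)) w := podProd_nonneg fun j => by positivity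
  have hS0 : 0 ≤ S := (Finset.sum_nonneg fun v _ => Real.rpow_nonneg
    (podProd_nonneg (fun j => by positivity) v) _).trans (hS 0)
  refine ⟨(CR * S) ^ (2 * τ), by positivity, fun {m n p} hp hpn hmn L {pp ρ} hρ hpp hppτ hρr => ?_⟩
  obtain ⟨g, hg⟩ := exists_dualSum_le (B := fun x => digitMap p m n (Polynomial.ofFn n x))
    (fun a ha => bijective_digitMap hp hpn hmn ha) hρ hnn he0 he1 hpp
    (by rw [← div_eq_mul_inv]; exact div_le_one_of_le₀ hppτ (by positivity)) L
  refine ⟨g, fun i hi => (hg i hi).trans ?_⟩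
  simp only [hρr, inv_inv]
  have hRs : ∑ k ∈ Finset.univ.erase (0 : Fin n → ZMod b), walshRate b α n k ^ τ⁻¹ ≤ CR :=
    (Finset.sum_le_sum_of_subset_of_nonneg (Finset.erase_subset _ _) fun k _ _ =>
      Real.rpow_nonneg (walshRate_nonneg _ _) _).trans (hCR n)
  have hRs0 : 0 ≤ ∑ k ∈ Finset.univ.erase (0 : Fin n → ZMod b), walshRate b α n k ^ τ⁻¹ :=
    Finset.sum_nonneg fun k _ => Real.rpow_nonneg (walshRate_nonneg _ _) _
  have hsum : ∑ w ∈ (Finset.range i).powerset, podProd q (fun j => K * (γ j : ℝ)) w ^ (2 * τ)⁻¹ *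
      (∑ k ∈ Finset.univ.erase (0 : Fin n → ZMod b), walshRate b α n k ^ τ⁻¹) ^ (w.card + 1) ≤
      CR * S := by
    refine le_trans ?_ (mul_le_mul_of_nonneg_left (hS i) hCR0)
    rw [Finset.mul_sum]
    refine Finset.sum_le_sum fun w _ => ?_
    have h1 : podProd q (fun j => CR ^ (2 * τ) * K * (γ j : ℝ)) w ^ (2 * τ)⁻¹ =
        CR ^ w.card * podProd q (fun j => K * (γ j : ℝ)) w ^ (2 * τ)⁻¹ := by
      simp only [mul_assoc (CR ^ (2 * τ))]
      rw [← pow_card_mul_podProd, Real.mul_rpow (by positivity) (hnn w), ← Real.rpow_natCast,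
        ← Real.rpow_natCast, ← Real.rpow_mul hCR0, ← Real.rpow_mul hCR0]
      congr 2
      field_simp
    rw [h1, mul_comm]
    calc _ ≤ CR ^ (w.card + 1) * podProd q (fun j => K * (γ j : ℝ)) w ^ (2 * τ)⁻¹ :=
          mul_le_mul_of_nonneg_right (pow_le_pow_left₀ hRs0 hRs _) (Real.rpow_nonneg (hnn w) _)
      _ = _ := by ring
  refine (Real.rpow_le_rpow ?_ (mul_le_mul_of_nonneg_left hsum (by positivity))
    (by positivity)).trans_eq ?_
  · exact mul_nonneg (by positivity) (Finset.sum_nonneg fun w _ =>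
      mul_nonneg (Real.rpow_nonneg (hnn w) _) (pow_nonneg hRs0 _))
  · rw [Real.mul_rpow (by positivity) (by positivity), Real.inv_rpow (by positivity),
      ← Real.rpow_neg (by positivity), mul_comm]

theorem exists_rule_le (b : ℕ) [Fact b.Prime] {α : ℕ} (hα : 1 ≤ α) (c : I) {q d Cγ CΓ : ℝ}
    (hq : 0 ≤ q) (hqd : q < d) (hd : 1 < d) {Γ γ : ℕ → ℝ≥0}
    (hγ : ∀ j : ℕ, (γ j : ℝ) ≤ Cγ * ((j : ℝ) + 1) ^ (-d)) (hCΓ : 0 ≤ CΓ)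
    (hΓ : ∀ u, (podWeights Γ γ u : ℝ) ≤ CΓ * podProd q (fun j => γ j) u) {τ : ℝ}
    (hτ : 1 / 2 ≤ τ) (hτα : τ < α) (hτd : 2 * τ < d) :
    ∃ C : ℝ, 0 ≤ C ∧ ∀ m, 1 ≤ m → ∀ (L : ℕ) (J : Finset ℕ), J ⊆ Finset.range L →
      ∃ R : PolyLatticeRule b, R.m = m ∧ R.Suitable α ∧
        ∑ i ∈ J, ∑ v ∈ (Finset.range i).powerset,
          podWeights Γ γ (insert i v) * ruleSqErr α c R (insert i v) ≤
            C * ((b : ℝ) ^ m) ^ (-(2 * τ)) * ∑ i ∈ J, (γ i : ℝ) := by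
  classical
  have hb := base_pos (b := b)
  have hb1 := one_lt_base (b := b)
  have hτ0 : 0 < τ := by linarith
  set K := 8 * featConst α b ^ 2 with hK
  have hK0 : 0 ≤ K := by positivity
  obtain ⟨C1, hC10, hC1⟩ := exists_generator_le b hα hq hqd hγ hτ hτα hτd
    (K := 2 ^ q * (2 ^ q * (2 ^ q * K))) (by positivity)
  obtain ⟨C2, hC20, hC2⟩ := exists_sum_podProd_mul_le hq hqd hd hγ hK0
  have ea : (fun j => 2 ^ q * (2 ^ q * (2 ^ q * K)) * (γ j : ℝ)) =
      fun j => 2 ^ q * (2 ^ q * (2 ^ q * (K * (γ j : ℝ)))) := by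
    funext j
    ring
  rw [ea] at hC1
  refine ⟨CΓ * (C2 * (C1 + 4 * α)), by positivity, fun m hm L J hJ => ?_⟩
  set N := ((b : ℝ) ^ m) ^ (-(2 * τ)) with hN
  have hN0 : 0 ≤ N := by positivity
  set η := (C1 + 4 * α) * N with hη
  have hη0 : 0 ≤ η := by positivity
  -- With at least `τm` digits the discretisation error does not exceed the target; this is what
  -- ties the degree of the modulus to `τ`.
  have hbn : ∀ n : ℕ, τ * m ≤ n → (2 * √α * ((b : ℝ) ^ n)⁻¹) ^ 2 ≤ η := fun n hn => by
    have h1 : (((b : ℝ) ^ n)⁻¹) ^ 2 ≤ N := by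
      rw [hN, ← Real.rpow_natCast, ← Real.rpow_natCast, ← Real.rpow_natCast, ← Real.rpow_neg hb.le,
        ← Real.rpow_mul hb.le, ← Real.rpow_mul hb.le]
      refine Real.rpow_le_rpow_of_exponent_le hb1.le ?_
      push_cast
      linarith
    rw [mul_pow, mul_pow, Real.sq_sqrt (by positivity)]
    have h2 : (2 : ℝ) ^ 2 * α * (((b : ℝ) ^ n)⁻¹) ^ 2 ≤ 2 ^ 2 * α * N :=
      mul_le_mul_of_nonneg_left h1 (by positivity)
    rw [hη]
    nlinarith [mul_nonneg hC10 hN0]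
  have hfinal : ∀ (R : PolyLatticeRule b) (Y : Finset ℕ → ℝ) (ε : ℝ), (∀ w, 0 ≤ Y w) → ε ≤ η →
      (∀ i < L, ∑ w ∈ (Finset.range i).powerset,
        podProd q (fun j => 2 ^ q * (2 ^ q * (2 ^ q * (K * (γ j : ℝ))))) w * Y (insert i w) ≤ η) →
      ∑ i ∈ J, ∑ v ∈ (Finset.range i).powerset,
          podWeights Γ γ (insert i v) * ruleSqErr α c R (insert i v) ≤
        ∑ i ∈ J, ∑ v ∈ (Finset.range i).powerset, podWeights Γ γ (insert i v) *
          (K ^ (insert i v).card * (ε + ∑ w ∈ (insert i v).powerset.erase ∅, Y w)) →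
      ∑ i ∈ J, ∑ v ∈ (Finset.range i).powerset,
          podWeights Γ γ (insert i v) * ruleSqErr α c R (insert i v) ≤
        CΓ * (C2 * (C1 + 4 * α)) * N * ∑ i ∈ J, (γ i : ℝ) := by
    intro R Y ε hY hε hcbc hle
    refine hle.trans ?_
    have h1 := mul_le_mul_of_nonneg_left (hC2 L J hJ Y hY η hη0 hcbc) hCΓ
    refine le_trans ?_ (h1.trans_eq (by rw [hη]; ring))
    rw [Finset.mul_sum]
    refine Finset.sum_le_sum fun i _ => ?_
    rw [Finset.mul_sum]
    refine Finset.sum_le_sum fun v _ => ?_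
    rw [← pow_card_mul_podProd]
    have hs : 0 ≤ ∑ w ∈ (insert i v).powerset.erase ∅, Y w := Finset.sum_nonneg fun w _ => hY w
    calc _ ≤ (podWeights Γ γ (insert i v) : ℝ) *
          (K ^ (insert i v).card * (η + ∑ w ∈ (insert i v).powerset.erase ∅, Y w)) := by gcongr
      _ ≤ CΓ * podProd q (fun j => γ j) (insert i v) *
          (K ^ (insert i v).card * (η + ∑ w ∈ (insert i v).powerset.erase ∅, Y w)) :=
          mul_le_mul_of_nonneg_right (hΓ _) (by positivity)
      _ = _ := by ring
  have hC1N : C1 * N ≤ η := by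
    rw [hη]
    exact mul_le_mul_of_nonneg_right (by linarith [Nat.cast_nonneg (α := ℝ) α]) hN0
  -- Degree `m` gives enough digits if `τ < 1`. Unshifted rules need `pp = 2 ≤ 2τ`, that is `τ ≥ 1`,
  -- and their `αm` digits suffice for `τ < α`.
  rcases lt_or_ge τ 1 with hτ1 | hτ1
  · obtain ⟨p, hp, hpn⟩ := exists_irreducible_natDegree b (n := m) (by omega)
    obtain ⟨g, hg⟩ := hC1 hp hpn (m := m) le_rfl L (pp := 1) (ρ := fun k => walshRate b α m k ^ 2)
      (fun k => sq_nonneg _) one_pos (by linarith) fun k => by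
        rw [← Real.rpow_natCast, ← Real.rpow_mul (walshRate_nonneg _ _)]
        congr 1
        push_cast
        field_simp
    simp only [Real.rpow_one] at hg
    obtain ⟨δ, hδ⟩ := exists_shift_sum_ruleSqErr_le hα c hp hpn hm le_rfl g
      (J.sigma fun i => (Finset.range i).powerset) (f := fun x => insert x.1 x.2)
      (W := fun x => (podWeights Γ γ (insert x.1 x.2) : ℝ)) (fun x => NNReal.coe_nonneg _) (L := L)
      fun x hx => by
        rw [Finset.mem_sigma] at hx
        have h1 := Finset.mem_range.1 (hJ hx.1)
        refine Finset.insert_subset (hJ hx.1) ((Finset.mem_powerset.1 hx.2).trans ?_)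
        exact Finset.range_subset_range.2 h1.le
    rw [Finset.sum_sigma, Finset.sum_sigma] at hδ
    refine ⟨digitRule hp hpn hm le_rfl g δ, rfl, Or.inr rfl, ?_⟩
    have hm0 : τ * m ≤ m := mul_le_of_le_one_left (Nat.cast_nonneg m) hτ1.le
    exact hfinal _ (dualSum (fun j => digitMap p m m (Polynomial.ofFn m (g j)))
      fun k => walshRate b α m k ^ 2) _ (fun w => dualSum_nonneg _ (fun k => sq_nonneg _) w)
      (hbn m hm0) (fun i hi => (hg i hi).trans hC1N) hδ
  · obtain ⟨p, hp, hpn⟩ := exists_irreducible_natDegree b (n := α * m)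
      (Nat.mul_ne_zero (by omega) (by omega))
    have hmn : m ≤ α * m := Nat.le_mul_of_pos_left m hα
    obtain ⟨g, hg⟩ := hC1 hp hpn hmn L (pp := 2) (ρ := walshRate b α (α * m))
      (fun k => walshRate_nonneg _ _) two_pos (by linarith) fun k => by
        congr 1
        field_simp
    simp only [Real.rpow_two] at hg
    refine ⟨digitRule hp hpn hm hmn g 0, rfl, Or.inl ⟨rfl, fun j => ?_⟩, ?_⟩
    · simp [digitRule, gridVal]
    refine hfinal _ (fun w => dualSum (fun j => digitMap p m (α * m) (Polynomial.ofFn (α * m) (g j)))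
      (walshRate b α (α * m)) w ^ 2) _ (fun w => sq_nonneg _) (hbn (α * m) ?_)
      (fun i hi => (hg i hi).trans hC1N) ?_
    · push_cast
      exact mul_le_mul_of_nonneg_right hτα.le (Nat.cast_nonneg m)
    · refine Finset.sum_le_sum fun i _ => Finset.sum_le_sum fun v _ =>
        mul_le_mul_of_nonneg_left ?_ (NNReal.coe_nonneg _)
      exact ruleSqErr_unshifted_le hα c hp hpn hm hmn g (insert i v)

end Level

end

noncomputable section

/-! ### Error and cost of multilevel algorithms -/

theorem sum_map_flatMap_range {β M : Type*} [AddCommMonoid M] (n : ℕ) (g : ℕ → List β)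
    (F : β → M) :
    (((List.range n).flatMap g).map F).sum = ∑ k ∈ Finset.range n, ((g k).map F).sum := by
  induction n with
  | zero => simp
  | succ n ih => simp [List.range_succ, Finset.sum_range_succ, ih]

theorem levelDim_monotone (L : ℕ) {a : ℝ} (ha : 1 ≤ a) : Monotone (levelDim L a) := by
  refine monotone_nat_of_le_succ fun k => ?_
  cases k with
  | zero => exact Nat.zero_le _
  | succ k =>
    exact Nat.mul_le_mul_left L (Nat.ceil_mono (pow_le_pow_right₀ ha (Nat.le_succ k)))

section Multilevel

variable {b : ℕ} [Fact b.Prime]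

theorem sum_map_multilevel {M' : Type*} [AddCommMonoid M'] (c : I) (L : ℕ) (a : ℝ) (M : ℕ)
    (R : ℕ → PolyLatticeRule b) (F : ℝ × SamplePoint c → M') :
    ((multilevel c L a M R).map F).sum = F (1, anchoredPoint c ∅ fun _ => c) +
      ∑ k ∈ Finset.range M, ∑ h ∈ Finset.range (b ^ (R k).m),
        (F (((b : ℝ) ^ (R k).m)⁻¹,
            anchoredPoint c (Finset.range (levelDim L a (k + 1))) ((R k).point h)) +
          F (-((b : ℝ) ^ (R k).m)⁻¹,
            anchoredPoint c (Finset.range (levelDim L a k)) ((R k).point h))) := by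
  rw [multilevel, List.map_cons, List.sum_cons, sum_map_flatMap_range]
  simp only [sum_map_flatMap_range, List.map_cons, List.map_nil, List.sum_cons, List.sum_nil,
    add_zero]

/-- A single anchored coordinate in `u` annihilates the product. -/
theorem prodFeat_anchoredPoint (α : ℕ) (c : I) (u v : Finset ℕ) (ω : ℕ → ℝ) (x : ℕ → I) :
    prodFeat α c u ω (anchoredPoint c v x).1 = if u ⊆ v then prodFeat α c u ω x else 0 := by
  split_ifs with h
  · refine Finset.prod_congr rfl fun j hj => ?_
    simp only [anchoredPoint, h hj, if_true]
  · obtain ⟨j, hj, hjv⟩ := Finset.not_subset.1 h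
    refine Finset.prod_eq_zero hj ?_
    simp only [anchoredPoint, hjv, if_false, feat_anchor]

theorem errFun_multilevel (α : ℕ) (c : I) (L : ℕ) (a : ℝ) (M : ℕ) (R : ℕ → PolyLatticeRule b)
    (u : Finset ℕ) (ω : ℕ → ℝ) :
    errFun (multilevel c L a M R) (prodFeat α c u ω) = (∏ j ∈ u, ∫ x : I, feat α c x (ω j)) -
      ((if u ⊆ ∅ then 1 else 0) + ∑ k ∈ Finset.range M,
        ((if u ⊆ Finset.range (levelDim L a (k + 1)) then 1 else 0) -
          (if u ⊆ Finset.range (levelDim L a k) then 1 else 0)) *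
        (((b : ℝ) ^ (R k).m)⁻¹ *
          ∑ h ∈ Finset.range (b ^ (R k).m), prodFeat α c u ω ((R k).point h))) := by
  rw [errFun, sum_map_multilevel, integral_prodFeat]
  simp only [prodFeat_anchoredPoint]
  congr 2
  · split_ifs with h
    · rw [Finset.subset_empty.1 h, prodFeat, Finset.prod_empty, mul_one]
    · rw [mul_zero]
  · refine Finset.sum_congr rfl fun k _ => ?_
    rw [Finset.mul_sum, Finset.mul_sum]
    refine Finset.sum_congr rfl fun h _ => ?_
    split_ifs <;> ring

theorem sqErr_multilevel_empty {α : ℕ} (c : I) (L : ℕ) (a : ℝ) (M : ℕ)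
    (R : ℕ → PolyLatticeRule b) : sqErr α (multilevel c L a M R) ∅ = 0 := by
  have h : ∀ ω, errFun (multilevel c L a M R) (prodFeat α c ∅ ω) = 0 := fun ω => by
    rw [errFun_multilevel]
    simp
  simp [sqErr, h]

theorem insert_subset_range_iff {i n : ℕ} {v : Finset ℕ} (hv : v ⊆ Finset.range i) :
    insert i v ⊆ Finset.range n ↔ i < n := by
  rw [Finset.insert_subset_iff, Finset.mem_range]
  exact ⟨fun h => h.1, fun h => ⟨h, hv.trans (Finset.range_subset_range.2 h.le)⟩⟩

/-- On the other levels the two truncated points either both contain all variables of the set or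
both miss `i`, so their contributions cancel. -/
theorem sqErr_multilevel_of_mem {α : ℕ} (c : I) (L : ℕ) {a : ℝ} (ha : 1 ≤ a) {M : ℕ}
    (R : ℕ → PolyLatticeRule b) {k : ℕ} (hk : k < M) {i : ℕ} (hi : levelDim L a k ≤ i)
    (hi' : i < levelDim L a (k + 1)) {v : Finset ℕ} (hv : v ⊆ Finset.range i) :
    sqErr α (multilevel c L a M R) (insert i v) = ruleSqErr α c (R k) (insert i v) := by
  refine integral_congr_ae (ae_of_all _ fun ω => ?_)
  simp only
  have hmono := levelDim_monotone L ha
  rw [errFun_multilevel, if_neg (by simp), zero_add, Finset.sum_eq_single k]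
  · rw [if_pos ((insert_subset_range_iff hv).2 hi'),
      if_neg (fun h => absurd ((insert_subset_range_iff hv).1 h) (not_lt.2 hi)), ruleErr]
    ring
  · intro l _ hl
    simp only [insert_subset_range_iff hv]
    rcases lt_or_gt_of_ne hl with h | h
    · have h1 : levelDim L a (l + 1) ≤ i := (hmono h).trans hi
      have h2 : levelDim L a l ≤ i := (hmono h.le).trans hi
      rw [if_neg (not_lt.2 h1), if_neg (not_lt.2 h2), sub_zero, zero_mul]
    · have h1 : i < levelDim L a l := hi'.trans_le (hmono h)
      have h2 : i < levelDim L a (l + 1) := h1.trans_le (hmono (Nat.le_succ l))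
      rw [if_pos h1, if_pos h2, sub_self, zero_mul]
  · exact fun h => absurd (Finset.mem_range.2 hk) h

/-- Beyond the last level the algorithm returns zero, and the error is the integral of the feature.
-/
theorem sqErr_multilevel_le {α : ℕ} (hα : 1 ≤ α) (c : I) (L : ℕ) {a : ℝ} (ha : 1 ≤ a) {M : ℕ}
    (R : ℕ → PolyLatticeRule b) {i : ℕ} (hi : levelDim L a M ≤ i) {v : Finset ℕ}
    (hv : v ⊆ Finset.range i) :
    sqErr α (multilevel c L a M R) (insert i v) ≤ (α : ℝ) ^ (insert i v).card := by
  have := isProbabilityMeasure_featMeasure hα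
  have hmono := levelDim_monotone L ha
  have h : ∀ ω, errFun (multilevel c L a M R) (prodFeat α c (insert i v) ω) ^ 2 ≤
      (α : ℝ) ^ (insert i v).card := fun ω => by
    rw [errFun_multilevel, if_neg (by simp), zero_add, Finset.sum_eq_zero, sub_zero, ← sq_abs,
      Finset.abs_prod]
    · refine (pow_le_pow_left₀ (Finset.prod_nonneg fun _ _ => abs_nonneg _)
        (Finset.prod_le_prod (fun _ _ => abs_nonneg _)
          fun j _ => abs_integral_feat_le α c (ω j)) 2).trans_eq ?_
      rw [Finset.prod_const, ← pow_mul, mul_comm, pow_mul, Real.sq_sqrt (Nat.cast_nonneg α)]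
    · intro k hk
      have hk := Finset.mem_range.1 hk
      have h1 : levelDim L a (k + 1) ≤ i := (hmono hk).trans hi
      have h2 : levelDim L a k ≤ i := (hmono hk.le).trans hi
      simp only [insert_subset_range_iff hv]
      rw [if_neg (not_lt.2 h1), if_neg (not_lt.2 h2), sub_zero, zero_mul]
  refine (integral_mono_of_nonneg (ae_of_all _ fun ω => sq_nonneg _) (integrable_const _)
    (ae_of_all _ h)).trans_eq ?_
  simp

theorem sum_range_levelDim (L : ℕ) {a : ℝ} (ha : 1 ≤ a) (f : ℕ → ℝ) (M : ℕ) :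
    ∑ i ∈ Finset.range (levelDim L a M), f i =
      ∑ k ∈ Finset.range M, ∑ i ∈ Finset.Ico (levelDim L a k) (levelDim L a (k + 1)), f i := by
  induction M with
  | zero => simp [levelDim]
  | succ M ih =>
    rw [Finset.sum_range_succ, ← ih, Finset.sum_range_add_sum_Ico _
      (levelDim_monotone L ha (Nat.le_succ M))]

/-- The squared error of a multilevel algorithm, split into the errors on the levels and the
truncation error. -/
theorem tsum_sqErr_multilevel_le {α : ℕ} (hα : 1 ≤ α) (c : I) {γ : Finset ℕ → ℝ≥0}
    (L : ℕ) {a : ℝ} (ha : 1 ≤ a) {M : ℕ}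
    (R : ℕ → PolyLatticeRule b) {E T : ℝ}
    (hE : ∑ k ∈ Finset.range M, ∑ i ∈ Finset.Ico (levelDim L a k) (levelDim L a (k + 1)),
      ∑ v ∈ (Finset.range i).powerset, (γ (insert i v) : ℝ) * ruleSqErr α c (R k) (insert i v) ≤ E)
    (hT : ∀ l, ∑ i ∈ Finset.Ico (levelDim L a M) l, ∑ v ∈ (Finset.range i).powerset,
      (γ (insert i v) : ℝ) * (α : ℝ) ^ (insert i v).card ≤ T) :
    ∑' u, (γ u : ℝ) * sqErr α (multilevel c L a M R) u ≤ E + T := by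
  set Q := multilevel c L a M R with hQ
  have hnn : ∀ u, 0 ≤ (γ u : ℝ) * sqErr α Q u := fun u =>
    mul_nonneg (γ u).2 (sqErr_nonneg α Q u)
  refine tsum_le_of_sum_powerset_le hnn fun l => ?_
  have h1 : ∑ u ∈ (Finset.range l).powerset, (γ u : ℝ) * sqErr α Q u ≤
      ∑ u ∈ (Finset.range (max l (levelDim L a M))).powerset, (γ u : ℝ) * sqErr α Q u :=
    Finset.sum_le_sum_of_subset_of_nonneg (Finset.powerset_mono.2
      (Finset.range_subset_range.2 (le_max_left _ _))) fun u _ _ => hnn u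
  refine h1.trans ?_
  rw [sum_powerset_range, hQ, sqErr_multilevel_empty, mul_zero, zero_add,
    ← Finset.sum_range_add_sum_Ico _ (le_max_right l (levelDim L a M)), sum_range_levelDim L ha]
  refine add_le_add (le_trans (le_of_eq ?_) hE) (le_trans (Finset.sum_le_sum fun i hi =>
    Finset.sum_le_sum fun v hv => ?_) (hT (max l (levelDim L a M))))
  · refine Finset.sum_congr rfl fun k hk => Finset.sum_congr rfl fun i hi =>
      Finset.sum_congr rfl fun v hv => ?_
    have hi := Finset.mem_Ico.1 hi
    rw [sqErr_multilevel_of_mem c L ha R (Finset.mem_range.1 hk) hi.1 hi.2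
      (Finset.mem_powerset.1 hv)]
  · exact mul_le_mul_of_nonneg_left (sqErr_multilevel_le hα c L ha R (Finset.mem_Ico.1 hi).1
      (Finset.mem_powerset.1 hv)) (γ _).2

theorem strictMono_range : StrictMono Finset.range := fun _ _ hij =>
  ⟨Finset.range_mono hij.le, fun h => absurd (Finset.range_subset_range.1 h) (not_le.2 hij)⟩

theorem pointCost_anchoredPoint_le {c : I} (cost : ℕ → ℝ) (l : ℕ) (x : ℕ → I) :
    pointCost cost Finset.range (anchoredPoint c (Finset.range l) x) ≤ ENNReal.ofReal (cost l) := by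
  refine (iInf₂_le l fun j hj => ?_).trans_eq (by rw [Finset.card_range])
  simp only [anchoredPoint, if_neg hj]

/-- The initial segments of `ℕ` are an admissible nested sequence and contain all the level sets
exactly. -/
theorem nestedCost_multilevel_le {c : I} {cost : ℕ → ℝ} (h1 : ∀ k, 1 ≤ cost k)
    (hmono : Monotone cost) (L : ℕ) {a : ℝ} (ha : 1 ≤ a) (M : ℕ) (R : ℕ → PolyLatticeRule b) :
    nestedCost cost (multilevel c L a M R) ≤ ENNReal.ofReal (cost 0 +
      ∑ k ∈ Finset.range M, (b : ℝ) ^ (R k).m * (2 * cost (levelDim L a (k + 1)))) := by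
  have h0 : ∀ k, 0 ≤ cost k := fun k => zero_le_one.trans (h1 k)
  refine (iInf₂_le Finset.range strictMono_range).trans ?_
  rw [sum_map_multilevel, ENNReal.ofReal_add (h0 0) (Finset.sum_nonneg fun k _ =>
    mul_nonneg (by positivity) (mul_nonneg zero_le_two (h0 _))),
    ENNReal.ofReal_sum_of_nonneg fun k _ =>
      mul_nonneg (by positivity) (mul_nonneg zero_le_two (h0 _))]
  refine add_le_add ?_ (Finset.sum_le_sum fun k _ => ?_)
  · have := pointCost_anchoredPoint_le (c := c) cost 0 fun _ => c
    rwa [Finset.range_zero] at this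
  · refine (Finset.sum_le_card_nsmul _ _ (ENNReal.ofReal (2 * cost (levelDim L a (k + 1))))
      fun h _ => ?_).trans_eq ?_
    · rw [two_mul, ENNReal.ofReal_add (h0 _) (h0 _)]
      refine add_le_add (pointCost_anchoredPoint_le cost _ _)
        ((pointCost_anchoredPoint_le cost _ _).trans (ENNReal.ofReal_le_ofReal ?_))
      exact hmono (levelDim_monotone L ha (Nat.le_succ k))
    · rw [Finset.card_range, nsmul_eq_mul, Nat.cast_pow,
        ENNReal.ofReal_mul (p := (b : ℝ) ^ (R k).m) (by positivity),
        ENNReal.ofReal_pow (Nat.cast_nonneg b), ENNReal.ofReal_natCast]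

end Multilevel

/-! ### Tails of the weights -/

/-- A mean value estimate for `x^{-D}`, which lets the tail sums telescope. -/
theorem mul_rpow_neg_le_sub {D x : ℝ} (hD : 0 < D) (hx : 0 < x) :
    D * (x + 1) ^ (-(D + 1)) ≤ x ^ (-D) - (x + 1) ^ (-D) := by
  have hx1 : 0 < x + 1 := by linarith
  have h1 : (x + 1) ^ (-(D + 1)) = (x + 1) ^ (-D) * (x + 1)⁻¹ := by
    rw [neg_add, Real.rpow_add hx1, Real.rpow_neg_one]
  have h2 : x ^ (-D) = (x + 1) ^ (-D) * (x / (x + 1)) ^ (-D) := by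
    rw [← Real.mul_rpow hx1.le (by positivity), mul_div_cancel₀ _ hx1.ne']
  have h3 : 1 + D * (x + 1)⁻¹ ≤ (x / (x + 1)) ^ (-D) := by
    have hy : 0 < x / (x + 1) := by positivity
    rw [Real.rpow_def_of_pos hy]
    have h4 := Real.log_le_sub_one_of_pos hy
    have h5 := Real.add_one_le_exp (Real.log (x / (x + 1)) * -D)
    have h6 : x / (x + 1) - 1 = -(x + 1)⁻¹ := by
      field_simp
      ring
    rw [h6] at h4
    nlinarith
  rw [h1, h2]
  have h7 : 0 < (x + 1) ^ (-D) := Real.rpow_pos_of_pos hx1 _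
  nlinarith

theorem sum_Ico_rpow_neg_le {D : ℝ} (hD : 0 < D) {n : ℕ} (hn : 1 ≤ n) (l : ℕ) :
    ∑ i ∈ Finset.Ico n l, ((i : ℝ) + 1) ^ (-(D + 1)) ≤ D⁻¹ * (n : ℝ) ^ (-D) := by
  have hn0 : (0 : ℝ) < n := by exact_mod_cast hn
  rcases le_or_gt l n with h | h
  · rw [Finset.Ico_eq_empty_of_le h, Finset.sum_empty]
    positivity
  have key : ∑ i ∈ Finset.Ico n l, ((i : ℝ) + 1) ^ (-(D + 1)) ≤
      D⁻¹ * ((n : ℝ) ^ (-D) - (l : ℝ) ^ (-D)) := by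
    induction l, h.le using Nat.le_induction with
    | base => simp
    | succ l hl ih =>
      have hl0 : (0 : ℝ) < l := by exact_mod_cast (by omega : 0 < l)
      rcases hl.eq_or_lt with rfl | hl'
      · rw [Finset.sum_Ico_succ_top le_rfl, Finset.Ico_self, Finset.sum_empty, zero_add,
          le_inv_mul_iff₀ hD, Nat.cast_add_one]
        exact mul_rpow_neg_le_sub hD hl0
      · rw [Finset.sum_Ico_succ_top hl]
        have h1 : ((l : ℝ) + 1) ^ (-(D + 1)) ≤ D⁻¹ * ((l : ℝ) ^ (-D) - ((l : ℝ) + 1) ^ (-D)) := by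
          rw [le_inv_mul_iff₀ hD]
          exact mul_rpow_neg_le_sub hD hl0
        have h2 := ih hl'
        rw [Nat.cast_add_one]
        calc _ ≤ D⁻¹ * ((n : ℝ) ^ (-D) - (l : ℝ) ^ (-D)) +
              D⁻¹ * ((l : ℝ) ^ (-D) - ((l : ℝ) + 1) ^ (-D)) := add_le_add h2 h1
          _ = _ := by ring
  refine key.trans (mul_le_mul_of_nonneg_left ?_ (by positivity))
  linarith [Real.rpow_nonneg (Nat.cast_nonneg (α := ℝ) l) (-D)]

/-- The dimensions satisfy `L_{k+1} ≥ a^k`; replacing `a^k` by `a^{k+1}` costs the factor `a^{d-1}`.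
The first level starts at `0` and is treated as a full sum. -/
theorem exists_sum_Ico_levelDim_le {d Cγ : ℝ} (hd : 1 < d) {γ : ℕ → ℝ≥0}
    (hγ : ∀ j : ℕ, (γ j : ℝ) ≤ Cγ * ((j : ℝ) + 1) ^ (-d)) {L : ℕ} (hL : 1 ≤ L) {a : ℝ} (ha : 1 < a) :
    ∃ C : ℝ, 0 ≤ C ∧ ∀ k l, ∑ i ∈ Finset.Ico (levelDim L a k) l, (γ i : ℝ) ≤
      C * (a ^ k) ^ (-(d - 1)) := by
  have hCγ : 0 ≤ Cγ := by simpa using (NNReal.coe_nonneg (γ 0)).trans (hγ 0)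
  have ha0 : 0 < a := by linarith
  set D := d - 1 with hD
  have hD0 : 0 < D := by linarith
  have hdD : -d = -(D + 1) := by rw [hD]; ring
  rw [hdD] at hγ
  have hpos : ∀ k l, 1 ≤ k → ∑ i ∈ Finset.Ico k l, (γ i : ℝ) ≤ Cγ * (D⁻¹ * (k : ℝ) ^ (-D)) :=
    fun k l hk => by
    refine (Finset.sum_le_sum fun i _ => hγ i).trans ?_
    rw [← Finset.mul_sum]
    exact mul_le_mul_of_nonneg_left (sum_Ico_rpow_neg_le hD0 hk l) hCγ
  have haD : 1 ≤ a ^ D := Real.one_le_rpow ha.le hD0.le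
  refine ⟨Cγ * (1 + D⁻¹ * a ^ D), by positivity, fun k l => ?_⟩
  cases k with
  | zero =>
    rw [pow_zero, Real.one_rpow, mul_one, levelDim]
    have h1 : ∑ i ∈ Finset.Ico 0 l, (γ i : ℝ) ≤ γ 0 + ∑ i ∈ Finset.Ico 1 l, (γ i : ℝ) := by
      rcases Nat.eq_zero_or_pos l with rfl | hl
      · simp
      · rw [Finset.sum_eq_sum_Ico_succ_bot hl]
    have h2 := hpos 1 l le_rfl
    have h3 := hγ 0
    simp only [Nat.cast_one, Real.one_rpow, mul_one, Nat.cast_zero, zero_add] at h2 h3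
    have h4 : D⁻¹ ≤ D⁻¹ * a ^ D := le_mul_of_one_le_right (by positivity) haD
    nlinarith
  | succ k =>
    have hLk : a ^ k ≤ (levelDim L a (k + 1) : ℝ) := by
      rw [levelDim, Nat.cast_mul]
      have h1 := Nat.le_ceil (a ^ k)
      have h2 : (1 : ℝ) ≤ L := by exact_mod_cast hL
      nlinarith [Nat.cast_nonneg (α := ℝ) ⌈a ^ k⌉₊]
    have h1 : 1 ≤ levelDim L a (k + 1) := by
      have : (0 : ℝ) < levelDim L a (k + 1) := lt_of_lt_of_le (by positivity) hLk
      exact_mod_cast this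
    refine (hpos _ l h1).trans ?_
    rw [mul_assoc]
    refine mul_le_mul_of_nonneg_left ?_ hCγ
    have h2 : (levelDim L a (k + 1) : ℝ) ^ (-D) ≤ (a ^ k) ^ (-D) :=
      Real.rpow_le_rpow_of_nonpos (by positivity) hLk (by linarith)
    have h3 : (a ^ (k + 1)) ^ (-D) = (a ^ k) ^ (-D) * (a ^ D)⁻¹ := by
      rw [pow_succ, Real.mul_rpow (by positivity) ha0.le, Real.rpow_neg ha0.le]
    rw [h3]
    have h4 : 0 < (a ^ k) ^ (-D) := by positivity
    calc D⁻¹ * (levelDim L a (k + 1) : ℝ) ^ (-D) ≤ D⁻¹ * (a ^ k) ^ (-D) :=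
          mul_le_mul_of_nonneg_left h2 (by positivity)
      _ = D⁻¹ * a ^ D * ((a ^ k) ^ (-D) * (a ^ D)⁻¹) := by field_simp
      _ ≤ _ := mul_le_mul_of_nonneg_right (by linarith) (by positivity)

end

noncomputable section

/-! ### Choice of the parameters of the multilevel algorithms -/

theorem exists_sum_powerset_insert_le (α : ℕ) {q d Cγ CΓ : ℝ} (hq : 0 ≤ q)
    (hqd : q < d) (hd : 1 < d) {Γ γ : ℕ → ℝ≥0}
    (hγ : ∀ j : ℕ, (γ j : ℝ) ≤ Cγ * ((j : ℝ) + 1) ^ (-d)) (hCΓ : 0 ≤ CΓ)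
    (hΓ : ∀ u, (podWeights Γ γ u : ℝ) ≤ CΓ * podProd q (fun j => (γ j : ℝ)) u) :
    ∃ C : ℝ, 0 ≤ C ∧ ∀ J : Finset ℕ, ∑ i ∈ J, ∑ v ∈ (Finset.range i).powerset,
      (podWeights Γ γ (insert i v) : ℝ) * (α : ℝ) ^ (insert i v).card ≤
        C * ∑ i ∈ J, (γ i : ℝ) := by
  obtain ⟨C, hC⟩ := exists_sum_podProd_rpow_le hq hqd hγ one_pos (by rwa [one_mul])
    (c := 2 ^ q * α) (by positivity)
  simp only [Real.rpow_one] at hC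
  have hC0 : 0 ≤ C := (Finset.sum_nonneg fun v _ =>
    podProd_nonneg (fun j => by positivity) v).trans (hC 0)
  refine ⟨CΓ * (α * C), by positivity, fun J => ?_⟩
  rw [Finset.mul_sum]
  refine Finset.sum_le_sum fun i _ => ?_
  have h1 : ∀ v ∈ (Finset.range i).powerset,
      (podWeights Γ γ (insert i v) : ℝ) * (α : ℝ) ^ (insert i v).card ≤
        CΓ * (α * γ i) * podProd q (fun j => 2 ^ q * α * (γ j : ℝ)) v := fun v hv => by
    have hiv : i ∉ v := fun h => by simpa using Finset.mem_powerset.1 hv h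
    calc (podWeights Γ γ (insert i v) : ℝ) * (α : ℝ) ^ (insert i v).card
        ≤ CΓ * podProd q (fun j => (γ j : ℝ)) (insert i v) * (α : ℝ) ^ (insert i v).card :=
          mul_le_mul_of_nonneg_right (hΓ _) (by positivity)
      _ = CΓ * podProd q (fun j => (α : ℝ) * γ j) (insert i v) := by
          rw [← pow_card_mul_podProd]
          ring
      _ ≤ CΓ * (α * γ i * podProd q (fun j => 2 ^ q * ((α : ℝ) * γ j)) v) :=
          mul_le_mul_of_nonneg_left
            (podProd_insert_le (a := fun j => (α : ℝ) * γ j) hq (fun j => by positivity) hiv) hCΓ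
      _ = _ := by simp only [mul_assoc]
  refine (Finset.sum_le_sum h1).trans ?_
  rw [← Finset.mul_sum]
  refine (mul_le_mul_of_nonneg_left (hC i) (by positivity)).trans_eq ?_
  ring

theorem summable_podWeights_mul_pow (α : ℕ) {q d Cγ CΓ : ℝ} (hq : 0 ≤ q)
    (hqd : q < d) (hd : 1 < d) {Γ γ : ℕ → ℝ≥0}
    (hγ : ∀ j : ℕ, (γ j : ℝ) ≤ Cγ * ((j : ℝ) + 1) ^ (-d)) (hCΓ : 0 ≤ CΓ)
    (hΓ : ∀ u, (podWeights Γ γ u : ℝ) ≤ CΓ * podProd q (fun j => (γ j : ℝ)) u) :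
    Summable fun u => (podWeights Γ γ u : ℝ) * (α : ℝ) ^ u.card := by
  obtain ⟨C, hC⟩ := exists_sum_podProd_rpow_le hq hqd hγ one_pos (by rwa [one_mul])
    (c := α) (by positivity)
  simp only [Real.rpow_one] at hC
  refine summable_of_sum_powerset_le (C := CΓ * C) (fun u => by positivity) fun L => ?_
  refine (Finset.sum_le_sum fun u _ => ?_).trans
    ((Finset.mul_sum _ _ _).symm.trans_le (mul_le_mul_of_nonneg_left (hC L) hCΓ))
  refine (mul_le_mul_of_nonneg_right (hΓ u) (by positivity)).trans_eq ?_
  rw [← pow_card_mul_podProd]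
  ring

theorem geom_sum_le_of_one_lt {r : ℝ} (hr : 1 < r) (n : ℕ) :
    ∑ k ∈ Finset.range (n + 1), r ^ k ≤ r / (r - 1) * r ^ n := by
  have h : 0 < r - 1 := by linarith
  rw [geom_sum_eq hr.ne', div_mul_eq_mul_div, pow_succ']
  exact div_le_div_of_nonneg_right (by linarith) h.le

theorem geom_sum_le_of_lt_one {r : ℝ} (h0 : 0 ≤ r) (hr : r < 1) (n : ℕ) :
    ∑ k ∈ Finset.range n, r ^ k ≤ (1 - r)⁻¹ := by
  rw [← tsum_geometric_of_lt_one h0 hr]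
  exact (summable_geometric_of_lt_one h0 hr).sum_le_tsum _ fun k _ => pow_nonneg h0 k

/-- The numbers of points `b ^ m k` on the levels, balancing the squared error and the cost. -/
theorem exists_level_parameters {a D p τ s b : ℝ} (ha : 1 < a) (hD : 0 < D)
    (hτ : 1 < p * τ) (hτ0 : 0 < τ) (hs : 2 * s < p * D) (hb : 1 < b) :
    ∃ C : ℝ, 0 ≤ C ∧ ∀ ε : ℝ, 0 < ε → ε ≤ 1 → ∃ (M : ℕ) (m : ℕ → ℕ), Antitone m ∧
      (∀ k, 1 ≤ m k) ∧ (a ^ M) ^ (-D) ≤ ε ^ 2 ∧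
      ∑ k ∈ Finset.range M, (b ^ m k) ^ (-(2 * τ)) * (a ^ k) ^ (-D) ≤ C * ε ^ 2 ∧
      ∑ k ∈ Finset.range M, b ^ m k * (a ^ k) ^ s ≤ C * ε ^ (-p) := by
  have ha0 : 0 < a := by linarith
  have hb0 : 0 < b := by linarith
  have hp : 0 < p := by
    by_contra h
    nlinarith
  -- The level sizes are about `(X / a^k)^ρ` with `X = ε^{-2/D}`, so that `X^{-D} = ε²` is the
  -- truncation target and `X^ρ = ε^{-p}` the permitted cost.
  set ρ := p * D / 2 with hρ
  have hρ0 : 0 < ρ := by positivity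
  -- The squared errors grow geometrically like `a^{χk}`, as `pτ > 1`, so the last level dominates;
  -- the costs decay like `a^{(s-ρ)k}`, as `2s < pD`, so the first level dominates.
  set χ := 2 * τ * ρ - D with hχ
  have hχ0 : 0 < χ := by
    have : χ = D * (p * τ - 1) := by rw [hχ, hρ]; ring
    rw [this]
    exact mul_pos hD (by linarith)
  have hr : 1 < a ^ χ := Real.one_lt_rpow ha hχ0
  have hr' : a ^ (s - ρ) < 1 := Real.rpow_lt_one_of_one_lt_of_neg ha (by rw [hρ]; linarith)
  set A := a ^ χ / (a ^ χ - 1) with hA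
  set B := b * (1 - a ^ (s - ρ))⁻¹ with hB
  have hA0 : 0 ≤ A := div_nonneg (by linarith) (by linarith)
  have hB0 : 0 ≤ B := mul_nonneg hb0.le (inv_nonneg.2 (by linarith))
  refine ⟨A + B, by positivity, fun ε hε hε1 => ?_⟩
  set X := ε ^ (-2 / D) with hX
  have hX1 : 1 ≤ X := Real.one_le_rpow_of_pos_of_le_one_of_nonpos hε hε1
    (div_nonpos_of_nonpos_of_nonneg (by norm_num) hD.le)
  have hX0 : 0 < X := by linarith
  have hXD : X ^ (-D) = ε ^ 2 := by
    rw [hX, ← Real.rpow_mul hε.le, ← Real.rpow_natCast]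
    congr 1
    push_cast
    field_simp
  have hXρ : X ^ ρ = ε ^ (-p) := by
    rw [hX, ← Real.rpow_mul hε.le, hρ]
    congr 1
    field_simp
  obtain ⟨n, hn, hn'⟩ := exists_nat_pow_near hX1 ha
  -- Rounding to powers of `b`; the maximum with `1` keeps this possible and monotone for all `k`,
  -- and the exponent `m k + 1` used below rounds up and is at least `1`.
  have hy : ∀ k : ℕ, ∃ l : ℕ, b ^ l ≤ max ((X / a ^ k) ^ ρ) 1 ∧
      max ((X / a ^ k) ^ ρ) 1 < b ^ (l + 1) := fun k => exists_nat_pow_near (le_max_right _ _) hb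
  choose m hm hm' using hy
  have hmax : ∀ k ∈ Finset.range (n + 1), max ((X / a ^ k) ^ ρ) 1 = (X / a ^ k) ^ ρ :=
    fun k hk => by
    refine max_eq_left (Real.one_le_rpow ?_ hρ0.le)
    rw [one_le_div (by positivity)]
    exact (pow_le_pow_right₀ ha.le (Nat.lt_succ_iff.1 (Finset.mem_range.1 hk))).trans hn
  have hpow : ∀ (e : ℝ) (k : ℕ), (a ^ k) ^ e = (a ^ e) ^ k := fun e k => by
    rw [← Real.rpow_natCast, ← Real.rpow_mul ha0.le, mul_comm, Real.rpow_mul ha0.le,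
      Real.rpow_natCast]
  refine ⟨n + 1, fun k => m k + 1, ?_, fun k => Nat.le_add_left 1 _, ?_, ?_, ?_⟩
  · intro k l hkl
    have h1 : max ((X / a ^ l) ^ ρ) 1 ≤ max ((X / a ^ k) ^ ρ) 1 := by
      refine max_le_max (Real.rpow_le_rpow (by positivity) ?_ hρ0.le) le_rfl
      exact div_le_div_of_nonneg_left hX0.le (by positivity) (pow_le_pow_right₀ ha.le hkl)
    exact (pow_lt_pow_iff_right₀ hb).1 ((hm l).trans_lt (h1.trans_lt (hm' k)))
  · rw [← hXD]
    exact Real.rpow_le_rpow_of_nonpos hX0 hn'.le (by linarith)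
  · have h1 : ∀ k ∈ Finset.range (n + 1), (b ^ (m k + 1)) ^ (-(2 * τ)) * (a ^ k) ^ (-D) ≤
        X ^ (-(2 * τ * ρ)) * (a ^ χ) ^ k := fun k hk => by
      have hak : 0 < a ^ k := by positivity
      have h2 : (b ^ (m k + 1)) ^ (-(2 * τ)) ≤ ((X / a ^ k) ^ ρ) ^ (-(2 * τ)) :=
        Real.rpow_le_rpow_of_nonpos (by positivity) ((hmax k hk).symm.trans_le (hm' k).le)
          (by linarith)
      refine (mul_le_mul_of_nonneg_right h2 (by positivity)).trans_eq ?_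
      rw [← hpow, ← Real.rpow_mul (by positivity), Real.div_rpow hX0.le hak.le,
        div_eq_mul_inv, ← Real.rpow_neg hak.le, mul_assoc, ← Real.rpow_add hak, hχ]
      congr 2 <;> ring
    refine (Finset.sum_le_sum h1).trans ?_
    rw [← Finset.mul_sum]
    have h2 : (a ^ χ) ^ n ≤ X ^ χ := by
      rw [← hpow]
      exact Real.rpow_le_rpow (by positivity) hn hχ0.le
    calc X ^ (-(2 * τ * ρ)) * ∑ k ∈ Finset.range (n + 1), (a ^ χ) ^ k
        ≤ X ^ (-(2 * τ * ρ)) * (A * X ^ χ) := mul_le_mul_of_nonneg_left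
          ((geom_sum_le_of_one_lt hr n).trans (mul_le_mul_of_nonneg_left h2 hA0)) (by positivity)
      _ = A * X ^ (-D) := by
          rw [mul_left_comm, ← Real.rpow_add hX0, hχ]
          congr 2
          ring
      _ = A * ε ^ 2 := by rw [hXD]
      _ ≤ _ := mul_le_mul_of_nonneg_right (by linarith) (by positivity)
  · have h1 : ∀ k ∈ Finset.range (n + 1), b ^ (m k + 1) * (a ^ k) ^ s ≤
        b * X ^ ρ * (a ^ (s - ρ)) ^ k := fun k hk => by
      have hak : 0 < a ^ k := by positivity
      have h2 : b ^ (m k + 1) ≤ b * (X / a ^ k) ^ ρ := by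
        rw [pow_succ']
        exact mul_le_mul_of_nonneg_left ((hm k).trans_eq (hmax k hk)) hb0.le
      refine (mul_le_mul_of_nonneg_right h2 (by positivity)).trans_eq ?_
      rw [← hpow, Real.div_rpow hX0.le hak.le, Real.rpow_sub hak]
      ring
    refine (Finset.sum_le_sum h1).trans ?_
    rw [← Finset.mul_sum, ← hXρ]
    calc b * X ^ ρ * ∑ k ∈ Finset.range (n + 1), (a ^ (s - ρ)) ^ k
        ≤ b * X ^ ρ * (1 - a ^ (s - ρ))⁻¹ := mul_le_mul_of_nonneg_left
          (geom_sum_le_of_lt_one (by positivity) hr' _) (by positivity)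
      _ = B * X ^ ρ := by rw [hB]; ring
      _ ≤ _ := mul_le_mul_of_nonneg_right (by linarith) (by positivity)

theorem levelDim_succ_add_one_le (L : ℕ) {a : ℝ} (ha : 1 ≤ a) (k : ℕ) :
    (levelDim L a (k + 1) : ℝ) + 1 ≤ (2 * L + 1) * a ^ k := by
  have h1 : 1 ≤ a ^ k := one_le_pow₀ ha
  have h2 := (Nat.ceil_lt_add_one (by linarith : 0 ≤ a ^ k)).le
  have h3 := mul_le_mul_of_nonneg_left h2 (Nat.cast_nonneg (α := ℝ) L)
  rw [levelDim, Nat.cast_mul]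
  nlinarith [Nat.cast_nonneg (α := ℝ) L]

/-- The conditions on `p` say that some rate `τ` with `1/p < τ < min(α, d/2)` is available and that
the cost of high levels is affordable. Level errors and truncation error are then both `O(ε²)` after
squaring. -/
theorem exists_multilevel_le (b : ℕ) [Fact b.Prime] {α : ℕ} (hα : 1 ≤ α) (c : I)
    {cost : ℕ → ℝ} (h1 : ∀ k, 1 ≤ cost k) (hmono : Monotone cost) {s : ℝ} (hs : 0 ≤ s)
    (hcost : Asymptotics.IsTheta atTop cost fun k : ℕ => (k : ℝ) ^ s)
    {q d Cγ CΓ : ℝ} (hq : 0 ≤ q) (hqd : q < d) (hd : 1 < d) {Γ γ : ℕ → ℝ≥0}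
    (hγ : ∀ j : ℕ, (γ j : ℝ) ≤ Cγ * ((j : ℝ) + 1) ^ (-d)) (hCΓ : 0 ≤ CΓ)
    (hΓ : ∀ u, (podWeights Γ γ u : ℝ) ≤ CΓ * podProd q (fun j => (γ j : ℝ)) u)
    {L : ℕ} (hL : 1 ≤ L) {a : ℝ} (ha : 1 < a) {p : ℝ} (hp : 0 < p) (hpα : 1 < p * α)
    (hpd : 2 < p * d) (hps : 2 * s < p * (d - 1)) :
    ∃ C : ℝ, ∀ ε : ℝ, 0 < ε → ε ≤ 1 → ∃ Q : Algorithm c, IsQMCMultilevel b α c L a Q ∧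
      worstCaseError α (podWeights Γ γ) Q ≤ ENNReal.ofReal ε ∧
      nestedCost cost Q ≤ ENNReal.ofReal (C * ε ^ (-p)) := by
  have hα' : (1 : ℝ) ≤ α := by exact_mod_cast hα
  have hb1 : (1 : ℝ) < b := by exact_mod_cast (Fact.out : b.Prime).one_lt
  obtain ⟨τ, hτl, hτu⟩ : ∃ τ, max (1 / 2) (1 / p) < τ ∧ τ < min (α : ℝ) (d / 2) := by
    refine exists_between (max_lt (lt_min (by linarith) (by linarith)) (lt_min ?_ ?_))
    · rw [div_lt_iff₀ hp]; linarith
    · rw [div_lt_iff₀ hp]; linarith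
  obtain ⟨hτ2, hτp⟩ := max_lt_iff.1 hτl
  obtain ⟨hτα, hτd⟩ := lt_min_iff.1 hτu
  rw [div_lt_iff₀ hp] at hτp
  obtain ⟨C₁, hC₁, hrule⟩ := exists_rule_le b hα c hq hqd hd hγ hCΓ hΓ hτ2.le hτα
    (by linarith : 2 * τ < d)
  obtain ⟨C₂, hC₂, htail⟩ := exists_sum_powerset_insert_le α hq hqd hd hγ hCΓ hΓ
  obtain ⟨C₃, hC₃, hlevel⟩ := exists_sum_Ico_levelDim_le hd hγ hL ha
  obtain ⟨C₄, hC₄, hpar⟩ := exists_level_parameters (τ := τ) ha (by linarith : 0 < d - 1)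
    (by linarith : 1 < p * τ) (by linarith) hps hb1
  obtain ⟨C₅, hC₅, hcost'⟩ := exists_cost_le hmono hs hcost
  have hsum := summable_podWeights_mul_pow α hq hqd hd hγ hCΓ hΓ
  set A := C₁ * C₃ * C₄ + C₂ * C₃ with hA
  have hA0 : 0 ≤ A := by positivity
  -- The construction is run with `ε₀ / B`, which turns the error bound `√A · ε` into `ε₀` and costs
  -- only the factor `B^p`.
  set B := max 1 √A with hB
  have hB1 : 1 ≤ B := le_max_left _ _
  set G := cost 0 + 2 * (C₅ * (2 * L + 1) ^ s) * C₄ with hG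
  have hcost0 : 0 ≤ cost 0 := zero_le_one.trans (h1 0)
  refine ⟨G * B ^ p, fun ε₀ hε₀ hε₀1 => ?_⟩
  set ε := ε₀ / B with hε_def
  have hε : 0 < ε := by positivity
  have hε1 : ε ≤ 1 := div_le_one_of_le₀ (hε₀1.trans hB1) (by positivity)
  obtain ⟨M, m, hm, hm1, hM, herr, hcst⟩ := hpar ε hε hε1
  have hR := fun k => hrule (m k) (hm1 k) (levelDim L a (k + 1))
    (Finset.Ico (levelDim L a k) (levelDim L a (k + 1)))
    (fun i hi => Finset.mem_range.2 (Finset.mem_Ico.1 hi).2)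
  choose R hRm hRs hRe using hR
  refine ⟨multilevel c L a M R, ⟨M, R, fun k _ => hRs k, fun k _ => ?_, rfl⟩, ?_, ?_⟩
  · rw [hRm, hRm]
    exact hm (Nat.le_succ k)
  · rw [worstCaseError_eq hα hsum]
    refine ENNReal.ofReal_le_ofReal ?_
    have hE : ∑ k ∈ Finset.range M, ∑ i ∈ Finset.Ico (levelDim L a k) (levelDim L a (k + 1)),
        ∑ v ∈ (Finset.range i).powerset, (podWeights Γ γ (insert i v) : ℝ) *
          ruleSqErr α c (R k) (insert i v) ≤ C₁ * C₃ * C₄ * ε ^ 2 := by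
      have h2 : ∀ k ∈ Finset.range M, ∑ i ∈ Finset.Ico (levelDim L a k) (levelDim L a (k + 1)),
          ∑ v ∈ (Finset.range i).powerset, (podWeights Γ γ (insert i v) : ℝ) *
            ruleSqErr α c (R k) (insert i v) ≤
          C₁ * C₃ * (((b : ℝ) ^ m k) ^ (-(2 * τ)) * (a ^ k) ^ (-(d - 1))) := fun k _ => by
        refine (hRe k).trans ((mul_le_mul_of_nonneg_left (hlevel k _)
          (mul_nonneg hC₁ (by positivity))).trans_eq ?_)
        ring
      refine (Finset.sum_le_sum h2).trans ?_
      rw [← Finset.mul_sum, mul_assoc (C₁ * C₃)]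
      exact mul_le_mul_of_nonneg_left herr (by positivity)
    have hT : ∀ l, ∑ i ∈ Finset.Ico (levelDim L a M) l, ∑ v ∈ (Finset.range i).powerset,
        (podWeights Γ γ (insert i v) : ℝ) * (α : ℝ) ^ (insert i v).card ≤ C₂ * C₃ * ε ^ 2 :=
      fun l => by
      refine (htail _).trans ?_
      rw [mul_assoc]
      exact mul_le_mul_of_nonneg_left ((hlevel M l).trans (mul_le_mul_of_nonneg_left hM hC₃)) hC₂
    have h3 := tsum_sqErr_multilevel_le hα c L ha.le R hE hT
    rw [← add_mul, ← hA] at h3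
    refine (Real.sqrt_le_sqrt h3).trans ?_
    rw [Real.sqrt_mul hA0, Real.sqrt_sq hε.le, hε_def, mul_div_assoc', div_le_iff₀ (by positivity),
      mul_comm]
    exact mul_le_mul_of_nonneg_left (le_max_right _ _) hε₀.le
  · refine (nestedCost_multilevel_le h1 hmono L ha.le M R).trans (ENNReal.ofReal_le_ofReal ?_)
    have h2 : ∀ k ∈ Finset.range M, (b : ℝ) ^ (R k).m * (2 * cost (levelDim L a (k + 1))) ≤
        2 * (C₅ * (2 * L + 1) ^ s) * ((b : ℝ) ^ m k * (a ^ k) ^ s) := fun k _ => by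
      have hak : 0 < a ^ k := by positivity
      have h3 : cost (levelDim L a (k + 1)) ≤ C₅ * ((2 * L + 1) ^ s * (a ^ k) ^ s) := by
        rw [← Real.mul_rpow (by positivity) hak.le]
        exact (hcost' _).trans (mul_le_mul_of_nonneg_left (Real.rpow_le_rpow (by positivity)
          (levelDim_succ_add_one_le L ha.le k) hs) hC₅.le)
      rw [hRm]
      calc (b : ℝ) ^ m k * (2 * cost (levelDim L a (k + 1))) ≤
            (b : ℝ) ^ m k * (2 * (C₅ * ((2 * L + 1) ^ s * (a ^ k) ^ s))) :=
          mul_le_mul_of_nonneg_left (mul_le_mul_of_nonneg_left h3 zero_le_two) (by positivity)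
        _ = _ := by ring
    have hεp : 1 ≤ ε ^ (-p) :=
      Real.one_le_rpow_of_pos_of_le_one_of_nonpos hε hε1 (by linarith)
    have h4 : ε ^ (-p) = B ^ p * ε₀ ^ (-p) := by
      rw [hε_def, Real.div_rpow hε₀.le (by positivity), Real.rpow_neg (by positivity : 0 ≤ B),
        div_inv_eq_mul, mul_comm]
    calc cost 0 + ∑ k ∈ Finset.range M, (b : ℝ) ^ (R k).m * (2 * cost (levelDim L a (k + 1)))
        ≤ cost 0 * ε ^ (-p) + 2 * (C₅ * (2 * L + 1) ^ s) * (C₄ * ε ^ (-p)) := by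
          refine add_le_add (le_mul_of_one_le_right hcost0 hεp)
            ((Finset.sum_le_sum h2).trans ?_)
          rw [← Finset.mul_sum]
          exact mul_le_mul_of_nonneg_left hcst (by positivity)
      _ = G * B ^ p * ε₀ ^ (-p) := by
          rw [mul_assoc G, ← h4, hG]
          ring

end

noncomputable section

/-! ### The exponent of tractability -/

theorem nestedCost_nil {c : I} (cost : ℕ → ℝ) : nestedCost cost ([] : Algorithm c) = 0 := by
  exact le_antisymm ((iInf₂_le Finset.range strictMono_range).trans_eq (by simp)) zero_le

/-- Tractability asks for all `ε > 0`. Above the initial error the empty algorithm is free; between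
`1` and that error the algorithm for `ε = 1` serves, with an enlarged constant. -/
theorem tractableWith_of_forall_le_one {α : ℕ} (hα : 1 ≤ α) {c : I} {γ : Finset ℕ → ℝ≥0}
    (hsum : Summable fun u => (γ u : ℝ) * (α : ℝ) ^ u.card) {cost : ℕ → ℝ} {p : ℝ} (hp : 0 ≤ p)
    {C : ℝ} (h : ∀ ε : ℝ, 0 < ε → ε ≤ 1 → ∃ Q : Algorithm c,
      worstCaseError α γ Q ≤ ENNReal.ofReal ε ∧ nestedCost cost Q ≤ ENNReal.ofReal (C * ε ^ (-p))) :
    TractableWith α c γ cost p := by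
  set B := max 1 √(∑' u, (γ u : ℝ) * sqErr α ([] : Algorithm c) u) with hB
  have hB1 : 1 ≤ B := le_max_left _ _
  have hBp : 1 ≤ B ^ p := Real.one_le_rpow hB1 hp
  refine ⟨hp, max C 0 * B ^ p, by positivity, fun ε hε => ?_⟩
  rcases le_or_gt ε 1 with h1 | h1
  · obtain ⟨Q, hQ, hQ'⟩ := h ε hε h1
    refine (iInf₂_le Q hQ).trans (hQ'.trans (ENNReal.ofReal_le_ofReal ?_))
    refine mul_le_mul_of_nonneg_right ?_ (by positivity)
    exact (le_max_left _ _).trans (le_mul_of_one_le_right (le_max_right _ _) hBp)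
  rcases le_or_gt B ε with h2 | h2
  · refine (iInf₂_le [] ?_).trans ((nestedCost_nil cost).trans_le zero_le)
    rw [worstCaseError_eq hα hsum]
    exact ENNReal.ofReal_le_ofReal ((le_max_right _ _).trans h2)
  · obtain ⟨Q, hQ, hQ'⟩ := h 1 one_pos le_rfl
    refine (iInf₂_le Q (hQ.trans (ENNReal.ofReal_le_ofReal h1.le))).trans
      (hQ'.trans (ENNReal.ofReal_le_ofReal ?_))
    rw [Real.one_rpow, mul_one, mul_assoc]
    refine (le_max_left _ _).trans (le_mul_of_one_le_right (le_max_right _ _) ?_)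
    rw [Real.rpow_neg hε.le, ← div_eq_mul_inv, ← Real.div_rpow (by positivity) hε.le]
    exact Real.one_le_rpow ((one_le_div hε).2 h2.le) hp

theorem pos_of_podWeights_pos {Γ γ : ℕ → ℝ≥0} (hγ : Antitone γ)
    (h : ∃ u : Finset ℕ, u.Nonempty ∧ 0 < podWeights Γ γ u) : 0 < γ 0 := by
  obtain ⟨u, ⟨j, hj⟩, hu⟩ := h
  refine (pos_iff_ne_zero.2 fun h0 => hu.ne' ?_).trans_le (hγ (Nat.zero_le j))
  rw [podWeights, Finset.prod_eq_zero hj h0, mul_zero]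

/-! ### Rearranging `2s/(d-1)` in the extended reals, including `d = ⊤`. -/

section Exponents

variable {d : EReal} {s r : ℝ}

theorem two_mul_div_sub_one_nonneg (hs : 0 ≤ s) (hd : 1 < d) :
    0 ≤ ((2 * s : ℝ) : EReal) / (d - 1) := by
  refine EReal.div_nonneg (by exact_mod_cast (by positivity : (0 : ℝ) ≤ 2 * s)) ?_
  exact (EReal.sub_nonneg (.inr (EReal.coe_ne_top 1)) (.inr (EReal.coe_ne_bot 1))).2 hd.le

theorem one_add_two_mul_div_lt (hr : 0 < r) (hd : 1 < d)
    (h : ((2 * s : ℝ) : EReal) / (d - 1) < r) : ((1 + 2 * s / r : ℝ) : EReal) < d := by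
  induction d with
  | bot => simp at hd
  | top => exact EReal.coe_lt_top _
  | coe x =>
    have hx : 1 < x := by exact_mod_cast hd
    rw [← EReal.coe_one, ← EReal.coe_sub, ← EReal.coe_div, EReal.coe_lt_coe_iff,
      div_lt_iff₀ (by linarith)] at h
    rw [EReal.coe_lt_coe_iff]
    have : 2 * s / r < x - 1 := by
      rw [div_lt_iff₀ hr]
      linarith
    linarith

theorem two_mul_div_le (hr : 0 < r) (hd : 1 < d) (h : ((1 + 2 * s / r : ℝ) : EReal) ≤ d) :
    ((2 * s : ℝ) : EReal) / (d - 1) ≤ r := by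
  induction d with
  | bot => simp at hd
  | top =>
    rw [← EReal.coe_one, EReal.top_sub_coe, EReal.div_top]
    exact_mod_cast hr.le
  | coe x =>
    have hx : 1 < x := by exact_mod_cast hd
    have h' : 2 * s / r ≤ x - 1 := by
      rw [EReal.coe_le_coe_iff] at h
      linarith
    rw [div_le_iff₀ hr] at h'
    rw [← EReal.coe_one, ← EReal.coe_sub, ← EReal.coe_div, EReal.coe_le_coe_iff,
      div_le_iff₀ (by linarith)]
    linarith

end Exponents

/-- All requirements are strict inequalities against `d`, so a single real number below `d` meets
them all and serves as decay exponent, even for `d = ⊤`. A negative `q` is replaced by `0`. -/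
theorem exists_summable_and_multilevel {α : ℕ} (hα : 1 ≤ α) (c : I)
    {cost : ℕ → ℝ} (h1 : ∀ k, 1 ≤ cost k) (hmono : Monotone cost) {s : ℝ} (hs : 0 ≤ s)
    (hcost : Asymptotics.IsTheta atTop cost fun k : ℕ => (k : ℝ) ^ s)
    {Γ γ : ℕ → ℝ≥0} (hγ : Antitone γ) (hΓ0 : Γ 0 = 1) (hΓ1 : Γ 1 = 1)
    (hd1 : 1 < decay (sobKernel α c) (podWeights Γ γ) 1)
    {q : ℝ} (hq : (q : EReal) < decay (sobKernel α c) (podWeights Γ γ) 1)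
    (hΓ : ∃ C : ℝ, 0 < C ∧ ∀ k : ℕ, 1 ≤ k → (Γ k : ℝ) ≤ C * (k.factorial : ℝ) ^ q) :
    (Summable fun u => (podWeights Γ γ u : ℝ) * (α : ℝ) ^ u.card) ∧
    ∀ p : ℝ, 0 < p → 1 < p * α →
      ((2 / p : ℝ) : EReal) < decay (sobKernel α c) (podWeights Γ γ) 1 →
      ((1 + 2 * s / p : ℝ) : EReal) < decay (sobKernel α c) (podWeights Γ γ) 1 →
      ∀ (b : ℕ) [Fact b.Prime] (L : ℕ) (a : ℝ), 1 ≤ L → 1 < a →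
      ∃ C : ℝ, ∀ ε : ℝ, 0 < ε → ε ≤ 1 → ∃ Q : Algorithm c, IsQMCMultilevel b α c L a Q ∧
        worstCaseError α (podWeights Γ γ) Q ≤ ENNReal.ofReal ε ∧
        nestedCost cost Q ≤ ENNReal.ofReal (C * ε ^ (-p)) := by
  obtain ⟨C, hC, hΓ⟩ := hΓ
  have hΓ' : ∀ u, (podWeights Γ γ u : ℝ) ≤
      max C 1 * podProd (max q 0) (fun j => (γ j : ℝ)) u := by
    refine podWeights_le hΓ0 (fun k hk => (hΓ k hk).trans ?_) (le_max_right _ _)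
    have hk : (1 : ℝ) ≤ k.factorial := by exact_mod_cast k.factorial_pos
    exact mul_le_mul (le_max_left _ _) (Real.rpow_le_rpow_of_exponent_le hk (le_max_left _ _))
      (by positivity) (by positivity)
  have hC1 : 0 ≤ max C 1 := by positivity
  have hq0 : ((max q 0 : ℝ) : EReal) < decay (sobKernel α c) (podWeights Γ γ) 1 := by
    rcases max_cases q 0 with h | h <;> rw [h.1]
    · exact hq
    · exact lt_trans (by exact_mod_cast one_pos) hd1
  have hK := kernelMean_pos hα c
  constructor
  · obtain ⟨x, hx, hx'⟩ := EReal.lt_iff_exists_real_btwn.1 (max_lt hd1 hq0)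
    obtain ⟨hx1, hxq⟩ := max_lt_iff.1 hx
    obtain ⟨Cγ, -, hCγ⟩ := exists_le_of_lt_decay hΓ1 hγ hK hx'
    exact summable_podWeights_mul_pow α (le_max_right _ _) (by exact_mod_cast hxq)
      (by exact_mod_cast hx1) hCγ hC1 hΓ'
  · intro p hp hpα hp2 hps b _ L a hL ha
    obtain ⟨x, hx, hx'⟩ := EReal.lt_iff_exists_real_btwn.1
      (max_lt (max_lt hd1 hq0) (max_lt hp2 hps))
    obtain ⟨hx12, hx34⟩ := max_lt_iff.1 hx
    obtain ⟨hx1, hxq⟩ := max_lt_iff.1 hx12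
    obtain ⟨hx2, hxs⟩ := max_lt_iff.1 hx34
    rw [EReal.coe_lt_coe_iff] at hxq hx2 hxs
    obtain ⟨Cγ, -, hCγ⟩ := exists_le_of_lt_decay hΓ1 hγ hK hx'
    rw [div_lt_iff₀ hp] at hx2
    have hxs' : 2 * s / p < x - 1 := by linarith
    rw [div_lt_iff₀ hp] at hxs'
    exact exists_multilevel_le b hα c h1 hmono hs hcost (le_max_right _ _) hxq
      (by exact_mod_cast hx1) hCγ hC1 hΓ' hL ha hp hpα (by linarith) (by linarith)

end

/-! ### Assembly of the bounds in the different regimes. -/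

theorem mainTheorem1
    (α : ℕ) (hα : 1 ≤ α) (c : unitInterval)
    (cost : ℕ → ℝ) (cost_one_le : ∀ k, 1 ≤ cost k) (cost_mono : Monotone cost)
    (s : ℝ) (hs : 0 ≤ s)
    (hcost : Asymptotics.IsTheta atTop cost fun k : ℕ => (k : ℝ) ^ s)
    (Γ γ : ℕ → ℝ≥0) (hγ : Antitone γ) (hΓ0 : Γ 0 = 1) (hΓ1 : Γ 1 = 1)
    (hactive : ∃ u : Finset ℕ, u.Nonempty ∧ 0 < podWeights Γ γ u)
    (d : EReal) (hd : d = decay (sobKernel α c) (podWeights Γ γ) 1) (hd1 : 1 < d)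
    (q : ℝ) (hq : (q : EReal) < d)
    (hΓ : ∃ C : ℝ, 0 < C ∧ ∀ k : ℕ, 1 ≤ k → (Γ k : ℝ) ≤ C * (k.factorial : ℝ) ^ q) :
    StronglyTractable α c (podWeights Γ γ) cost ∧
    ((2 * α - 1) / (2 * α) ≤ s →
      pNes α c (podWeights Γ γ) cost =
          max ((1 / α : ℝ) : EReal) (((2 * s : ℝ) : EReal) / (d - 1)) ∧
        MultilevelAttains α c (podWeights Γ γ) cost
          (max ((1 / α : ℝ) : EReal) (((2 * s : ℝ) : EReal) / (d - 1)))) ∧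
    (s < (2 * α - 1) / (2 * α) →
      (((2 * α : ℝ) : EReal) ≤ d →
        pNes α c (podWeights Γ γ) cost = ((1 / α : ℝ) : EReal) ∧
          MultilevelAttains α c (podWeights Γ γ) cost ((1 / α : ℝ) : EReal)) ∧
      (((1 / (1 - s) : ℝ) : EReal) < d → d < ((2 * α : ℝ) : EReal) →
        max ((1 / α : ℝ) : EReal) (((2 * s : ℝ) : EReal) / (d - 1)) ≤
            pNes α c (podWeights Γ γ) cost ∧
          pNes α c (podWeights Γ γ) cost ≤ 2 / d ∧
          MultilevelAttains α c (podWeights Γ γ) cost (2 / d)) ∧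
      (d ≤ ((1 / (1 - s) : ℝ) : EReal) →
        pNes α c (podWeights Γ γ) cost = ((2 * s : ℝ) : EReal) / (d - 1) ∧
          MultilevelAttains α c (podWeights Γ γ) cost (((2 * s : ℝ) : EReal) / (d - 1)))) := by
  have hα' : (1 : ℝ) ≤ α := by exact_mod_cast hα
  have hα0 : (0 : ℝ) < α := by linarith
  obtain ⟨hsum, hattain⟩ := exists_summable_and_multilevel hα c cost_one_le cost_mono hs hcost hγ
    hΓ0 hΓ1 (hd ▸ hd1) (hd ▸ hq) hΓ
  rw [← hd] at hattain
  have htract : ∀ p : ℝ, 0 < p → 1 < p * α → ((2 / p : ℝ) : EReal) < d →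
      ((1 + 2 * s / p : ℝ) : EReal) < d → TractableWith α c (podWeights Γ γ) cost p :=
    fun p hp hpα hp2 hps => by
    have : Fact (Nat.Prime 2) := ⟨Nat.prime_two⟩
    obtain ⟨C, hC⟩ := hattain p hp hpα hp2 hps 2 1 2 le_rfl one_lt_two
    refine tractableWith_of_forall_le_one hα hsum hp.le (C := C) fun ε hε hε1 => ?_
    obtain ⟨Q, -, hQ⟩ := hC ε hε hε1
    exact ⟨Q, hQ⟩
  -- In each regime it remains to check that every `p > V` exceeds `1/α`, `2/d` and `2s/(d-1)`.
  have hupper : ∀ V : EReal, (∀ p : ℝ, V < p → 0 < p ∧ 1 < p * α ∧ ((2 / p : ℝ) : EReal) < d ∧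
      ((1 + 2 * s / p : ℝ) : EReal) < d) → pNes α c (podWeights Γ γ) cost ≤ V ∧
      MultilevelAttains α c (podWeights Γ γ) cost V := fun V hV => by
    constructor
    · refine le_of_forall_gt_imp_ge_of_dense fun W hW => ?_
      obtain ⟨p, hp, hp'⟩ := EReal.lt_iff_exists_real_btwn.1 hW
      obtain ⟨h0, h1, h2, h3⟩ := hV p hp
      have : pNes α c (podWeights Γ γ) cost ≤ p := sInf_le ⟨p, rfl, htract p h0 h1 h2 h3⟩
      exact this.trans hp'.le
    · intro b _ L a hL ha p hp
      obtain ⟨h0, h1, h2, h3⟩ := hV p hp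
      exact hattain p h0 h1 h2 h3 b L a hL ha
  have hlower : ((1 / α : ℝ) : EReal) ≤ pNes α c (podWeights Γ γ) cost ∧
      ((2 * s : ℝ) : EReal) / (d - 1) ≤ pNes α c (podWeights Γ γ) cost := by
    have h0 : 0 < podWeights Γ γ {0} := by
      rw [podWeights_singleton hΓ1]
      exact pos_of_podWeights_pos hγ hactive
    have h1 : ∀ r, TractableWith α c (podWeights Γ γ) cost r → 1 / (α : ℝ) ≤ r := fun r hr =>
      (TractableWith.reachesWith hr).one_div_le hα hsum h0 cost_one_le hr.1
    refine ⟨le_sInf ?_, le_sInf ?_⟩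
    · rintro _ ⟨r, rfl, hr⟩
      exact_mod_cast h1 r hr
    · rintro _ ⟨r, rfl, hr⟩
      have hr0 : 0 < r := lt_of_lt_of_le (by positivity) (h1 r hr)
      refine two_mul_div_le hr0 hd1 ?_
      -- For `s = 0` the cost puts no restriction on the number of variables, and the claim reduces
      -- to `1 ≤ d`.
      rcases hs.eq_or_lt with rfl | hs0
      · simpa using hd1.le
      · obtain ⟨C, hC⟩ := (TractableWith.reachesWith hr).exists_weight_le hα hγ
          (podWeights_singleton hΓ1) hsum cost_one_le hs0 hcost hr0
        rw [hd]
        exact le_decay hΓ1 hγ (kernelMean_pos hα c) hC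
  have hαp : ∀ p : ℝ, 1 / (α : ℝ) < p → 0 < p ∧ 1 < p * α := fun p hp =>
    ⟨lt_trans (by positivity) hp, (div_lt_iff₀ hα0).1 hp⟩
  -- If `p ≥ 2(1 - s)`, the requirement `p > 2/d` is already contained in `p > 2s/(d-1)`.
  have htwo : ∀ p : ℝ, 0 < p → 2 ≤ p + 2 * s → ((1 + 2 * s / p : ℝ) : EReal) < d →
      ((2 / p : ℝ) : EReal) < d := fun p hp h h' => by
    refine lt_of_le_of_lt (EReal.coe_le_coe_iff.2 ?_) h'
    rw [← div_self hp.ne', ← add_div]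
    exact div_le_div_of_nonneg_right h hp.le
  refine ⟨?_, fun hsα => ?_, fun hsα => ⟨fun hdα => ?_, fun hds hdα => ?_, fun hds => ?_⟩⟩
  · obtain ⟨x, hx, hx'⟩ := EReal.lt_iff_exists_real_btwn.1 hd1
    have hx1 : 1 < x := by exact_mod_cast hx
    have hy : 0 < x - 1 := by linarith
    have h2 : 0 ≤ 2 * s / (x - 1) := by positivity
    have hp : 0 < 2 + 2 * s / (x - 1) := by linarith
    have hps : ((1 + 2 * s / (2 + 2 * s / (x - 1)) : ℝ) : EReal) < d := by
      refine lt_trans (EReal.coe_lt_coe_iff.2 ?_) hx'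
      have : 2 * s / (2 + 2 * s / (x - 1)) < x - 1 := by
        rw [div_lt_iff₀ hp, mul_add, mul_div_cancel₀ _ hy.ne']
        linarith
      linarith
    exact ⟨2 + 2 * s / (x - 1), htract _ hp (by nlinarith) (htwo _ hp (by linarith) hps) hps⟩
  -- Here `2(1 - s) ≤ 1/α < p`, so the requirement from `2/d` is void.
  · rw [div_le_iff₀ (by positivity)] at hsα
    obtain ⟨h1, h2⟩ := hupper (max ((1 / α : ℝ) : EReal) (((2 * s : ℝ) : EReal) / (d - 1)))
      fun p hp => by
      obtain ⟨hp1, hp2⟩ := max_lt_iff.1 hp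
      obtain ⟨hp0, hpα⟩ := hαp p (EReal.coe_lt_coe_iff.1 hp1)
      have hps := one_add_two_mul_div_lt hp0 hd1 hp2
      exact ⟨hp0, hpα, htwo p hp0 (by nlinarith) hps, hps⟩
    exact ⟨le_antisymm h1 (max_le hlower.1 hlower.2), h2⟩
  -- For `d ≥ 2α`, both `2/d` and `2s/(d-1)` are at most `1/α`.
  · rw [lt_div_iff₀ (by positivity)] at hsα
    obtain ⟨h1, h2⟩ := hupper ((1 / α : ℝ) : EReal) fun p hp => by
      obtain ⟨hp0, hpα⟩ := hαp p (EReal.coe_lt_coe_iff.1 hp)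
      refine ⟨hp0, hpα, lt_of_lt_of_le (EReal.coe_lt_coe_iff.2 ?_) hdα,
        lt_of_lt_of_le (EReal.coe_lt_coe_iff.2 ?_) hdα⟩
      · rw [div_lt_iff₀ hp0]
        nlinarith
      · have : 2 * s / p ≤ s * (2 * α) := by
          rw [div_le_iff₀ hp0]
          nlinarith
        linarith
    exact ⟨le_antisymm h1 hlower.1, h2⟩
  -- Here `2/d` is the largest of the three: `d < 2α` compares it with `1/α`, and `d > 1/(1-s)` with
  -- `2s/(d-1)`.
  · refine ⟨max_le hlower.1 hlower.2, hupper _ fun p hp => ?_⟩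
    have hs1 : s < 1 := hsα.trans_le (div_le_one_of_le₀ (by linarith) (by positivity))
    induction d with
    | bot => simp at hd1
    | top => simp at hdα
    | coe x =>
      have hx1 : 1 < x := by exact_mod_cast hd1
      rw [EReal.coe_lt_coe_iff] at hds hdα
      rw [div_lt_iff₀ (by linarith)] at hds
      have hp' : 2 / x < p := EReal.coe_lt_coe_iff.1 hp
      rw [div_lt_iff₀ (by linarith)] at hp'
      have hp0 : 0 < p := by nlinarith
      refine ⟨hp0, by nlinarith, EReal.coe_lt_coe_iff.2 ?_, EReal.coe_lt_coe_iff.2 ?_⟩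
      · rw [div_lt_iff₀ hp0]
        linarith
      · have : 2 * s / p ≤ s * x := by
          rw [div_le_iff₀ hp0]
          nlinarith
        linarith
  · have hs1 : s < 1 := hsα.trans_le (div_le_one_of_le₀ (by linarith) (by positivity))
    rw [lt_div_iff₀ (by positivity)] at hsα
    have hs0 : 0 < s := by
      have h : (1 : ℝ) < 1 / (1 - s) := by exact_mod_cast hd1.trans_le hds
      rw [lt_div_iff₀ (by linarith)] at h
      linarith
    obtain ⟨h1, h2⟩ := hupper (((2 * s : ℝ) : EReal) / (d - 1)) fun p hp => by
      have hp0 : 0 < p := by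
        exact_mod_cast (two_mul_div_sub_one_nonneg hs hd1).trans_lt hp
      have hps := one_add_two_mul_div_lt hp0 hd1 hp
      -- From `1 + 2s/p < d ≤ 1/(1-s)`. It removes the requirement from `2/d`, and also gives `p >
      -- 1/α`, because `s < 1 - 1/(2α)`.
      have h3 : 2 * (1 - s) < p := by
        have h := EReal.coe_lt_coe_iff.1 (hps.trans_le hds)
        rw [lt_div_iff₀ (by linarith)] at h
        have h' : 2 * s / p * (1 - s) < s := by linarith
        rw [div_mul_eq_mul_div, div_lt_iff₀ hp0] at h'
        nlinarith
      exact ⟨hp0, by nlinarith, htwo p hp0 (by linarith) hps, hps⟩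
    exact ⟨le_antisymm h1 hlower.2, h2⟩
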